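/- Let $d\ge 1$. All functions are real-valued, and $L^p=L^p(\mathbb R^d,dx)$. For $k\in\mathbb N^d$ let $h_k(x)=\prod_{i=1}^d h_{k_i}(x_i)$ be the $L^2$-normalized Hermite functions, where $h_n(x)=(2^n n!\sqrt\pi)^{-1/2}H_n(x)e^{-x^2/2}$ for $n\in\mathbb N=\{0,1,2,\dots\}$ and $H_n$ is the $n$-th (physicists') Hermite polynomial. They are eigenfunctions of the harmonic oscillator $L=-\Delta+|x|^2$ with eigenvalues $\lambda_k=2(k_1+\dots+k_d)+d$. For $i=1,\dots,d$ let $\delta_i=\partial_{x_i}+x_i$. The Riesz transforms $R_i=\delta_iL^{-1/2}$ are defined on $L^2$ by the $L^2$-convergent series $$R_if=\sum_{k\in\mathbb N^d}\lambda_k^{-1/2}\Big(\int_{\mathbb R^d}f\,h_k\,dx\Big)\,\delta_ih_k,\qquad f\in L^2,$$ and $\mathbf Rf=(R_1f,\dots,R_df)$. For $1<p<\infty$ put $p^*=\max\big(p,\tfrac{p}{p-1}\big)$, and for $\mathbf g=(g_1,\dots,g_d)$ put $\|\mathbf g\|_p=\big\|(\sum_{i=1}^d|g_i|^2)^{1/2}\big\|_{L^p}$.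 Theorem. For every $1<p<\infty$, the operator $\mathbf R$, restricted to $L^p\cap L^2$, extends uniquely to a bounded linear operator, still denoted by $\mathbf R$, from $L^p(\mathbb R^d)$ to $L^p(\mathbb R^d;\mathbb R^d)$, and $$\|\mathbf Rf\|_p\le 48\,(p^*-1)\,\|f\|_p,\qquad f\in L^p.$$ In particular, the constant does not depend on $d$. -/

import Mathlib

open MeasureTheory Filter Topology

noncomputable section

namespace HarmonicOscillator

/-- The space `ℝ^d` with its Euclidean norm and Lebesgue measure. -/
abbrev Space (d : ℕ) : Type := EuclideanSpace ℝ (Fin d)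

/-- The `L²(ℝ, dx)`-normalized one-dimensional Hermite function
`h_n(x) = (2^n n! √π)^(-1/2) H_n(x) e^(-x²/2)`, where `H_n` is the physicists' Hermite polynomial.
Mathlib's `Polynomial.hermite n` is the probabilists' polynomial `He_n`, and
`H_n(x) = 2^(n/2) He_n(√2 x)`. -/
def hermiteFun (n : ℕ) (x : ℝ) : ℝ :=
  (√((n.factorial : ℝ) * √Real.pi))⁻¹ *
    Polynomial.aeval (√2 * x) (Polynomial.hermite n) * Real.exp (-x ^ 2 / 2)

/-- The tensor product Hermite function `h_k = h_{k_1} ⊗ ⋯ ⊗ h_{k_d}` on `ℝ^d`, for `k ∈ ℕ^d`. -/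
def hermiteFunction {d : ℕ} (k : Fin d → ℕ) (x : Space d) : ℝ :=
  ∏ i, hermiteFun (k i) (x i)

/-- The eigenvalue `2|k| + d` of the harmonic oscillator `-Δ + |x|²` belonging to `h_k`. -/
def eigenvalue {d : ℕ} (k : Fin d → ℕ) : ℝ := 2 * (∑ i, (k i : ℝ)) + d

/-- The first order operator `δ_i = ∂_{x_i} + x_i`. -/
def delta {d : ℕ} (i : Fin d) (u : Space d → ℝ) (x : Space d) : ℝ :=
  lineDeriv ℝ u x (EuclideanSpace.single i 1) + x i * u x

/-- The partial sum over `s` of the series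
`R_i f = ∑_k λ_k^(-1/2) ⟨f, h_k⟩ δ_i h_k` defining the `i`-th Riesz transform
`R_i = δ_i L^(-1/2)`. -/
def rieszPartialSum {d : ℕ} (i : Fin d) (f : Space d → ℝ) (s : Finset (Fin d → ℕ))
    (x : Space d) : ℝ :=
  ∑ k ∈ s, (√(eigenvalue k))⁻¹ * (∫ y, f y * hermiteFunction k y) *
    delta i (hermiteFunction k) x

/-- `g = (g_1, …, g_d)` is the vector of Riesz transforms `𝐑 f = (R_1 f, …, R_d f)` of the
function `f ∈ L²`: each `g_i` is in `L²` and is the sum in `L²` of the series for `R_i f`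
(over the index set `ℕ^d`, unconditionally). This determines `g` up to a null set. -/
def IsRieszVector {d : ℕ} (f : Space d → ℝ) (g : Space d → Space d) : Prop :=
  ∀ i : Fin d, MemLp (fun x => g x i) 2 volume ∧
    Tendsto (fun s : Finset (Fin d → ℕ) =>
      eLpNorm (fun x => rieszPartialSum i f s x - g x i) 2 volume) atTop (𝓝 0)

/-- `T` is a bounded linear operator from `L^p(ℝ^d)` to `L^p(ℝ^d; ℝ^d)` that agrees with the
vector of Riesz transforms on `L^p ∩ L²`. -/
def IsRieszExtension {d : ℕ} (p : ℝ)
    (T : Lp ℝ (ENNReal.ofReal p) (volume : Measure (Space d)) →ₗ[ℝ]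
      Lp (Space d) (ENNReal.ofReal p) (volume : Measure (Space d))) : Prop :=
  (∃ C : ℝ, ∀ f, ‖T f‖ ≤ C * ‖f‖) ∧
    ∀ f : Lp ℝ (ENNReal.ofReal p) (volume : Measure (Space d)),
      MemLp f 2 volume → IsRieszVector f (T f)

/-- `p^* = max(p, p/(p-1))`. -/
def pStar (p : ℝ) : ℝ := max p (p / (p - 1))

end HarmonicOscillator

end

/-!
The Riesz transforms are bounded on `L^p` with a constant free of the dimension by a Bellman
function argument, run on Poisson extensions.

Let `f` be a finite Hermite expansion with real coefficients and `g` one with coefficients in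
`ℝ^d`, and put `u(t) = e^{-t√L} f` and `v(t) = e^{-t√(L+2)} g`. Since `δ_i` maps `h_k` to a multiple
of `h_{k - e_i}`, it intertwines `√L` with `√(L+2)`. Hence the pairing `∫ ⟨𝐑 f, g⟩` is the value at
`t = 0` of a function `Ψ(t)` that decays exponentially and satisfies `Ψ'' = -4 ∫ ∑_i (δ_i u) (∂_t v)_i`
(`integral_rieszExpansion_mul`, `integral_pairingDensity`).

The Bellman function is `F(r, s) = r^a + s^b + γ r (r^a + s^b)^{1 - 1/a}` with
`r = |U|² + ε` and `s = |V|² + ε`, where `2a` and `2b` are the conjugate exponents in the order that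
makes `a ≥ 1`; the two functions `u` and `v` take the places of `U` and `V`, or the other way round.
It is smooth because `ε > 0`, is of the size of `|U|^{2a} + |V|^{2b}`, and its second derivative in
the direction of `(U', V')` dominates a multiple of `τ |U'|² + |V'|² / τ` with a suitable weight `τ`.
So `Φ(t) = ∫ F(|U|² + ε, |V|² + ε) - F(ε, ε) dx` is a convex function of `t` whose second derivative
controls `|Ψ''|` by the inequality of the geometric and arithmetic means; the potentials `|x|² + σ`
enter with a favourable sign and absorb the zero order term of `δ_i`. Thus `c Φ ± Ψ` are convex
functions that tend to `0` at infinity, so they are nonnegative, and at `t = 0` this bounds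
`∫ ⟨𝐑 f, g⟩` by a multiple of `‖f‖_p^p + ‖g‖_q^q`. After scaling it becomes
`|∫ ⟨𝐑 f, g⟩| ≤ 36 (p^* - 1) ‖f‖_p ‖g‖_q` (`abs_integral_rieszExpansion_mul_le_mul`).

Hermite expansions are dense in `L^p ∩ L^q` simultaneously (`exists_eLpNorm_sub_expansion_le`): with
respect to the finite measure `e^{-|x|²/2} dx`, polynomials approximate trigonometric polynomials by
Taylor's formula, and these approximate bounded continuous functions by the Stone-Weierstrass
theorem. So the duality of `L^p` and `L^q` gives the norm bound on expansions, and the operator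
`rieszLp` is the extension by density. On `L^p ∩ L²` it is given by the Hermite series, because the
partial sums are contractions of `L²` and limits in `L^p` and in `L²` of the same sequence agree
almost everywhere (`isRieszVector_rieszLp`). Uniqueness follows from the density of the expansions.
-/

namespace HarmonicOscillator

/-! ### One-dimensional Hermite functions -/

theorem derivative_hermite_succ (n : ℕ) :
    Polynomial.derivative (Polynomial.hermite (n + 1)) =
      ((n : Polynomial ℤ) + 1) * Polynomial.hermite n := by
  induction n with
  | zero => simp [Polynomial.hermite_succ]
  | succ n ih =>
    rw [Polynomial.hermite_succ (n + 1)]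
    simp only [Polynomial.derivative_sub, Polynomial.derivative_mul, Polynomial.derivative_X, ih,
      Polynomial.derivative_add, Polynomial.derivative_natCast, Polynomial.derivative_one]
    conv_rhs => rw [Polynomial.hermite_succ n]
    push_cast
    rw [Polynomial.hermite_succ n]
    ring

theorem hermiteFun_zero (x : ℝ) :
    hermiteFun 0 x = (√(√Real.pi))⁻¹ * Real.exp (-x ^ 2 / 2) := by
  simp [hermiteFun]

/-- The derivative of a Hermite function, before it is rewritten by a ladder relation. -/
theorem hasDerivAt_hermiteFun_aux (n : ℕ) (x : ℝ) :
    HasDerivAt (hermiteFun n)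
      ((√((n.factorial : ℝ) * √Real.pi))⁻¹ *
        (√2 * Polynomial.aeval (√2 * x) (Polynomial.derivative (Polynomial.hermite n))) *
          Real.exp (-x ^ 2 / 2) - x * hermiteFun n x) x := by
  have h1 : HasDerivAt (fun y : ℝ => Polynomial.aeval (√2 * y) (Polynomial.hermite n))
      (Polynomial.aeval (√2 * x) (Polynomial.derivative (Polynomial.hermite n)) * (√2 * 1)) x :=
    (Polynomial.hasDerivAt_aeval (Polynomial.hermite n) (√2 * x)).comp x
      ((hasDerivAt_id x).const_mul (√2))
  have h2 : HasDerivAt (fun y : ℝ => Real.exp (-y ^ 2 / 2)) (Real.exp (-x ^ 2 / 2) * (-x)) x := by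
    have : HasDerivAt (fun y : ℝ => -y ^ 2 / 2) (-x) x := by
      have := ((hasDerivAt_id x).pow 2).neg.div_const 2
      convert! this using 1
      simp
      ring
    exact this.exp
  have h3 := (h1.const_mul ((√((n.factorial : ℝ) * √Real.pi))⁻¹)).mul h2
  convert! h3 using 1
  simp only [hermiteFun]
  ring

theorem sqrt_factorial_succ (n : ℕ) :
    (√(((n + 1).factorial : ℝ) * √Real.pi))⁻¹ * √((n : ℝ) + 1) =
      (√((n.factorial : ℝ) * √Real.pi))⁻¹ := by
  have hn : (0 : ℝ) < (n : ℝ) + 1 := by positivity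
  have hf : (0 : ℝ) < (n.factorial : ℝ) * √Real.pi := by positivity
  rw [Nat.factorial_succ]
  push_cast
  rw [mul_assoc, Real.sqrt_mul hn.le, mul_inv]
  field_simp

/-- The annihilation operator `d/dx + x` lowers the degree of a Hermite function. -/
theorem hasDerivAt_hermiteFun (n : ℕ) (x : ℝ) :
    HasDerivAt (hermiteFun n) (√(2 * n) * hermiteFun (n - 1) x - x * hermiteFun n x) x := by
  convert! hasDerivAt_hermiteFun_aux n x using 2
  cases n with
  | zero => simp
  | succ n =>
    rw [derivative_hermite_succ, Nat.add_sub_cancel, hermiteFun, ← sqrt_factorial_succ n]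
    have hn : (0 : ℝ) ≤ (n : ℝ) + 1 := by positivity
    have : √(2 * ((n + 1 : ℕ) : ℝ)) * √((n : ℝ) + 1) = √2 * ((n : ℝ) + 1) := by
      push_cast
      rw [Real.sqrt_mul (by norm_num), mul_assoc, Real.mul_self_sqrt hn]
    simp only [map_mul, map_add, map_natCast, map_one]
    linear_combination ((√(((n + 1).factorial : ℝ) * √Real.pi))⁻¹ *
      (Polynomial.aeval (√2 * x) (Polynomial.hermite n)) * Real.exp (-x ^ 2 / 2)) * this

/-- The three-term recurrence of the Hermite functions, in terms of the creation operator
`x - d/dx = 2x - (d/dx + x)`. -/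
theorem hermiteFun_succ (n : ℕ) (x : ℝ) :
    √(2 * ((n : ℝ) + 1)) * hermiteFun (n + 1) x =
      2 * x * hermiteFun n x - √(2 * n) * hermiteFun (n - 1) x := by
  have h1 := (hasDerivAt_hermiteFun n x).unique (hasDerivAt_hermiteFun_aux n x)
  have h2 : √(2 * ((n : ℝ) + 1)) = √2 * √((n : ℝ) + 1) := Real.sqrt_mul (by norm_num) _
  have h3 : √(2 : ℝ) * √2 = 2 := Real.mul_self_sqrt (by norm_num)
  rw [sub_left_inj] at h1
  rw [h1, h2]
  simp only [hermiteFun]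
  rw [Polynomial.hermite_succ, ← sqrt_factorial_succ n]
  simp only [map_mul, map_sub, Polynomial.aeval_X]
  linear_combination ((√(((n + 1).factorial : ℝ) * √Real.pi))⁻¹ * √((n : ℝ) + 1) * x *
      (Polynomial.aeval (√2 * x) (Polynomial.hermite n)) * Real.exp (-x ^ 2 / 2)) * h3

/-- Multiplication by the coordinate, as a combination of neighbouring Hermite functions. -/
theorem mul_hermiteFun (n : ℕ) (x : ℝ) :
    x * hermiteFun n x =
      √(2 * ((n : ℝ) + 1)) / 2 * hermiteFun (n + 1) x + √(2 * n) / 2 * hermiteFun (n - 1) x := by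
  linear_combination (-1 / 2) * hermiteFun_succ n x

theorem continuous_hermiteFun (n : ℕ) : Continuous (hermiteFun n) :=
  continuous_iff_continuousAt.2 fun x => (hasDerivAt_hermiteFun n x).continuousAt

/-- The harmonic oscillator equation `h_n'' = (x² - (2n+1)) h_n`, as a derivative of the
expression for `h_n'`. -/
theorem hasDerivAt_deriv_hermiteFun (n : ℕ) (x : ℝ) :
    HasDerivAt (fun x => √(2 * n) * hermiteFun (n - 1) x - x * hermiteFun n x)
      ((x ^ 2 - (2 * n + 1)) * hermiteFun n x) x := by
  have h := ((hasDerivAt_hermiteFun (n - 1) x).const_mul (√(2 * n))).sub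
    ((hasDerivAt_id x).mul (hasDerivAt_hermiteFun n x))
  convert! h using 1
  cases n with
  | zero => simp; ring
  | succ n =>
    have h3 := hermiteFun_succ n x
    have h4 : √(2 * ((n : ℝ) + 1)) * √(2 * ((n : ℝ) + 1)) = 2 * ((n : ℝ) + 1) :=
      Real.mul_self_sqrt (by positivity)
    simp only [Nat.add_sub_cancel, id]
    push_cast
    linear_combination (-√(2 * ((n : ℝ) + 1))) * h3 + hermiteFun (n + 1) x * h4

/-- Hermite functions decay like a Gaussian of half the exponent. -/
theorem exists_abs_hermiteFun_le (n : ℕ) :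
    ∃ C, ∀ x, |hermiteFun n x| ≤ C * Real.exp (-x ^ 2 / 4) := by
  suffices h : ∀ P : Polynomial ℝ, ∃ C, ∀ x : ℝ, |P.eval x| ≤ C * Real.exp (x ^ 2 / 4) by
    obtain ⟨C, hC⟩ := h (((Polynomial.hermite n).map (algebraMap ℤ ℝ)).comp
      (Polynomial.C √2 * Polynomial.X))
    refine ⟨(√((n.factorial : ℝ) * √Real.pi))⁻¹ * C, fun x => ?_⟩
    have h1 := hC x
    simp only [Polynomial.eval_comp, Polynomial.eval_mul, Polynomial.eval_C,
      Polynomial.eval_X] at h1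
    rw [Polynomial.eval_map_algebraMap] at h1
    rw [hermiteFun, abs_mul, abs_mul, Real.abs_exp, abs_of_nonneg (by positivity)]
    calc _ ≤ (√((n.factorial : ℝ) * √Real.pi))⁻¹ * (C * Real.exp (x ^ 2 / 4)) *
          Real.exp (-x ^ 2 / 2) := by gcongr
      _ = (√((n.factorial : ℝ) * √Real.pi))⁻¹ * C *
          (Real.exp (x ^ 2 / 4) * Real.exp (-x ^ 2 / 2)) := by ring
      _ = _ := by
        rw [← Real.exp_add]
        congr 2
        ring
  intro P
  induction P using Polynomial.induction_on' with
  | add p q hp hq =>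
    obtain ⟨C, hC⟩ := hp
    obtain ⟨D, hD⟩ := hq
    refine ⟨C + D, fun x => ?_⟩
    rw [Polynomial.eval_add, add_mul]
    exact (abs_add_le _ _).trans (add_le_add (hC x) (hD x))
  | monomial m a =>
    refine ⟨|a| * (2 ^ m * m.factorial * Real.exp 1), fun x => ?_⟩
    rw [Polynomial.eval_monomial, abs_mul, abs_pow, mul_assoc]
    refine mul_le_mul_of_nonneg_left ?_ (abs_nonneg a)
    have h1 : (|x| / 2) ^ m / m.factorial ≤ Real.exp (|x| / 2) :=
      Real.pow_div_factorial_le_exp _ (by positivity) m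
    have h2 : Real.exp (|x| / 2) ≤ Real.exp 1 * Real.exp (x ^ 2 / 4) := by
      rw [← Real.exp_add]
      refine Real.exp_le_exp.2 ?_
      nlinarith [sq_abs x, sq_nonneg (|x| - 1)]
    have h3 : (0 : ℝ) < m.factorial := by positivity
    rw [div_le_iff₀ h3, div_pow, div_le_iff₀ (by positivity)] at h1
    calc |x| ^ m ≤ Real.exp (|x| / 2) * m.factorial * 2 ^ m := h1
      _ ≤ (Real.exp 1 * Real.exp (x ^ 2 / 4)) * m.factorial * 2 ^ m := by gcongr
      _ = _ := by ring

theorem integrable_hermiteFun_mul (n m : ℕ) :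
    Integrable (fun x => hermiteFun n x * hermiteFun m x) := by
  obtain ⟨C, hC⟩ := exists_abs_hermiteFun_le n
  obtain ⟨D, hD⟩ := exists_abs_hermiteFun_le m
  have hG : Integrable (fun x : ℝ => C * D * Real.exp (-(1 / 2) * x ^ 2)) :=
    (integrable_exp_neg_mul_sq (by norm_num)).const_mul _
  refine hG.mono' ((continuous_hermiteFun n).mul
    (continuous_hermiteFun m)).aestronglyMeasurable (ae_of_all _ fun x => ?_)
  rw [Real.norm_eq_abs, abs_mul]
  calc _ ≤ (C * Real.exp (-x ^ 2 / 4)) * (D * Real.exp (-x ^ 2 / 4)) :=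
        mul_le_mul (hC x) (hD x) (abs_nonneg _) ((abs_nonneg _).trans (hC x))
    _ = C * D * (Real.exp (-x ^ 2 / 4) * Real.exp (-x ^ 2 / 4)) := by ring
    _ = _ := by
      rw [← Real.exp_add]
      congr 2
      ring

/-- The creation and annihilation operators are adjoint to each other. -/
theorem integral_hermiteFun_mul_ladder (n m : ℕ) :
    √(2 * ((n : ℝ) + 1)) * ∫ x, hermiteFun (n + 1) x * hermiteFun m x =
      √(2 * m) * ∫ x, hermiteFun n x * hermiteFun (m - 1) x := by
  have key : ∫ x, (hermiteFun n x * (√(2 * m) * hermiteFun (m - 1) x - x * hermiteFun m x) +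
      (√(2 * n) * hermiteFun (n - 1) x - x * hermiteFun n x) * hermiteFun m x) = 0 := by
    have i1 : Integrable (fun x => x * hermiteFun n x * hermiteFun m x) := by
      have := ((integrable_hermiteFun_mul (n + 1) m).const_mul (√(2 * ((n : ℝ) + 1)) / 2)).add
        ((integrable_hermiteFun_mul (n - 1) m).const_mul (√(2 * n) / 2))
      refine this.congr (ae_of_all _ fun x => ?_)
      simp only [Pi.add_apply, mul_hermiteFun n x]
      ring
    have j1 : Integrable (fun x => hermiteFun n x *
        (√(2 * m) * hermiteFun (m - 1) x - x * hermiteFun m x)) := by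
      refine (((integrable_hermiteFun_mul n (m - 1)).const_mul (√(2 * m))).sub i1).congr
        (ae_of_all _ fun x => ?_)
      simp only [Pi.sub_apply]
      ring
    have j2 : Integrable (fun x => (√(2 * n) * hermiteFun (n - 1) x - x * hermiteFun n x) *
        hermiteFun m x) := by
      refine (((integrable_hermiteFun_mul (n - 1) m).const_mul (√(2 * n))).sub i1).congr
        (ae_of_all _ fun x => ?_)
      simp only [Pi.sub_apply]
      ring
    rw [integral_add j1 j2, integral_mul_deriv_eq_deriv_mul_of_integrable
      (fun x _ => hasDerivAt_hermiteFun n x) (fun x _ => hasDerivAt_hermiteFun m x) j1 j2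
      (integrable_hermiteFun_mul n m)]
    ring
  have : ∀ x, hermiteFun n x * (√(2 * m) * hermiteFun (m - 1) x - x * hermiteFun m x) +
      (√(2 * n) * hermiteFun (n - 1) x - x * hermiteFun n x) * hermiteFun m x =
      √(2 * m) * (hermiteFun n x * hermiteFun (m - 1) x) -
        √(2 * ((n : ℝ) + 1)) * (hermiteFun (n + 1) x * hermiteFun m x) := by
    intro x
    linear_combination (hermiteFun m x) * hermiteFun_succ n x
  simp only [this] at key
  rw [integral_sub ((integrable_hermiteFun_mul _ _).const_mul _)
    ((integrable_hermiteFun_mul _ _).const_mul _), integral_const_mul, integral_const_mul] at key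
  linarith

theorem integral_hermiteFun_mul (n m : ℕ) :
    ∫ x, hermiteFun n x * hermiteFun m x = if n = m then 1 else 0 := by
  induction n generalizing m with
  | zero =>
    cases m with
    | zero =>
      have h1 : ∀ x : ℝ, hermiteFun 0 x * hermiteFun 0 x =
          (√Real.pi)⁻¹ * Real.exp (-1 * x ^ 2) := by
        intro x
        have h2 : Real.exp (-x ^ 2 / 2) * Real.exp (-x ^ 2 / 2) = Real.exp (-1 * x ^ 2) := by
          rw [← Real.exp_add]
          congr 1
          ring
        have h3 : (√√Real.pi)⁻¹ * (√√Real.pi)⁻¹ = (√Real.pi)⁻¹ := by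
          rw [← mul_inv, Real.mul_self_sqrt (Real.sqrt_nonneg _)]
        rw [hermiteFun_zero, ← h2, ← h3]
        ring
      simp only [h1, if_true]
      rw [integral_const_mul, integral_gaussian, div_one]
      exact inv_mul_cancel₀ (by positivity)
    | succ m =>
      have h := integral_hermiteFun_mul_ladder m 0
      simp only [Nat.cast_zero, mul_zero, Real.sqrt_zero, zero_mul, mul_eq_zero] at h
      rcases h with h | h
      · exact absurd h (by positivity)
      · rw [if_neg (by omega), ← h]
        simp only [mul_comm]
  | succ n ih =>
    have h := integral_hermiteFun_mul_ladder n m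
    rw [ih] at h
    have h0 : √(2 * ((n : ℝ) + 1)) ≠ 0 := by positivity
    cases m with
    | zero =>
      simp only [Nat.cast_zero, mul_zero, Real.sqrt_zero, zero_mul, mul_eq_zero] at h
      simpa using h.resolve_left h0
    | succ m =>
      simp only [Nat.add_sub_cancel, Nat.add_right_cancel_iff] at h ⊢
      split_ifs at h ⊢ with hnm
      · subst hnm
        push_cast at h
        exact mul_left_cancel₀ h0 h
      · rw [mul_zero] at h
        exact (mul_eq_zero.1 h).resolve_left h0

end HarmonicOscillator

namespace HarmonicOscillator

/-! ### Hermite functions on `ℝ^d` -/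

/-- The multi-index `k - e_i`; its `i`-th entry is truncated at `0`, where the annihilation
operator produces the factor `√(2 k_i) = 0`. -/
def lower {d : ℕ} (i : Fin d) (k : Fin d → ℕ) : Fin d → ℕ := Function.update k i (k i - 1)

/-- The multi-index `k + e_i`. -/
def raise {d : ℕ} (i : Fin d) (k : Fin d → ℕ) : Fin d → ℕ := Function.update k i (k i + 1)

variable {d : ℕ}

theorem hermiteFunction_eq_mul_prod_erase (i : Fin d) (k : Fin d → ℕ) (x : Space d) :
    hermiteFunction k x =
      hermiteFun (k i) (x i) * ∏ j ∈ Finset.univ.erase i, hermiteFun (k j) (x j) :=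
  (Finset.mul_prod_erase _ _ (Finset.mem_univ i)).symm

theorem hermiteFunction_update (i : Fin d) (k : Fin d → ℕ) (n : ℕ) (x : Space d) :
    hermiteFunction (Function.update k i n) x =
      hermiteFun n (x i) * ∏ j ∈ Finset.univ.erase i, hermiteFun (k j) (x j) := by
  rw [hermiteFunction_eq_mul_prod_erase i, Function.update_self]
  congr 1
  refine Finset.prod_congr rfl fun j hj => ?_
  rw [Function.update_of_ne (Finset.ne_of_mem_erase hj)]

theorem hermiteFunction_add_smul_single (i : Fin d) (k : Fin d → ℕ) (x : Space d) (t : ℝ) :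
    hermiteFunction k (x + t • EuclideanSpace.single i (1 : ℝ)) =
      hermiteFun (k i) (x i + t) * ∏ j ∈ Finset.univ.erase i, hermiteFun (k j) (x j) := by
  rw [hermiteFunction_eq_mul_prod_erase i]
  congr 1
  · simp
  · refine Finset.prod_congr rfl fun j hj => ?_
    simp [Finset.ne_of_mem_erase hj]

/-- The partial derivative `∂_i h_k`, expressed through the annihilation relation. -/
noncomputable def partialHermite (i : Fin d) (k : Fin d → ℕ) (x : Space d) : ℝ :=
  √(2 * (k i : ℝ)) * hermiteFunction (lower i k) x - x i * hermiteFunction k x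

theorem partialHermite_eq (i : Fin d) (k : Fin d → ℕ) (x : Space d) :
    partialHermite i k x = (√(2 * (k i : ℝ)) * hermiteFun (k i - 1) (x i) -
      x i * hermiteFun (k i) (x i)) * ∏ j ∈ Finset.univ.erase i, hermiteFun (k j) (x j) := by
  rw [partialHermite, lower, hermiteFunction_update, hermiteFunction_eq_mul_prod_erase i k]
  ring

theorem hasLineDerivAt_hermiteFunction (i : Fin d) (k : Fin d → ℕ) (x : Space d) :
    HasLineDerivAt ℝ (hermiteFunction k) (partialHermite i k x) x
      (EuclideanSpace.single i (1 : ℝ)) := by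
  unfold HasLineDerivAt
  simp only [hermiteFunction_add_smul_single, partialHermite_eq]
  refine HasDerivAt.mul_const ?_ _
  have h := hasDerivAt_hermiteFun (k i) (x i + 0)
  simpa using h.comp_const_add (x i) 0

theorem hasLineDerivAt_partialHermite (i : Fin d) (k : Fin d → ℕ) (x : Space d) :
    HasLineDerivAt ℝ (partialHermite i k) ((x i ^ 2 - (2 * k i + 1)) * hermiteFunction k x) x
      (EuclideanSpace.single i (1 : ℝ)) := by
  unfold HasLineDerivAt
  have h0 : ∀ t : ℝ, partialHermite i k (x + t • EuclideanSpace.single i (1 : ℝ)) =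
      (√(2 * (k i : ℝ)) * hermiteFun (k i - 1) (x i + t) -
        (x i + t) * hermiteFun (k i) (x i + t)) *
          ∏ j ∈ Finset.univ.erase i, hermiteFun (k j) (x j) := by
    intro t
    rw [partialHermite_eq]
    congr 1
    · simp
    · refine Finset.prod_congr rfl fun j hj => ?_
      simp [Finset.ne_of_mem_erase hj]
  simp only [h0]
  rw [hermiteFunction_eq_mul_prod_erase i, ← mul_assoc]
  refine HasDerivAt.mul_const ?_ _
  have h := hasDerivAt_deriv_hermiteFun (k i) (x i + 0)
  simpa using h.comp_const_add (x i) 0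

/-- The operator `δ_i` annihilates one quantum in the `i`-th direction. -/
theorem delta_hermiteFunction (i : Fin d) (k : Fin d → ℕ) (x : Space d) :
    delta i (hermiteFunction k) x = √(2 * (k i : ℝ)) * hermiteFunction (lower i k) x := by
  rw [delta, (hasLineDerivAt_hermiteFunction i k x).lineDeriv, partialHermite]
  ring

theorem mul_hermiteFunction (i : Fin d) (k : Fin d → ℕ) (x : Space d) :
    x i * hermiteFunction k x = √(2 * ((k i : ℝ) + 1)) / 2 * hermiteFunction (raise i k) x +
      √(2 * k i) / 2 * hermiteFunction (lower i k) x := by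
  rw [raise, lower, hermiteFunction_update, hermiteFunction_update,
    hermiteFunction_eq_mul_prod_erase i k, ← mul_assoc, mul_hermiteFun]
  ring

theorem continuous_hermiteFunction (k : Fin d → ℕ) : Continuous (hermiteFunction k) := by
  unfold hermiteFunction
  refine continuous_finsetProd _ fun i _ => (continuous_hermiteFun (k i)).comp ?_
  fun_prop

theorem continuous_partialHermite (i : Fin d) (k : Fin d → ℕ) :
    Continuous (partialHermite i k) := by
  unfold partialHermite
  have := continuous_hermiteFunction k
  have := continuous_hermiteFunction (lower i k)
  fun_prop

theorem exists_abs_hermiteFunction_le (k : Fin d → ℕ) :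
    ∃ C, 0 ≤ C ∧ ∀ x, |hermiteFunction k x| ≤ C * Real.exp (-‖x‖ ^ 2 / 4) := by
  choose C hC using exists_abs_hermiteFun_le
  have hC0 : ∀ n, 0 ≤ C n := fun n => by
    have := (abs_nonneg _).trans (hC n 0)
    simpa using this
  refine ⟨∏ i, C (k i), Finset.prod_nonneg fun i _ => hC0 _, fun x => ?_⟩
  rw [hermiteFunction, Finset.abs_prod]
  calc _ ≤ ∏ i, (C (k i) * Real.exp (-(x i) ^ 2 / 4)) :=
        Finset.prod_le_prod (fun _ _ => abs_nonneg _) fun i _ => hC _ _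
    _ = _ := by
      rw [Finset.prod_mul_distrib, ← Real.exp_sum, EuclideanSpace.norm_sq_eq,
        ← Finset.sum_div, Finset.sum_neg_distrib]
      simp

theorem exists_abs_mul_hermiteFunction_le (i : Fin d) (k : Fin d → ℕ) :
    ∃ C, 0 ≤ C ∧ ∀ x : Space d, |x i * hermiteFunction k x| ≤ C * Real.exp (-‖x‖ ^ 2 / 4) := by
  obtain ⟨C, hC0, hC⟩ := exists_abs_hermiteFunction_le (raise i k)
  obtain ⟨D, hD0, hD⟩ := exists_abs_hermiteFunction_le (lower i k)
  refine ⟨√(2 * ((k i : ℝ) + 1)) / 2 * C + √(2 * k i) / 2 * D, by positivity, fun x => ?_⟩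
  rw [mul_hermiteFunction, add_mul]
  refine (abs_add_le _ _).trans (add_le_add ?_ ?_)
  · rw [abs_mul, abs_of_nonneg (by positivity), mul_assoc]
    gcongr
    exact hC x
  · rw [abs_mul, abs_of_nonneg (by positivity), mul_assoc]
    gcongr
    exact hD x

theorem exists_abs_partialHermite_le (i : Fin d) (k : Fin d → ℕ) :
    ∃ C, 0 ≤ C ∧ ∀ x : Space d, |partialHermite i k x| ≤ C * Real.exp (-‖x‖ ^ 2 / 4) := by
  obtain ⟨C, hC0, hC⟩ := exists_abs_mul_hermiteFunction_le i k
  obtain ⟨D, hD0, hD⟩ := exists_abs_hermiteFunction_le (lower i k)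
  refine ⟨√(2 * (k i : ℝ)) * D + C, by positivity, fun x => ?_⟩
  rw [partialHermite, add_mul]
  refine (abs_sub _ _).trans (add_le_add ?_ (hC x))
  rw [abs_mul, abs_of_nonneg (by positivity), mul_assoc]
  gcongr
  exact hD x

theorem exists_abs_secondPartial_hermiteFunction_le (i : Fin d) (k : Fin d → ℕ) :
    ∃ C, 0 ≤ C ∧ ∀ x : Space d, |(x i ^ 2 - (2 * k i + 1)) * hermiteFunction k x| ≤
      C * Real.exp (-‖x‖ ^ 2 / 4) := by
  obtain ⟨C, hC0, hC⟩ := exists_abs_mul_hermiteFunction_le i (raise i k)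
  obtain ⟨D, hD0, hD⟩ := exists_abs_mul_hermiteFunction_le i (lower i k)
  obtain ⟨B, hB0, hB⟩ := exists_abs_hermiteFunction_le k
  refine ⟨√(2 * ((k i : ℝ) + 1)) / 2 * C + √(2 * k i) / 2 * D + (2 * k i + 1) * B,
    by positivity, fun x => ?_⟩
  have : (x i ^ 2 - (2 * k i + 1)) * hermiteFunction k x =
      √(2 * ((k i : ℝ) + 1)) / 2 * (x i * hermiteFunction (raise i k) x) +
      √(2 * k i) / 2 * (x i * hermiteFunction (lower i k) x) -
      (2 * k i + 1) * hermiteFunction k x := by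
    linear_combination (x i) * mul_hermiteFunction i k x
  rw [this, add_mul _ _ (Real.exp _), add_mul _ _ (Real.exp _)]
  refine (abs_sub _ _).trans (add_le_add ((abs_add_le _ _).trans (add_le_add ?_ ?_)) ?_)
  · rw [abs_mul, abs_of_nonneg (by positivity), mul_assoc]
    gcongr
    exact hC x
  · rw [abs_mul, abs_of_nonneg (by positivity), mul_assoc]
    gcongr
    exact hD x
  · rw [abs_mul, abs_of_nonneg (by positivity), mul_assoc]
    gcongr
    exact hB x

theorem integrable_exp_neg_mul_norm_sq {b : ℝ} (hb : 0 < b) :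
    Integrable (fun x : Space d => Real.exp (-b * ‖x‖ ^ 2)) := by
  have h := (GaussianFourier.integrable_cexp_neg_mul_sq_norm_add (V := Space d)
    (b := (b : ℂ)) (by simpa using hb) 0 0).norm
  refine h.congr (ae_of_all _ fun x => ?_)
  simp [Complex.norm_exp, ← Complex.ofReal_pow]

theorem integral_hermiteFunction_mul (k m : Fin d → ℕ) :
    ∫ x, hermiteFunction k x * hermiteFunction m x = if k = m then 1 else 0 := by
  have h := (EuclideanSpace.volume_preserving_symm_measurableEquiv_toLp (Fin d)).integral_comp
    (MeasurableEquiv.toLp 2 (Fin d → ℝ)).symm.measurableEmbedding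
    (fun y : Fin d → ℝ => ∏ i, (hermiteFun (k i) (y i) * hermiteFun (m i) (y i)))
  rw [integral_fintype_prod_volume_eq_prod
    (f := fun i y => hermiteFun (k i) y * hermiteFun (m i) y)] at h
  simp only [integral_hermiteFun_mul] at h
  calc _ = ∏ i, (if k i = m i then (1 : ℝ) else 0) := by
        rw [← h]
        simp only [hermiteFunction, ← Finset.prod_mul_distrib]
        rfl
    _ = _ := by
      rw [Finset.prod_ite_zero]
      simp [funext_iff]

theorem integrable_hermiteFunction_mul (k m : Fin d → ℕ) :
    Integrable (fun x => hermiteFunction k x * hermiteFunction m x) := by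
  obtain ⟨C, -, hC⟩ := exists_abs_hermiteFunction_le k
  obtain ⟨D, -, hD⟩ := exists_abs_hermiteFunction_le m
  refine ((integrable_exp_neg_mul_norm_sq (d := d) (b := 1 / 2)
    (by norm_num)).const_mul (C * D)).mono'
    ((continuous_hermiteFunction k).mul (continuous_hermiteFunction m)).aestronglyMeasurable
    (ae_of_all _ fun x => ?_)
  rw [Real.norm_eq_abs, abs_mul]
  calc _ ≤ (C * Real.exp (-‖x‖ ^ 2 / 4)) * (D * Real.exp (-‖x‖ ^ 2 / 4)) :=
        mul_le_mul (hC x) (hD x) (abs_nonneg _) ((abs_nonneg _).trans (hC x))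
    _ = C * D * (Real.exp (-‖x‖ ^ 2 / 4) * Real.exp (-‖x‖ ^ 2 / 4)) := by ring
    _ = _ := by
      rw [← Real.exp_add]
      congr 2
      ring

end HarmonicOscillator

namespace HarmonicOscillator

/-! ### The Bellman function -/

/-- Half-exponents `a = P/2 ≥ 1` and `b = Q/2 ∈ (1/2, 1]` of a pair of conjugate exponents
`Q ≤ 2 ≤ P`; conjugacy `1/a + 1/b = 2` is written without division. -/
structure BellmanExponents where
  a : ℝ
  b : ℝ
  half_lt_b : 1 / 2 < b
  b_le_one : b ≤ 1
  conj : a * (2 * b - 1) = b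

namespace BellmanExponents

variable (e : BellmanExponents)

/-- The exponent `θ = 1 - 2/P = 2/Q - 1` of the interaction term. -/
noncomputable def θ : ℝ := (1 - e.b) / e.b

/-- The weight `γ = (Q - 1)/8` of the interaction term. -/
noncomputable def γ : ℝ := (2 * e.b - 1) / 8

theorem b_pos : 0 < e.b := by linarith [e.half_lt_b]

theorem γ_pos : 0 < e.γ := by
  have := e.half_lt_b
  unfold γ
  linarith

theorem γ_le : e.γ ≤ 1 / 8 := by
  have := e.b_le_one
  unfold γ
  linarith

theorem one_le_a : 1 ≤ e.a := by
  have h1 := e.half_lt_b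
  have h2 := e.b_le_one
  have h3 := e.conj
  by_contra h
  push Not at h
  nlinarith

theorem a_pos : 0 < e.a := lt_of_lt_of_le one_pos e.one_le_a

theorem b_mul_θ : e.b * e.θ = 1 - e.b := mul_div_cancel₀ _ e.b_pos.ne'

theorem a_mul_θ : e.a * e.θ = e.a - 1 := by
  have h1 := e.b_mul_θ
  have h2 := e.conj
  have h3 := e.b_pos
  refine mul_left_cancel₀ h3.ne' ?_
  linear_combination e.a * h1 - h2

theorem θ_nonneg : 0 ≤ e.θ := div_nonneg (by linarith [e.b_le_one]) e.b_pos.le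

theorem θ_le_one : e.θ ≤ 1 := by
  have := e.half_lt_b
  rw [θ, div_le_one e.b_pos]
  linarith

/-- The sum `S = r^a + s^b`; for `r = |U|²` and `s = |V|²` it is `|U|^P + |V|^Q`. -/
noncomputable def S (r s : ℝ) : ℝ := r ^ e.a + s ^ e.b

/-- The weight `τ = S^θ` which balances the two terms of the Hessian estimate. -/
noncomputable def τ (r s : ℝ) : ℝ := e.S r s ^ e.θ

/-- The Bellman function `|U|^P + |V|^Q + γ |U|² (|U|^P + |V|^Q)^θ`, in the variables `r = |U|²`
and `s = |V|²`. Like the function of Nazarov and Treil, its interaction term behaves as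
`|U|² |V|^(2-Q)` where `|U|^P ≤ |V|^Q` and as `|U|^P` elsewhere, but it is smooth for
`r, s > 0`. -/
noncomputable def F (r s : ℝ) : ℝ := e.S r s + e.γ * (r * e.τ r s)

/-- The partial derivative of `F` in `r`. -/
noncomputable def Fr (r s : ℝ) : ℝ :=
  e.a * r ^ e.a / r + e.γ * e.τ r s * (1 + (e.a - 1) * r ^ e.a / e.S r s)

/-- The partial derivative of `F` in `s`. -/
noncomputable def Fs (r s : ℝ) : ℝ :=
  e.b * s ^ e.b / s * (1 + e.γ * e.θ * r * e.τ r s / e.S r s)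

/-- The second partial derivative of `F` in `r`. -/
noncomputable def Frr (r s : ℝ) : ℝ :=
  e.a * (e.a - 1) * r ^ e.a / r ^ 2 +
    e.γ * (e.a - 1) * (e.τ r s * r ^ e.a / (e.S r s * r)) * (1 + e.a - r ^ e.a / e.S r s)

/-- The mixed second partial derivative of `F`. -/
noncomputable def Frs (r s : ℝ) : ℝ :=
  e.γ * (1 - e.b) * (s ^ e.b) ^ 2 * e.τ r s / (s * e.S r s ^ 2)

/-- The second partial derivative of `F` in `s`. -/
noncomputable def Fss (r s : ℝ) : ℝ :=
  -(e.b * (1 - e.b) * s ^ e.b / s ^ 2 * (1 + e.γ * e.θ * r * e.τ r s / e.S r s)) -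
    e.b * (2 * e.b - 1) * (e.γ * e.θ * r * e.τ r s / e.S r s) * (s ^ e.b) ^ 2 /
      (s ^ 2 * e.S r s)

variable {e} {r s : ℝ}

theorem S_pos (hr : 0 < r) (hs : 0 < s) : 0 < e.S r s :=
  add_pos (Real.rpow_pos_of_pos hr _) (Real.rpow_pos_of_pos hs _)

theorem τ_pos (hr : 0 < r) (hs : 0 < s) : 0 < e.τ r s := Real.rpow_pos_of_pos (S_pos hr hs) _

theorem mul_τ_le (hr : 0 ≤ r) (hs : 0 ≤ s) : r * e.τ r s ≤ e.S r s := by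
  have ha := e.a_pos
  have hX : 0 ≤ r ^ e.a := Real.rpow_nonneg hr _
  have hS : 0 ≤ e.S r s := add_nonneg hX (Real.rpow_nonneg hs _)
  rcases hS.eq_or_lt with h0 | h0
  · have : r ^ e.a = 0 := by
      have := Real.rpow_nonneg hs e.b
      unfold S at h0
      linarith
    have hr0 : r = 0 := by
      rw [Real.rpow_eq_zero_iff_of_nonneg hr] at this
      exact this.1
    rw [← h0, hr0, zero_mul]
  have h1 : r = (r ^ e.a) ^ (1 / e.a) := by
    rw [← Real.rpow_mul hr, mul_one_div_cancel ha.ne', Real.rpow_one]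
  have h2 : r ≤ e.S r s ^ (1 / e.a) := by
    conv_lhs => rw [h1]
    refine Real.rpow_le_rpow hX ?_ (by positivity)
    exact le_add_of_nonneg_right (Real.rpow_nonneg hs _)
  have h3 : 1 / e.a + e.θ = 1 := by
    have := e.a_mul_θ
    field_simp
    linarith
  calc r * e.τ r s ≤ e.S r s ^ (1 / e.a) * e.S r s ^ e.θ :=
        mul_le_mul_of_nonneg_right h2 (Real.rpow_nonneg hS _)
    _ = e.S r s := by rw [← Real.rpow_add h0, h3, Real.rpow_one]

theorem le_τ_mul (hr : 0 < r) (hs : 0 < s) : s ≤ e.τ r s * s ^ e.b := by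
  have h1 : (s ^ e.b) ^ e.θ ≤ e.τ r s :=
    Real.rpow_le_rpow (Real.rpow_nonneg hs.le _)
      (le_add_of_nonneg_left (Real.rpow_nonneg hr.le _)) e.θ_nonneg
  calc s = (s ^ e.b) ^ e.θ * s ^ e.b := by
        rw [← Real.rpow_mul hs.le, e.b_mul_θ, ← Real.rpow_add hs]
        simp
    _ ≤ _ := mul_le_mul_of_nonneg_right h1 (Real.rpow_nonneg hs.le _)

theorem sq_mul_τ_le (hr : 0 < r) (hs : 0 < s) : (s ^ e.b) ^ 2 * e.τ r s ≤ s * e.S r s := by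
  have hS := e.S_pos hr hs
  have hθ : (2 - 1 / e.b) + e.θ = 1 := by
    have := e.b_mul_θ
    have := e.b_pos
    field_simp
    linarith
  have hY : 0 < s ^ e.b := Real.rpow_pos_of_pos hs _
  have h1 : (s ^ e.b) ^ 2 = s * (s ^ e.b) ^ (2 - 1 / e.b) := by
    have h3 : (s ^ e.b) ^ (1 / e.b) = s := by
      rw [← Real.rpow_mul hs.le, mul_one_div_cancel e.b_pos.ne', Real.rpow_one]
    rw [Real.rpow_sub hY, h3, Real.rpow_two]
    field_simp
  have h2 : (s ^ e.b) ^ (2 - 1 / e.b) ≤ e.S r s ^ (2 - 1 / e.b) := by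
    refine Real.rpow_le_rpow hY.le (le_add_of_nonneg_left (Real.rpow_nonneg hr.le _)) ?_
    linarith [e.θ_le_one]
  rw [h1, mul_assoc]
  refine mul_le_mul_of_nonneg_left ?_ hs.le
  calc _ ≤ e.S r s ^ (2 - 1 / e.b) * e.S r s ^ e.θ :=
        mul_le_mul_of_nonneg_right h2 (τ_pos hr hs).le
    _ = _ := by rw [← Real.rpow_add hS, hθ, Real.rpow_one]

section Derivatives

variable {f g : ℝ → ℝ} {f' g' h : ℝ}

theorem _root_.HasDerivAt.rpow_const_div (hf : HasDerivAt f f' h) (h0 : 0 < f h) (c : ℝ) :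
    HasDerivAt (fun x => f x ^ c) (c * f h ^ c / f h * f') h := by
  convert! hf.rpow_const (p := c) (Or.inl h0.ne') using 1
  rw [Real.rpow_sub_one h0.ne']
  ring

theorem hasDerivAt_S (hf : HasDerivAt f f' h) (hg : HasDerivAt g g' h) (hf0 : 0 < f h)
    (hg0 : 0 < g h) : HasDerivAt (fun x => e.S (f x) (g x))
      (e.a * f h ^ e.a / f h * f' + e.b * g h ^ e.b / g h * g') h :=
  (hf.rpow_const_div hf0 e.a).add (hg.rpow_const_div hg0 e.b)

theorem hasDerivAt_τ (hf : HasDerivAt f f' h) (hg : HasDerivAt g g' h) (hf0 : 0 < f h)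
    (hg0 : 0 < g h) : HasDerivAt (fun x => e.τ (f x) (g x))
      (e.θ * e.τ (f h) (g h) / e.S (f h) (g h) *
        (e.a * f h ^ e.a / f h * f' + e.b * g h ^ e.b / g h * g')) h :=
  (hasDerivAt_S hf hg hf0 hg0).rpow_const_div (S_pos hf0 hg0) e.θ

theorem hasDerivAt_F (hf : HasDerivAt f f' h) (hg : HasDerivAt g g' h) (hf0 : 0 < f h)
    (hg0 : 0 < g h) : HasDerivAt (fun x => e.F (f x) (g x))
      (e.Fr (f h) (g h) * f' + e.Fs (f h) (g h) * g') h := by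
  have h1 := (hasDerivAt_S (e := e) hf hg hf0 hg0).add
    ((hf.mul (hasDerivAt_τ (e := e) hf hg hf0 hg0)).const_mul e.γ)
  convert! h1 using 1
  have hS := S_pos (e := e) hf0 hg0
  have h2 := e.a_mul_θ
  simp only [Fr, Fs]
  field_simp
  linear_combination (-(f h ^ e.a) * e.γ * e.τ (f h) (g h) * f' * g h * f h) * h2

theorem hasDerivAt_Fr (hf : HasDerivAt f f' h) (hg : HasDerivAt g g' h) (hf0 : 0 < f h)
    (hg0 : 0 < g h) : HasDerivAt (fun x => e.Fr (f x) (g x))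
      (e.Frr (f h) (g h) * f' + e.Frs (f h) (g h) * g') h := by
  have hS := S_pos (e := e) hf0 hg0
  have hX := hf.rpow_const_div hf0 e.a
  have h1 := ((hX.const_mul e.a).div hf hf0.ne').add
    (((hasDerivAt_τ (e := e) hf hg hf0 hg0).const_mul e.γ).mul
    (((hX.const_mul (e.a - 1)).div (hasDerivAt_S (e := e) hf hg hf0 hg0) hS.ne').const_add 1))
  convert! h1 using 1
  have hθ : e.θ = (e.a - 1) / e.a := by
    rw [eq_div_iff e.a_pos.ne', mul_comm, e.a_mul_θ]
  have hb : 1 - e.b = e.b * (e.a - 1) / e.a := by rw [← e.b_mul_θ, hθ]; ring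
  have hY : g h ^ e.b = e.S (f h) (g h) - f h ^ e.a := by simp [S]
  have ha := e.a_pos
  simp only [Frr, Frs, Pi.div_apply]
  rw [hb, hY, hθ]
  field_simp
  ring

theorem hasDerivAt_Fs (hf : HasDerivAt f f' h) (hg : HasDerivAt g g' h) (hf0 : 0 < f h)
    (hg0 : 0 < g h) : HasDerivAt (fun x => e.Fs (f x) (g x))
      (e.Frs (f h) (g h) * f' + e.Fss (f h) (g h) * g') h := by
  have hS := S_pos (e := e) hf0 hg0
  have hY := hg.rpow_const_div hg0 e.b
  have h1 := ((hY.const_mul e.b).div hg hg0.ne').mul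
    ((((hf.const_mul (e.γ * e.θ)).mul (hasDerivAt_τ (e := e) hf hg hf0 hg0)).div
    (hasDerivAt_S (e := e) hf hg hf0 hg0) hS.ne').const_add 1)
  convert! h1 using 1
  have hb0 := e.b_pos
  have hθ : e.θ = (1 - e.b) / e.b := rfl
  obtain ⟨c, hc⟩ : ∃ c, c = 2 * e.b - 1 := ⟨_, rfl⟩
  have h2b : c ≠ 0 := by linarith [e.half_lt_b]
  have ha : e.a = e.b / c := by
    rw [eq_div_iff h2b, hc, e.conj]
  have hX : f h ^ e.a = e.S (f h) (g h) - g h ^ e.b := by simp [S]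
  simp only [Frs, Fss, Pi.div_apply, Pi.mul_apply]
  rw [hX, hθ, ha, ← hc]
  field_simp
  rw [hc]
  ring

end Derivatives

end BellmanExponents
end HarmonicOscillator

namespace HarmonicOscillator

namespace BellmanExponents

variable {e : BellmanExponents} {r s : ℝ}

theorem rpow_a_div_S_le_one (hr : 0 < r) (hs : 0 < s) : r ^ e.a / e.S r s ≤ 1 := by
  rw [div_le_one (S_pos hr hs)]
  exact le_add_of_nonneg_right (Real.rpow_nonneg hs.le _)

theorem rpow_b_div_S_le_one (hr : 0 < r) (hs : 0 < s) : s ^ e.b / e.S r s ≤ 1 := by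
  rw [div_le_one (S_pos hr hs)]
  exact le_add_of_nonneg_left (Real.rpow_nonneg hr.le _)

theorem interaction_weight_mem (hr : 0 < r) (hs : 0 < s) :
    0 ≤ e.γ * e.θ * r * e.τ r s / e.S r s ∧ e.γ * e.θ * r * e.τ r s / e.S r s ≤ e.γ := by
  have h1 := mul_τ_le (e := e) hr.le hs.le
  have h2 := S_pos (e := e) hr hs
  have h3 := τ_pos (e := e) hr hs
  have h4 := e.θ_nonneg
  have h5 := e.γ_pos
  refine ⟨by positivity, ?_⟩
  rw [div_le_iff₀ h2, mul_assoc, mul_assoc]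
  refine mul_le_mul_of_nonneg_left ?_ h5.le
  calc e.θ * (r * e.τ r s) ≤ 1 * (r * e.τ r s) := by
        refine mul_le_mul_of_nonneg_right e.θ_le_one (by positivity)
    _ ≤ _ := by rwa [one_mul]

theorem Frr_nonneg (hr : 0 < r) (hs : 0 < s) : 0 ≤ e.Frr r s := by
  have h1 : 0 ≤ e.a - 1 := by linarith [e.one_le_a]
  have h2 := e.a_pos
  have h3 := e.γ_pos
  have h4 := τ_pos (e := e) hr hs
  have h5 := S_pos (e := e) hr hs
  have h6 : 0 ≤ 1 + e.a - r ^ e.a / e.S r s := by linarith [rpow_a_div_S_le_one (e := e) hr hs]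
  unfold Frr
  positivity

theorem Frs_nonneg (hr : 0 < r) (hs : 0 < s) : 0 ≤ e.Frs r s := by
  have h1 : 0 ≤ 1 - e.b := by linarith [e.b_le_one]
  have h3 := e.γ_pos
  have h4 := τ_pos (e := e) hr hs
  have h5 := S_pos (e := e) hr hs
  unfold Frs
  positivity

theorem Frs_le (hr : 0 < r) (hs : 0 < s) : e.Frs r s ≤ e.γ * (1 - e.b) / e.S r s := by
  have h1 : 0 ≤ 1 - e.b := by linarith [e.b_le_one]
  have h3 := e.γ_pos
  have h5 := S_pos (e := e) hr hs
  have h6 := sq_mul_τ_le (e := e) hr hs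
  unfold Frs
  rw [div_le_div_iff₀ (by positivity) h5]
  calc e.γ * (1 - e.b) * (s ^ e.b) ^ 2 * e.τ r s * e.S r s
      = (e.γ * (1 - e.b)) * ((s ^ e.b) ^ 2 * e.τ r s) * e.S r s := by ring
    _ ≤ (e.γ * (1 - e.b)) * (s * e.S r s) * e.S r s := by gcongr
    _ = _ := by ring

theorem γ_mul_τ_le_Fr (hr : 0 < r) (hs : 0 < s) : e.γ * e.τ r s ≤ e.Fr r s := by
  have h1 : 0 ≤ e.a - 1 := by linarith [e.one_le_a]
  have h2 := e.a_pos
  have h3 := e.γ_pos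
  have h4 := τ_pos (e := e) hr hs
  have h5 := S_pos (e := e) hr hs
  have h6 : 0 ≤ e.a * r ^ e.a / r := by positivity
  have h7 : 0 ≤ e.γ * e.τ r s * ((e.a - 1) * r ^ e.a / e.S r s) := by positivity
  unfold Fr
  linarith

theorem inv_τ_le (hr : 0 < r) (hs : 0 < s) : (e.τ r s)⁻¹ ≤ s ^ e.b / s := by
  have h4 := τ_pos (e := e) hr hs
  rw [inv_eq_one_div, div_le_div_iff₀ h4 hs, one_mul, mul_comm]
  exact le_τ_mul hr hs

theorem b_div_τ_le_Fs (hr : 0 < r) (hs : 0 < s) : e.b / e.τ r s ≤ e.Fs r s := by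
  have h1 := inv_τ_le (e := e) hr hs
  have h2 := (interaction_weight_mem (e := e) hr hs).1
  have h3 := e.b_pos
  have h4 : 0 ≤ s ^ e.b / s := by positivity
  unfold Fs
  calc e.b / e.τ r s = e.b * (e.τ r s)⁻¹ * 1 := by ring
    _ ≤ e.b * (s ^ e.b / s) * (1 + e.γ * e.θ * r * e.τ r s / e.S r s) := by
      gcongr
      linarith
    _ = _ := by ring

theorem Fs_nonneg (hr : 0 < r) (hs : 0 < s) : 0 ≤ e.Fs r s :=
  (div_nonneg e.b_pos.le (τ_pos hr hs).le).trans (b_div_τ_le_Fs hr hs)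

theorem Fr_nonneg (hr : 0 < r) (hs : 0 < s) : 0 ≤ e.Fr r s :=
  (mul_nonneg e.γ_pos.le (τ_pos hr hs).le).trans (γ_mul_τ_le_Fr hr hs)

theorem Fss_nonpos (hr : 0 < r) (hs : 0 < s) : e.Fss r s ≤ 0 := by
  have h1 : 0 ≤ 1 - e.b := by linarith [e.b_le_one]
  have h2 : 0 ≤ 2 * e.b - 1 := by linarith [e.half_lt_b]
  have h3 := e.b_pos
  have h4 := (interaction_weight_mem (e := e) hr hs).1
  have h5 := S_pos (e := e) hr hs
  have h6 : 0 ≤ e.b * (1 - e.b) * s ^ e.b / s ^ 2 *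
      (1 + e.γ * e.θ * r * e.τ r s / e.S r s) := by positivity
  have h7 : 0 ≤ e.b * (2 * e.b - 1) * (e.γ * e.θ * r * e.τ r s / e.S r s) * (s ^ e.b) ^ 2 /
      (s ^ 2 * e.S r s) := by positivity
  unfold Fss
  linarith

/-- The radial concavity of `F` in `V` eats only part of the term coming from `F_s`: what is left
has the factor `2b - 1 = Q - 1`. -/
theorem le_Fs_add_mul_Fss (hr : 0 < r) (hs : 0 < s) :
    2 * e.b * (2 * e.b - 1) * (1 - e.γ) / e.τ r s ≤ 2 * e.Fs r s + 4 * s * e.Fss r s := by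
  obtain ⟨hκ0, hκ⟩ := interaction_weight_mem (e := e) hr hs
  have hY := rpow_b_div_S_le_one (e := e) hr hs
  have hτ := inv_τ_le (e := e) hr hs
  have h2 : 0 < 2 * e.b - 1 := by linarith [e.half_lt_b]
  have h3 := e.b_pos
  have h5 := S_pos (e := e) hr hs
  have hγ := e.γ_le
  unfold Fs Fss
  set κ := e.γ * e.θ * r * e.τ r s / e.S r s with hκdef
  have key : 2 * (e.b * s ^ e.b / s * (1 + κ)) +
      4 * s * (-(e.b * (1 - e.b) * s ^ e.b / s ^ 2 * (1 + κ)) -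
        e.b * (2 * e.b - 1) * κ * (s ^ e.b) ^ 2 / (s ^ 2 * e.S r s)) =
      2 * e.b * (2 * e.b - 1) * (1 + κ - 2 * κ * (s ^ e.b / e.S r s)) * (s ^ e.b / s) := by
    field_simp
    ring
  rw [key, div_eq_mul_inv]
  have h6 : 1 - e.γ ≤ 1 + κ - 2 * κ * (s ^ e.b / e.S r s) := by nlinarith
  have h7 : 0 ≤ 1 - e.γ := by linarith
  have h8 : 0 ≤ (e.τ r s)⁻¹ := inv_nonneg.2 (τ_pos hr hs).le
  have h9 : 0 ≤ 1 + κ - 2 * κ * (s ^ e.b / e.S r s) := h7.trans h6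
  exact mul_le_mul (mul_le_mul_of_nonneg_left h6 (by positivity)) hτ h8 (by positivity)

/-- The second derivative of `F(|U|² + ε, |V|² + ε)` along a curve, bounded below. Here `A` and `B`
stand for `|U'|²` and `|V'|²`, and `u`, `v` for `⟪U, U''⟫` and `⟪V, V''⟫`. -/
theorem le_second_derivative (hr : 0 < r) (hs : 0 < s) {r' s' A B u v : ℝ}
    (hA : r' ^ 2 ≤ 4 * r * A) (hB : s' ^ 2 ≤ 4 * s * B) :
    (2 * e.b - 1) * (e.τ r s / 8 * A + B / (2 * e.τ r s)) +
        2 * e.Fr r s * u + 2 * e.Fs r s * v ≤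
      (e.Frr r s * r' + e.Frs r s * s') * r' + e.Fr r s * (2 * A + 2 * u) +
        ((e.Frs r s * r' + e.Fss r s * s') * s' + e.Fs r s * (2 * B + 2 * v)) := by
  have hS := S_pos (e := e) hr hs
  have hτ := τ_pos (e := e) hr hs
  have hb1 : 0 ≤ 1 - e.b := by linarith [e.b_le_one]
  have hb2 : 0 < 2 * e.b - 1 := by linarith [e.half_lt_b]
  have hγ := e.γ_pos
  have hA0 : 0 ≤ A := by
    by_contra h
    push Not at h
    nlinarith [sq_nonneg r', mul_pos hr (neg_pos.2 h)]
  have hB0 : 0 ≤ B := by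
    by_contra h
    push Not at h
    nlinarith [sq_nonneg s', mul_pos hs (neg_pos.2 h)]
  have hrr : 0 ≤ e.Frr r s * r' ^ 2 := mul_nonneg (Frr_nonneg hr hs) (sq_nonneg _)
  have hss : e.Fss r s * (4 * s * B) ≤ e.Fss r s * s' ^ 2 :=
    mul_le_mul_of_nonpos_left hB (Fss_nonpos hr hs)
  -- The mixed term is split by the weight `τ² / 2`.
  have hcross : -(e.γ * (1 - e.b) * (2 * e.τ r s * A + 8 / e.τ r s * B)) ≤
      2 * e.Frs r s * r' * s' := by
    have h1 : -(e.τ r s ^ 2 / 2 * r' ^ 2 + 2 / e.τ r s ^ 2 * s' ^ 2) ≤ 2 * (r' * s') := by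
      have h2 : e.τ r s ^ 2 / 2 * r' ^ 2 + 2 / e.τ r s ^ 2 * s' ^ 2 + 2 * (r' * s') =
          (e.τ r s ^ 2 * r' + 2 * s') ^ 2 / (2 * e.τ r s ^ 2) := by
        field_simp
        ring
      have h3 : 0 ≤ (e.τ r s ^ 2 * r' + 2 * s') ^ 2 / (2 * e.τ r s ^ 2) := by positivity
      linarith
    have h2 : e.τ r s ^ 2 / 2 * r' ^ 2 + 2 / e.τ r s ^ 2 * s' ^ 2 ≤
        e.τ r s ^ 2 / 2 * (4 * r * A) + 2 / e.τ r s ^ 2 * (4 * s * B) := by gcongr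
    have h3 := Frs_nonneg (e := e) hr hs
    have h4 : r ≤ e.S r s / e.τ r s := by
      rw [le_div_iff₀ hτ]
      exact mul_τ_le hr.le hs.le
    have h5 : s ≤ e.τ r s * e.S r s := (le_τ_mul (e := e) hr hs).trans
      (mul_le_mul_of_nonneg_left (le_add_of_nonneg_left (Real.rpow_nonneg hr.le _)) hτ.le)
    have h6 : e.τ r s ^ 2 / 2 * (4 * r * A) + 2 / e.τ r s ^ 2 * (4 * s * B) ≤
        e.τ r s ^ 2 / 2 * (4 * (e.S r s / e.τ r s) * A) +
          2 / e.τ r s ^ 2 * (4 * (e.τ r s * e.S r s) * B) := by gcongr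
    have h7 : e.τ r s ^ 2 / 2 * (4 * (e.S r s / e.τ r s) * A) +
          2 / e.τ r s ^ 2 * (4 * (e.τ r s * e.S r s) * B) =
        e.S r s * (2 * e.τ r s * A + 8 / e.τ r s * B) := by
      field_simp
      ring
    calc -(e.γ * (1 - e.b) * (2 * e.τ r s * A + 8 / e.τ r s * B))
        = -(e.γ * (1 - e.b) / e.S r s * (e.S r s * (2 * e.τ r s * A + 8 / e.τ r s * B))) := by
          field_simp
      _ ≤ -(e.Frs r s * (e.S r s * (2 * e.τ r s * A + 8 / e.τ r s * B))) := by
          have := mul_le_mul_of_nonneg_right (Frs_le (e := e) hr hs)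
            (show 0 ≤ e.S r s * (2 * e.τ r s * A + 8 / e.τ r s * B) by positivity)
          linarith
      _ ≤ e.Frs r s * (2 * (r' * s')) := by
          rw [← mul_neg]
          refine mul_le_mul_of_nonneg_left ?_ h3
          linarith
      _ = _ := by ring
  have hr2 : e.γ * e.τ r s * A ≤ e.Fr r s * A :=
    mul_le_mul_of_nonneg_right (γ_mul_τ_le_Fr hr hs) hA0
  have hs2 := mul_le_mul_of_nonneg_right (le_Fs_add_mul_Fss (e := e) hr hs) hB0
  have hcA : (2 * e.b - 1) * (e.τ r s / 8 * A) ≤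
      2 * (e.γ * e.τ r s * A) - e.γ * (1 - e.b) * (2 * e.τ r s * A) := by
    have : 2 * (e.γ * e.τ r s * A) - e.γ * (1 - e.b) * (2 * e.τ r s * A) -
        (2 * e.b - 1) * (e.τ r s / 8 * A) = (2 * e.b - 1) * (e.γ * e.τ r s * A) := by
      unfold γ
      ring
    have : 0 ≤ (2 * e.b - 1) * (e.γ * e.τ r s * A) := by positivity
    linarith
  have hcB : (2 * e.b - 1) * (B / (2 * e.τ r s)) ≤
      2 * e.b * (2 * e.b - 1) * (1 - e.γ) / e.τ r s * B -
        e.γ * (1 - e.b) * (8 / e.τ r s * B) := by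
    have h1 : 2 * e.b * (2 * e.b - 1) * (1 - e.γ) / e.τ r s * B -
        e.γ * (1 - e.b) * (8 / e.τ r s * B) - (2 * e.b - 1) * (B / (2 * e.τ r s)) =
        (2 * e.b - 1) * (2 * e.b * (1 - e.γ) - (1 - e.b) - 1 / 2) * (B / e.τ r s) := by
      unfold γ
      field_simp
    have h2 : 0 ≤ 2 * e.b * (1 - e.γ) - (1 - e.b) - 1 / 2 := by
      have := e.b_le_one
      unfold γ
      nlinarith
    have : 0 ≤ (2 * e.b - 1) * (2 * e.b * (1 - e.γ) - (1 - e.b) - 1 / 2) * (B / e.τ r s) := by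
      positivity
    linarith
  linarith

/-- At `ε = 0` the Bellman function is dominated by `|U|^P + |V|^Q`. -/
theorem F_le (hr : 0 ≤ r) (hs : 0 ≤ s) : e.F r s ≤ 9 / 8 * (r ^ e.a + s ^ e.b) := by
  have h1 := mul_τ_le (e := e) hr hs
  have h2 := e.γ_le
  have h3 := e.γ_pos
  have h4 : 0 ≤ e.S r s := add_nonneg (Real.rpow_nonneg hr _) (Real.rpow_nonneg hs _)
  have h5 : e.γ * (r * e.τ r s) ≤ 1 / 8 * e.S r s :=
    (mul_le_mul_of_nonneg_left h1 h3.le).trans (mul_le_mul_of_nonneg_right h2 h4)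
  have h6 : e.S r s = r ^ e.a + s ^ e.b := rfl
  unfold F
  linarith

theorem continuous_F : Continuous (fun p : ℝ × ℝ => e.F p.1 p.2) := by
  have ha := e.a_pos.le
  have hb := e.b_pos.le
  have hθ := e.θ_nonneg
  have h1 : Continuous fun p : ℝ × ℝ => e.S p.1 p.2 :=
    (continuous_fst.rpow_const fun _ => Or.inr ha).add
      (continuous_snd.rpow_const fun _ => Or.inr hb)
  have h2 : Continuous fun p : ℝ × ℝ => e.τ p.1 p.2 := h1.rpow_const fun _ => Or.inr hθ
  exact h1.add ((continuous_fst.mul h2).const_mul _)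

theorem continuousAt_τ {p : ℝ × ℝ} : ContinuousAt (fun p : ℝ × ℝ => e.τ p.1 p.2) p := by
  have h1 : Continuous fun p : ℝ × ℝ => e.S p.1 p.2 :=
    (continuous_fst.rpow_const fun _ => Or.inr e.a_pos.le).add
      (continuous_snd.rpow_const fun _ => Or.inr e.b_pos.le)
  exact (h1.rpow_const fun _ => Or.inr e.θ_nonneg).continuousAt

/-- All derivatives of `F` up to order two are bounded on squares compactly contained in the open
quadrant. -/
theorem exists_derivative_bound (e : BellmanExponents) {ε : ℝ} (hε : 0 < ε) (M : ℝ) :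
    ∃ C, 0 ≤ C ∧ ∀ r ∈ Set.Icc ε M, ∀ s ∈ Set.Icc ε M, |e.Fr r s| ≤ C ∧ |e.Fs r s| ≤ C ∧
      |e.Frr r s| ≤ C ∧ |e.Frs r s| ≤ C ∧ |e.Fss r s| ≤ C := by
  have hK : IsCompact (Set.Icc ε M ×ˢ Set.Icc ε M) := isCompact_Icc.prod isCompact_Icc
  have main : ∀ G : ℝ → ℝ → ℝ, (∀ p : ℝ × ℝ, 0 < p.1 → 0 < p.2 →
      ContinuousAt (fun p : ℝ × ℝ => G p.1 p.2) p) →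
      ∃ C, ∀ r ∈ Set.Icc ε M, ∀ s ∈ Set.Icc ε M, |G r s| ≤ C := by
    intro G hG
    obtain ⟨C, hC⟩ := hK.exists_bound_of_continuousOn (f := fun p : ℝ × ℝ => G p.1 p.2)
      (fun p hp => (hG p (hε.trans_le hp.1.1) (hε.trans_le hp.2.1)).continuousWithinAt)
    exact ⟨C, fun r hr s hs => hC (r, s) ⟨hr, hs⟩⟩
  have hX : ∀ p : ℝ × ℝ, ContinuousAt (fun p : ℝ × ℝ => p.1 ^ e.a) p := fun p =>
    (continuous_fst.rpow_const fun _ => Or.inr e.a_pos.le).continuousAt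
  have hY : ∀ p : ℝ × ℝ, ContinuousAt (fun p : ℝ × ℝ => p.2 ^ e.b) p := fun p =>
    (continuous_snd.rpow_const fun _ => Or.inr e.b_pos.le).continuousAt
  have hS : ∀ p : ℝ × ℝ, ContinuousAt (fun p : ℝ × ℝ => e.S p.1 p.2) p := fun p =>
    (hX p).add (hY p)
  have hτ : ∀ p : ℝ × ℝ, ContinuousAt (fun p : ℝ × ℝ => e.τ p.1 p.2) p := fun p =>
    continuousAt_τ
  have h1 : ∀ p : ℝ × ℝ, ContinuousAt (fun p : ℝ × ℝ => p.1) p := fun p => continuousAt_fst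
  have h2 : ∀ p : ℝ × ℝ, ContinuousAt (fun p : ℝ × ℝ => p.2) p := fun p => continuousAt_snd
  have hκ : ∀ p : ℝ × ℝ, 0 < p.1 → 0 < p.2 →
      ContinuousAt (fun p : ℝ × ℝ => e.γ * e.θ * p.1 * e.τ p.1 p.2 / e.S p.1 p.2) p :=
    fun p hr hs => (((h1 p).const_mul _).mul (hτ p)).div (hS p) (S_pos hr hs).ne'
  obtain ⟨C1, hC1⟩ := main e.Fr fun p hr hs => by
    have := (S_pos (e := e) hr hs).ne'
    exact (((hX p).const_mul _).div (h1 p) hr.ne').add (((hτ p).const_mul _).mul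
      (((((hX p).const_mul _).div (hS p) this)).const_add 1))
  obtain ⟨C2, hC2⟩ := main e.Fs fun p hr hs =>
    (((hY p).const_mul _).div (h2 p) hs.ne').mul ((hκ p hr hs).const_add 1)
  obtain ⟨C3, hC3⟩ := main e.Frr fun p hr hs => by
    have hS0 := (S_pos (e := e) hr hs).ne'
    exact (((hX p).const_mul _).div ((h1 p).pow 2) (pow_ne_zero 2 hr.ne')).add
      (((((hτ p).mul (hX p)).div ((hS p).mul (h1 p)) (mul_ne_zero hS0 hr.ne')).const_mul _).mul
      (((hX p).div (hS p) hS0).const_sub _))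
  obtain ⟨C4, hC4⟩ := main e.Frs fun p hr hs => by
    have hS0 := (S_pos (e := e) hr hs).ne'
    exact ((((hY p).pow 2).const_mul _).mul (hτ p)).div ((h2 p).mul ((hS p).pow 2))
      (mul_ne_zero hs.ne' (pow_ne_zero 2 hS0))
  obtain ⟨C5, hC5⟩ := main e.Fss fun p hr hs => by
    have hS0 := (S_pos (e := e) hr hs).ne'
    exact ((((hY p).const_mul _).div ((h2 p).pow 2) (pow_ne_zero 2 hs.ne')).mul
      ((hκ p hr hs).const_add 1)).neg.sub ((((hκ p hr hs).const_mul _).mul ((hY p).pow 2)).div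
      (((h2 p).pow 2).mul (hS p)) (mul_ne_zero (pow_ne_zero 2 hs.ne') hS0))
  refine ⟨|C1| + |C2| + |C3| + |C4| + |C5|, by positivity, fun r hr s hs => ?_⟩
  have := hC1 r hr s hs
  have := hC2 r hr s hs
  have := hC3 r hr s hs
  have := hC4 r hr s hs
  have := hC5 r hr s hs
  have := le_abs_self C1
  have := le_abs_self C2
  have := le_abs_self C3
  have := le_abs_self C4
  have := le_abs_self C5
  have := abs_nonneg C1
  have := abs_nonneg C2
  have := abs_nonneg C3
  have := abs_nonneg C4
  have := abs_nonneg C5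
  refine ⟨?_, ?_, ?_, ?_, ?_⟩ <;> linarith

theorem S_sub_nonneg {ε w z : ℝ} (hε : 0 ≤ ε) (hw : 0 ≤ w) (hz : 0 ≤ z) :
    e.S ε ε ≤ e.S (w + ε) (z + ε) :=
  add_le_add (Real.rpow_le_rpow hε (by linarith) e.a_pos.le)
    (Real.rpow_le_rpow hε (by linarith) e.b_pos.le)

theorem F_sub_nonneg {ε w z : ℝ} (hε : 0 ≤ ε) (hw : 0 ≤ w) (hz : 0 ≤ z) :
    e.F ε ε ≤ e.F (w + ε) (z + ε) := by
  have h1 := S_sub_nonneg (e := e) hε hw hz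
  have h0 : 0 ≤ e.S ε ε := add_nonneg (Real.rpow_nonneg hε _) (Real.rpow_nonneg hε _)
  have h2 : e.τ ε ε ≤ e.τ (w + ε) (z + ε) := Real.rpow_le_rpow h0 h1 e.θ_nonneg
  have h3 : 0 ≤ e.τ ε ε := Real.rpow_nonneg h0 _
  have h4 := e.γ_pos
  unfold F
  gcongr
  linarith

/-- A bound, uniform in the regularization `ε`, that vanishes with `w = |U|²` and `z = |V|²`. -/
theorem exists_F_sub_le (e : BellmanExponents) (M : ℝ) :
    ∃ K, 0 ≤ K ∧ ∀ ε, 0 < ε → ε ≤ 1 → ∀ w, 0 ≤ w → w ≤ M → ∀ z, 0 ≤ z → z ≤ M →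
      e.F (w + ε) (z + ε) - e.F ε ε ≤ K * w + 2 * z ^ e.b := by
  have ha := e.a_pos
  have ha1 := e.one_le_a
  have hθ := e.θ_nonneg
  refine ⟨2 * (e.a * (|M| + 1) ^ (e.a - 1)) + e.τ (|M| + 1) (|M| + 1), ?_, ?_⟩
  · have := τ_pos (e := e) (r := |M| + 1) (s := |M| + 1) (by positivity) (by positivity)
    positivity
  intro ε hε hε1 w hw hwM z hz hzM
  have hM := le_abs_self M
  have hX : (w + ε) ^ e.a - ε ^ e.a ≤ e.a * (|M| + 1) ^ (e.a - 1) * w := by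
    have hd : ∀ x ∈ interior (Set.Icc ε (w + ε)),
        deriv (fun x : ℝ => x ^ e.a) x ≤ e.a * (|M| + 1) ^ (e.a - 1) := by
      intro x hx
      rw [interior_Icc] at hx
      have hx0 : 0 < x := hε.trans hx.1
      rw [Real.deriv_rpow_const]
      refine mul_le_mul_of_nonneg_left ?_ ha.le
      exact Real.rpow_le_rpow hx0.le (by linarith [hx.2]) (by linarith)
    have h := (convex_Icc ε (w + ε)).image_sub_le_mul_sub_of_deriv_le
      (f := fun x : ℝ => x ^ e.a) (Real.continuous_rpow_const ha.le).continuousOn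
      (fun x hx => by
        rw [interior_Icc] at hx
        exact (Real.differentiableAt_rpow_const_of_ne _
          (hε.trans hx.1).ne').differentiableWithinAt)
      hd ε (by constructor <;> linarith) (w + ε) (by constructor <;> linarith) (by linarith)
    simpa using h
  have hY : (z + ε) ^ e.b - ε ^ e.b ≤ z ^ e.b := by
    linarith [Real.rpow_add_le_add_rpow hz hε.le e.b_pos.le e.b_le_one]
  have hS0 := S_pos (e := e) hε hε
  have hS1 := S_sub_nonneg (e := e) hε.le hw hz
  have hS1' := hS0.trans_le hS1
  have hSdiff : e.S (w + ε) (z + ε) - e.S ε ε ≤ e.a * (|M| + 1) ^ (e.a - 1) * w + z ^ e.b := by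
    unfold S
    linarith
  have hτM : e.τ (w + ε) (z + ε) ≤ e.τ (|M| + 1) (|M| + 1) := by
    refine Real.rpow_le_rpow hS1'.le (add_le_add ?_ ?_) hθ
    · exact Real.rpow_le_rpow (by linarith) (by linarith) ha.le
    · exact Real.rpow_le_rpow (by linarith) (by linarith) e.b_pos.le
  -- Concavity of `t ↦ t ^ θ`, together with `ε S₀^θ ≤ S₀`.
  have hτdiff : ε * (e.τ (w + ε) (z + ε) - e.τ ε ε) ≤ e.S (w + ε) (z + ε) - e.S ε ε := by
    have h1 : (1 + (e.S (w + ε) (z + ε) - e.S ε ε) / e.S ε ε) ^ e.θ ≤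
        1 + e.θ * ((e.S (w + ε) (z + ε) - e.S ε ε) / e.S ε ε) := by
      refine rpow_one_add_le_one_add_mul_self ?_ hθ e.θ_le_one
      have : 0 ≤ (e.S (w + ε) (z + ε) - e.S ε ε) / e.S ε ε := div_nonneg (by linarith) hS0.le
      linarith
    have h2 : 1 + (e.S (w + ε) (z + ε) - e.S ε ε) / e.S ε ε =
        e.S (w + ε) (z + ε) / e.S ε ε := by field_simp; ring
    have h4 : e.τ (w + ε) (z + ε) =
        (e.S (w + ε) (z + ε) / e.S ε ε) ^ e.θ * e.τ ε ε := by
      unfold τ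
      rw [Real.div_rpow hS1'.le hS0.le]
      have := (Real.rpow_pos_of_pos hS0 e.θ).ne'
      field_simp
    rw [h2] at h1
    have hτ0 := τ_pos (e := e) hε hε
    have h5 := mul_τ_le (e := e) hε.le hε.le
    set D := e.S (w + ε) (z + ε) - e.S ε ε with hD
    have hD0 : 0 ≤ D := by linarith
    calc ε * (e.τ (w + ε) (z + ε) - e.τ ε ε)
        = (ε * e.τ ε ε) * ((e.S (w + ε) (z + ε) / e.S ε ε) ^ e.θ - 1) := by rw [h4]; ring
      _ ≤ (ε * e.τ ε ε) * (1 * (D / e.S ε ε)) := by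
        refine mul_le_mul_of_nonneg_left ?_ (by positivity)
        have : e.θ * (D / e.S ε ε) ≤ 1 * (D / e.S ε ε) :=
          mul_le_mul_of_nonneg_right e.θ_le_one (by positivity)
        linarith
      _ ≤ e.S ε ε * (1 * (D / e.S ε ε)) := by gcongr
      _ = D := by field_simp
  have hγ := e.γ_pos
  have hγ1 := e.γ_le
  have hτw : w * e.τ (w + ε) (z + ε) ≤ w * e.τ (|M| + 1) (|M| + 1) := by gcongr
  have hI : e.γ * ((w + ε) * e.τ (w + ε) (z + ε) - ε * e.τ ε ε) ≤
      1 * (w * e.τ (|M| + 1) (|M| + 1) + (e.a * (|M| + 1) ^ (e.a - 1) * w + z ^ e.b)) := by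
    refine mul_le_mul (by linarith) (by linarith) ?_ zero_le_one
    have h2 : e.τ ε ε ≤ e.τ (w + ε) (z + ε) := Real.rpow_le_rpow hS0.le hS1 hθ
    have h3 := τ_pos (e := e) hε hε
    have := mul_le_mul_of_nonneg_left h2 hε.le
    have : 0 ≤ w * e.τ (w + ε) (z + ε) := mul_nonneg hw (h3.le.trans h2)
    linarith
  unfold F
  linarith

end BellmanExponents
end HarmonicOscillator

namespace HarmonicOscillator

/-! ### The Bellman function along Poisson extensions -/

section Energy

variable {E₁ E₂ : Type*} [NormedAddCommGroup E₁] [NormedAddCommGroup E₂]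

/-- The regularized Bellman function of two vectors, normalized to vanish at the origin. -/
noncomputable def energy (e : BellmanExponents) (ε : ℝ) (u : E₁) (v : E₂) : ℝ :=
  e.F (‖u‖ ^ 2 + ε) (‖v‖ ^ 2 + ε) - e.F ε ε

variable {e : BellmanExponents} {ε : ℝ}

theorem energy_nonneg (hε : 0 ≤ ε) (u : E₁) (v : E₂) : 0 ≤ energy e ε u v :=
  sub_nonneg.2 (BellmanExponents.F_sub_nonneg hε (sq_nonneg _) (sq_nonneg _))

theorem continuous_energy {X : Type*} [TopologicalSpace X] (e : BellmanExponents) (ε : ℝ)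
    {u : X → E₁} {v : X → E₂} (hu : Continuous u) (hv : Continuous v) :
    Continuous (fun x => energy e ε (u x) (v x)) :=
  (BellmanExponents.continuous_F.comp (((hu.norm.pow 2).add_const ε).prodMk
    ((hv.norm.pow 2).add_const ε))).sub continuous_const

theorem exists_energy_le (e : BellmanExponents) {N : ℝ} (hN : 0 ≤ N) :
    ∃ K, 0 ≤ K ∧ ∀ ε, 0 < ε → ε ≤ 1 → ∀ δ, 0 ≤ δ → δ ≤ N → ∀ (u : E₁) (v : E₂), ‖u‖ ≤ δ →
      ‖v‖ ≤ δ → energy e ε u v ≤ K * δ := by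
  obtain ⟨K, hK0, hK⟩ := BellmanExponents.exists_F_sub_le e (N ^ 2)
  refine ⟨K * N + 2 * N ^ (2 * e.b - 1), by positivity, fun ε hε hε1 δ hδ hδN u v hu hv => ?_⟩
  have hu2 : ‖u‖ ^ 2 ≤ δ ^ 2 := by gcongr
  have hv2 : ‖v‖ ^ 2 ≤ δ ^ 2 := by gcongr
  have hδ2 : δ ^ 2 ≤ N ^ 2 := by gcongr
  refine (hK ε hε hε1 _ (sq_nonneg _) (hu2.trans hδ2) _ (sq_nonneg _) (hv2.trans hδ2)).trans ?_
  have hb := e.half_lt_b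
  have h1 : (‖v‖ ^ 2) ^ e.b ≤ N ^ (2 * e.b - 1) * δ := by
    calc (‖v‖ ^ 2) ^ e.b ≤ (δ ^ 2) ^ e.b := Real.rpow_le_rpow (sq_nonneg _) hv2 e.b_pos.le
      _ = δ ^ (2 * e.b - 1) * δ := by
        rw [← Real.rpow_natCast, ← Real.rpow_mul hδ]
        nth_rewrite 3 [← Real.rpow_one δ]
        rw [← Real.rpow_add_of_nonneg hδ (by linarith) zero_le_one]
        congr 1
        push_cast
        ring
      _ ≤ _ := by
        gcongr
        linarith
  have h2 : K * ‖u‖ ^ 2 ≤ K * (N * δ) := by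
    refine mul_le_mul_of_nonneg_left (hu2.trans ?_) hK0
    rw [sq]
    gcongr
  linarith

variable [InnerProductSpace ℝ E₁] [InnerProductSpace ℝ E₂]

/-- The derivative of `energy` along a curve through `(u, v)` with velocity `(u', v')`. -/
noncomputable def energyDeriv (e : BellmanExponents) (ε : ℝ) (u : E₁) (v : E₂) (u' : E₁)
    (v' : E₂) : ℝ :=
  e.Fr (‖u‖ ^ 2 + ε) (‖v‖ ^ 2 + ε) * (2 * inner ℝ u u') +
    e.Fs (‖u‖ ^ 2 + ε) (‖v‖ ^ 2 + ε) * (2 * inner ℝ v v')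

/-- The second derivative of `energy` along a curve through `(u, v)` with velocity `(u', v')` and
acceleration `(u'', v'')`. -/
noncomputable def energyDeriv₂ (e : BellmanExponents) (ε : ℝ) (u : E₁) (v : E₂) (u' : E₁)
    (v' : E₂) (u'' : E₁) (v'' : E₂) : ℝ :=
  (e.Frr (‖u‖ ^ 2 + ε) (‖v‖ ^ 2 + ε) * (2 * inner ℝ u u') +
      e.Frs (‖u‖ ^ 2 + ε) (‖v‖ ^ 2 + ε) * (2 * inner ℝ v v')) * (2 * inner ℝ u u') +
    e.Fr (‖u‖ ^ 2 + ε) (‖v‖ ^ 2 + ε) * (2 * ‖u'‖ ^ 2 + 2 * inner ℝ u u'') +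
  ((e.Frs (‖u‖ ^ 2 + ε) (‖v‖ ^ 2 + ε) * (2 * inner ℝ u u') +
      e.Fss (‖u‖ ^ 2 + ε) (‖v‖ ^ 2 + ε) * (2 * inner ℝ v v')) * (2 * inner ℝ v v') +
    e.Fs (‖u‖ ^ 2 + ε) (‖v‖ ^ 2 + ε) * (2 * ‖v'‖ ^ 2 + 2 * inner ℝ v v''))

theorem hasDerivAt_norm_sq_add {u : ℝ → E₁} {u' : E₁} {h : ℝ} (hu : HasDerivAt u u' h) :
    HasDerivAt (fun x => ‖u x‖ ^ 2 + ε) (2 * inner ℝ (u h) u') h :=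
  hu.norm_sq.add_const ε

theorem hasDerivAt_energy (hε : 0 < ε) {u : ℝ → E₁} {v : ℝ → E₂} {u' : E₁} {v' : E₂} {h : ℝ}
    (hu : HasDerivAt u u' h) (hv : HasDerivAt v v' h) :
    HasDerivAt (fun x => energy e ε (u x) (v x)) (energyDeriv e ε (u h) (v h) u' v') h :=
  (BellmanExponents.hasDerivAt_F (hasDerivAt_norm_sq_add hu) (hasDerivAt_norm_sq_add hv)
    (by positivity) (by positivity)).sub_const _

theorem hasDerivAt_energyDeriv (hε : 0 < ε) {u u' : ℝ → E₁} {v v' : ℝ → E₂} {u'' : E₁} {v'' : E₂}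
    {h : ℝ} (hu : HasDerivAt u (u' h) h) (hv : HasDerivAt v (v' h) h)
    (hu' : HasDerivAt u' u'' h) (hv' : HasDerivAt v' v'' h) :
    HasDerivAt (fun x => energyDeriv e ε (u x) (v x) (u' x) (v' x))
      (energyDeriv₂ e ε (u h) (v h) (u' h) (v' h) u'' v'') h := by
  have h1 := hasDerivAt_norm_sq_add (ε := ε) hu
  have h2 := hasDerivAt_norm_sq_add (ε := ε) hv
  have p1 : 0 < ‖u h‖ ^ 2 + ε := by positivity
  have p2 : 0 < ‖v h‖ ^ 2 + ε := by positivity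
  have k1 := (hu.inner ℝ hu').const_mul 2
  have k2 := (hv.inner ℝ hv').const_mul 2
  refine (((BellmanExponents.hasDerivAt_Fr (e := e) h1 h2 p1 p2).mul k1).add
    ((BellmanExponents.hasDerivAt_Fs (e := e) h1 h2 p1 p2).mul k2)).congr_deriv ?_
  simp only [energyDeriv₂, real_inner_self_eq_norm_sq]
  ring

theorem le_energyDeriv₂ (hε : 0 < ε) (u : E₁) (v : E₂) (u' : E₁) (v' : E₂) (u'' : E₁)
    (v'' : E₂) :
    (2 * e.b - 1) * (e.τ (‖u‖ ^ 2 + ε) (‖v‖ ^ 2 + ε) / 8 * ‖u'‖ ^ 2 +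
        ‖v'‖ ^ 2 / (2 * e.τ (‖u‖ ^ 2 + ε) (‖v‖ ^ 2 + ε))) +
        2 * e.Fr (‖u‖ ^ 2 + ε) (‖v‖ ^ 2 + ε) * inner ℝ u u'' +
        2 * e.Fs (‖u‖ ^ 2 + ε) (‖v‖ ^ 2 + ε) * inner ℝ v v'' ≤
      energyDeriv₂ e ε u v u' v' u'' v'' := by
  refine BellmanExponents.le_second_derivative (by positivity) (by positivity) ?_ ?_
  · have := abs_le.1 (abs_real_inner_le_norm u u')
    have h1 : (inner ℝ u u') ^ 2 ≤ (‖u‖ * ‖u'‖) ^ 2 := sq_le_sq' this.1 this.2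
    nlinarith [mul_nonneg hε.le (sq_nonneg ‖u'‖)]
  · have := abs_le.1 (abs_real_inner_le_norm v v')
    have h1 : (inner ℝ v v') ^ 2 ≤ (‖v‖ * ‖v'‖) ^ 2 := sq_le_sq' this.1 this.2
    nlinarith [mul_nonneg hε.le (sq_nonneg ‖v'‖)]

theorem abs_two_mul_inner_le {δ : ℝ} {y z : E₁} (hy : ‖y‖ ≤ δ) (hz : ‖z‖ ≤ δ) :
    |2 * inner ℝ y z| ≤ 2 * δ ^ 2 := by
  rw [abs_mul, abs_two]
  have : ‖y‖ * ‖z‖ ≤ δ * δ := mul_le_mul hy hz (norm_nonneg _) ((norm_nonneg y).trans hy)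
  have := abs_real_inner_le_norm y z
  nlinarith

theorem abs_two_mul_norm_sq_add_inner_le {δ : ℝ} {y z w : E₁} (hy : ‖y‖ ≤ δ) (hz : ‖z‖ ≤ δ)
    (hw : ‖w‖ ≤ δ) : |2 * ‖y‖ ^ 2 + 2 * inner ℝ z w| ≤ 4 * δ ^ 2 := by
  refine (abs_add_le _ _).trans ?_
  have h1 := abs_two_mul_inner_le hz hw
  have h2 : |2 * ‖y‖ ^ 2| ≤ 2 * δ ^ 2 := by
    rw [abs_of_nonneg (by positivity)]
    gcongr
  linarith

/-- On bounded sets the first two derivatives of `energy` are controlled by the size of the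
vectors involved. -/
theorem exists_energyDeriv_le (e : BellmanExponents) (hε : 0 < ε) {N : ℝ} (hN : 0 ≤ N) :
    ∃ K, 0 ≤ K ∧ ∀ δ, 0 ≤ δ → δ ≤ N → ∀ (u u' u'' : E₁) (v v' v'' : E₂), ‖u‖ ≤ δ → ‖v‖ ≤ δ →
      ‖u'‖ ≤ δ → ‖v'‖ ≤ δ → ‖u''‖ ≤ δ → ‖v''‖ ≤ δ →
      |energyDeriv e ε u v u' v'| ≤ K * δ ∧ |energyDeriv₂ e ε u v u' v' u'' v''| ≤ K * δ := by
  obtain ⟨C, hC0, hC⟩ := BellmanExponents.exists_derivative_bound e hε (N ^ 2 + ε)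
  refine ⟨C * (16 * N ^ 3 + 8 * N), by positivity,
    fun δ hδ hδN u u' u'' v v' v'' hu hv hu' hv' hu'' hv'' => ?_⟩
  have hmem : ∀ x : ℝ, 0 ≤ x → x ≤ δ → x ^ 2 + ε ∈ Set.Icc ε (N ^ 2 + ε) := fun x hx hxδ =>
    ⟨by linarith [sq_nonneg x], by
      have : x ^ 2 ≤ N ^ 2 := pow_le_pow_left₀ hx (hxδ.trans hδN) 2
      linarith⟩
  obtain ⟨c1, c2, c3, c4, c5⟩ := hC _ (hmem _ (norm_nonneg u) hu) _ (hmem _ (norm_nonneg v) hv)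
  have i1 := abs_two_mul_inner_le hu hu'
  have i2 := abs_two_mul_inner_le hv hv'
  have n1 := abs_two_mul_norm_sq_add_inner_le hu' hu hu''
  have n2 := abs_two_mul_norm_sq_add_inner_le hv' hv hv''
  have hmul : ∀ x y X Y : ℝ, |x| ≤ X → |y| ≤ Y → |x * y| ≤ X * Y := fun x y X Y hx hy => by
    rw [abs_mul]
    exact mul_le_mul hx hy (abs_nonneg _) ((abs_nonneg _).trans hx)
  have hδ2 : δ ^ 2 ≤ N * δ := by
    rw [sq]
    gcongr
  have hδ4 : δ ^ 4 ≤ N ^ 3 * δ := by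
    rw [show δ ^ 4 = δ ^ 3 * δ by ring]
    gcongr
  have hCN3 : C * δ ^ 4 ≤ C * (N ^ 3 * δ) := mul_le_mul_of_nonneg_left hδ4 hC0
  have hCN2 : C * δ ^ 2 ≤ C * (N * δ) := mul_le_mul_of_nonneg_left hδ2 hC0
  have hN3 : 0 ≤ C * (N ^ 3 * δ) := by positivity
  have hN1 : 0 ≤ C * (N * δ) := by positivity
  constructor
  · refine (abs_add_le _ _).trans ?_
    have := hmul _ _ _ _ c1 i1
    have := hmul _ _ _ _ c2 i2
    linarith
  · refine (abs_add_le _ _).trans ?_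
    have a1 : ∀ α β : ℝ, |α| ≤ C → |β| ≤ C →
        |α * (2 * inner ℝ u u') + β * (2 * inner ℝ v v')| ≤ 4 * C * δ ^ 2 := by
      intro α β hα hβ
      refine (abs_add_le _ _).trans ?_
      have := hmul _ _ _ _ hα i1
      have := hmul _ _ _ _ hβ i2
      linarith
    have a2 := hmul _ _ _ _ (a1 _ _ c3 c4) i1
    have a3 := hmul _ _ _ _ (a1 _ _ c4 c5) i2
    have a4 := hmul _ _ _ _ c1 n1
    have a5 := hmul _ _ _ _ c2 n2
    refine (add_le_add ((abs_add_le _ _).trans (add_le_add a2 a4))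
      ((abs_add_le _ _).trans (add_le_add a3 a5))).trans ?_
    linarith

end Energy

/-- A smooth solution `U : ℝ × ℝ^d → E` of `∂_t² U + Δ U = (|x|² + σ) U`, with `σ ≥ 0`, bundled
with its derivatives, which all have Gaussian decay in `x` and exponential decay in `t`. The
Poisson extensions `e^{-t √(L + σ)} f` of finite Hermite expansions `f` are of this kind. -/
structure PoissonExtension (d : ℕ) (E : Type*) [NormedAddCommGroup E] [InnerProductSpace ℝ E] where
  /-- The nonnegative constant added to the potential. -/
  σ : ℝ
  /-- The function itself. -/
  val : ℝ → Space d → E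
  /-- Its first spatial derivatives. -/
  dx : Fin d → ℝ → Space d → E
  /-- Its pure second spatial derivatives. -/
  dxx : Fin d → ℝ → Space d → E
  /-- Its derivative in time. -/
  dt : ℝ → Space d → E
  /-- Its second derivative in time. -/
  dtt : ℝ → Space d → E
  σ_nonneg : 0 ≤ σ
  hasLineDerivAt_val : ∀ i t x,
    HasLineDerivAt ℝ (val t) (dx i t x) x (EuclideanSpace.single i (1 : ℝ))
  hasLineDerivAt_dx : ∀ i t x,
    HasLineDerivAt ℝ (dx i t) (dxx i t x) x (EuclideanSpace.single i (1 : ℝ))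
  hasDerivAt_val : ∀ t x, HasDerivAt (fun t => val t x) (dt t x) t
  hasDerivAt_dt : ∀ t x, HasDerivAt (fun t => dt t x) (dtt t x) t
  continuous_val : ∀ t, Continuous (val t)
  continuous_dx : ∀ i t, Continuous (dx i t)
  continuous_dxx : ∀ i t, Continuous (dxx i t)
  continuous_dt : ∀ t, Continuous (dt t)
  continuous_dtt : ∀ t, Continuous (dtt t)
  bound : ∀ T, ∃ C, 0 ≤ C ∧ ∀ t, T ≤ t → ∀ x,
    ‖val t x‖ ≤ C * (Real.exp (-t) * Real.exp (-‖x‖ ^ 2 / 4)) ∧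
    ‖dt t x‖ ≤ C * (Real.exp (-t) * Real.exp (-‖x‖ ^ 2 / 4)) ∧
    ‖dtt t x‖ ≤ C * (Real.exp (-t) * Real.exp (-‖x‖ ^ 2 / 4)) ∧
    (∀ i, ‖dx i t x‖ ≤ C * (Real.exp (-t) * Real.exp (-‖x‖ ^ 2 / 4))) ∧
    ∀ i, ‖dxx i t x‖ ≤ C * (Real.exp (-t) * Real.exp (-‖x‖ ^ 2 / 4))
  equation : ∀ t x, ∑ i, dxx i t x + dtt t x = (‖x‖ ^ 2 + σ) • val t x

namespace PoissonExtension

variable {d : ℕ} {E₁ E₂ : Type*} [NormedAddCommGroup E₁] [InnerProductSpace ℝ E₁]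
  [NormedAddCommGroup E₂] [InnerProductSpace ℝ E₂]

/-- The square of the full gradient, potential included:
`|∂_t U|² + |∇ U|² + |x|² |U|²`. -/
noncomputable def gradSq (U : PoissonExtension d E₁) (t : ℝ) (x : Space d) : ℝ :=
  ‖U.dt t x‖ ^ 2 + ∑ i, ‖U.dx i t x‖ ^ 2 + ‖x‖ ^ 2 * ‖U.val t x‖ ^ 2

variable (U : PoissonExtension d E₁) (V : PoissonExtension d E₂) (e : BellmanExponents)

/-- The space-time Laplacian of the energy dominates the gradients, with a weight and its
inverse. -/
theorem le_laplacian_energy {ε : ℝ} (hε : 0 < ε) (t : ℝ) (x : Space d) :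
    (2 * e.b - 1) * (e.τ (‖U.val t x‖ ^ 2 + ε) (‖V.val t x‖ ^ 2 + ε) / 8 * U.gradSq t x +
        V.gradSq t x / (2 * e.τ (‖U.val t x‖ ^ 2 + ε) (‖V.val t x‖ ^ 2 + ε))) ≤
      ∑ i, energyDeriv₂ e ε (U.val t x) (V.val t x) (U.dx i t x) (V.dx i t x) (U.dxx i t x)
        (V.dxx i t x) +
      energyDeriv₂ e ε (U.val t x) (V.val t x) (U.dt t x) (V.dt t x) (U.dtt t x)
        (V.dtt t x) := by
  have ht := le_energyDeriv₂ (e := e) hε (U.val t x) (V.val t x) (U.dt t x) (V.dt t x)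
    (U.dtt t x) (V.dtt t x)
  have hx := Finset.sum_le_sum fun i (_ : i ∈ Finset.univ) => le_energyDeriv₂ (e := e) hε
    (U.val t x) (V.val t x) (U.dx i t x) (V.dx i t x) (U.dxx i t x) (V.dxx i t x)
  have p1 : 0 < ‖U.val t x‖ ^ 2 + ε := by positivity
  have p2 : 0 < ‖V.val t x‖ ^ 2 + ε := by positivity
  have hτ := BellmanExponents.τ_pos (e := e) p1 p2
  have hFr := BellmanExponents.γ_mul_τ_le_Fr (e := e) p1 p2
  have hFs := BellmanExponents.b_div_τ_le_Fs (e := e) p1 p2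
  have hUeq : ∑ i, inner ℝ (U.val t x) (U.dxx i t x) + inner ℝ (U.val t x) (U.dtt t x) =
      (‖x‖ ^ 2 + U.σ) * ‖U.val t x‖ ^ 2 := by
    rw [← inner_sum, ← inner_add_right, U.equation, inner_smul_right, real_inner_self_eq_norm_sq]
  have hVeq : ∑ i, inner ℝ (V.val t x) (V.dxx i t x) + inner ℝ (V.val t x) (V.dtt t x) =
      (‖x‖ ^ 2 + V.σ) * ‖V.val t x‖ ^ 2 := by
    rw [← inner_sum, ← inner_add_right, V.equation, inner_smul_right, real_inner_self_eq_norm_sq]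
  unfold gradSq
  set r := ‖U.val t x‖ ^ 2 + ε
  set s := ‖V.val t x‖ ^ 2 + ε
  have hb := e.half_lt_b
  have hb1 := e.b_le_one
  simp only [Finset.sum_add_distrib, ← Finset.mul_sum, ← Finset.sum_div] at hx
  have kU : (2 * e.b - 1) * (e.τ r s / 8 * (‖x‖ ^ 2 * ‖U.val t x‖ ^ 2)) ≤
      2 * e.Fr r s * ((‖x‖ ^ 2 + U.σ) * ‖U.val t x‖ ^ 2) := by
    have h1 := U.σ_nonneg
    calc _ = e.γ * e.τ r s * (‖x‖ ^ 2 * ‖U.val t x‖ ^ 2) := by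
          unfold BellmanExponents.γ
          ring
      _ ≤ e.Fr r s * ((‖x‖ ^ 2 + U.σ) * ‖U.val t x‖ ^ 2) := by
          have := BellmanExponents.Fr_nonneg (e := e) p1 p2
          gcongr
          linarith
      _ ≤ _ := by
          have h2 : 0 ≤ e.Fr r s * ((‖x‖ ^ 2 + U.σ) * ‖U.val t x‖ ^ 2) :=
            mul_nonneg (BellmanExponents.Fr_nonneg p1 p2) (by positivity)
          linarith
  have kV : (2 * e.b - 1) * ((‖x‖ ^ 2 * ‖V.val t x‖ ^ 2) / (2 * e.τ r s)) ≤
      2 * e.Fs r s * ((‖x‖ ^ 2 + V.σ) * ‖V.val t x‖ ^ 2) := by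
    have h1 := V.σ_nonneg
    calc _ ≤ e.b * 4 * ((‖x‖ ^ 2 * ‖V.val t x‖ ^ 2) / (2 * e.τ r s)) := by
          gcongr
          linarith
      _ = 2 * (e.b / e.τ r s) * (‖x‖ ^ 2 * ‖V.val t x‖ ^ 2) := by
          field_simp
          ring
      _ ≤ _ := by
          have := BellmanExponents.Fs_nonneg (e := e) p1 p2
          gcongr
          linarith
  have e1 : (2 * e.b - 1) * (e.τ r s / 8 * (‖U.dt t x‖ ^ 2 + ∑ i, ‖U.dx i t x‖ ^ 2 +
      ‖x‖ ^ 2 * ‖U.val t x‖ ^ 2) + (‖V.dt t x‖ ^ 2 + ∑ i, ‖V.dx i t x‖ ^ 2 +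
      ‖x‖ ^ 2 * ‖V.val t x‖ ^ 2) / (2 * e.τ r s)) =
      (2 * e.b - 1) * (e.τ r s / 8 * ∑ i, ‖U.dx i t x‖ ^ 2 +
        (∑ i, ‖V.dx i t x‖ ^ 2) / (2 * e.τ r s)) +
      (2 * e.b - 1) * (e.τ r s / 8 * ‖U.dt t x‖ ^ 2 + ‖V.dt t x‖ ^ 2 / (2 * e.τ r s)) +
      ((2 * e.b - 1) * (e.τ r s / 8 * (‖x‖ ^ 2 * ‖U.val t x‖ ^ 2)) +
        (2 * e.b - 1) * ((‖x‖ ^ 2 * ‖V.val t x‖ ^ 2) / (2 * e.τ r s))) := by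
    ring
  rw [← hUeq] at kU
  rw [← hVeq] at kV
  rw [e1]
  linarith

end PoissonExtension
end HarmonicOscillator

namespace HarmonicOscillator

section Profile

variable {d : ℕ}

theorem integrable_exp_neg_norm_sq_div_four :
    Integrable (fun x : Space d => Real.exp (-‖x‖ ^ 2 / 4)) := by
  refine (integrable_exp_neg_mul_norm_sq (d := d) (b := 1 / 4) (by norm_num)).congr
    (ae_of_all _ fun x => ?_)
  simp only
  congr 1
  ring

theorem integrable_of_abs_le_profile {G : Space d → ℝ} (hG : AEStronglyMeasurable G) {K t : ℝ}
    (hb : ∀ x, |G x| ≤ K * (Real.exp (-t) * Real.exp (-‖x‖ ^ 2 / 4))) : Integrable G :=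
  ((integrable_exp_neg_norm_sq_div_four.const_mul (Real.exp (-t))).const_mul K).mono' hG
    (ae_of_all _ hb)

/-- Differentiation under the integral for functions of `(t, x)` with Gaussian decay in `x`. -/
theorem hasDerivAt_integral_of_le_profile {G G' : ℝ → Space d → ℝ}
    (hG : ∀ t, AEStronglyMeasurable (G t)) (hG' : ∀ t, AEStronglyMeasurable (G' t))
    (hd : ∀ t x, HasDerivAt (fun t => G t x) (G' t x) t)
    (hb : ∀ T, ∃ K, 0 ≤ K ∧ ∀ t, T ≤ t → ∀ x,
      |G t x| ≤ K * (Real.exp (-t) * Real.exp (-‖x‖ ^ 2 / 4)) ∧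
      |G' t x| ≤ K * (Real.exp (-t) * Real.exp (-‖x‖ ^ 2 / 4))) (t : ℝ) :
    HasDerivAt (fun t => ∫ x, G t x) (∫ x, G' t x) t := by
  obtain ⟨K, hK0, hK⟩ := hb (t - 1)
  refine (hasDerivAt_integral_of_dominated_loc_of_deriv_le (F := G) (F' := G')
    (bound := fun x => K * (Real.exp (-(t - 1)) * Real.exp (-‖x‖ ^ 2 / 4)))
    (Metric.ball_mem_nhds t one_pos) (Eventually.of_forall hG)
    (integrable_of_abs_le_profile (hG t) fun x => (hK t (by linarith) x).1) (hG' t)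
    (ae_of_all _ fun x s hs => ?_)
    ((integrable_exp_neg_norm_sq_div_four.const_mul _).const_mul K)
    (ae_of_all _ fun x s _ => hd s x)).2
  rw [Metric.mem_ball, Real.dist_eq, abs_lt] at hs
  refine (hK s (by linarith) x).2.trans ?_
  gcongr
  linarith

theorem tendsto_integral_of_le_profile {G : ℝ → Space d → ℝ} {K : ℝ}
    (hb : ∀ t, 0 ≤ t → ∀ x, |G t x| ≤ K * (Real.exp (-t) * Real.exp (-‖x‖ ^ 2 / 4))) :
    Tendsto (fun t => ∫ x, G t x) atTop (𝓝 0) := by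
  have h1 : Tendsto (fun t : ℝ => K * (Real.exp (-t) * ∫ x : Space d, Real.exp (-‖x‖ ^ 2 / 4)))
      atTop (𝓝 0) := by
    have := ((Real.tendsto_exp_neg_atTop_nhds_zero).mul_const
      (∫ x : Space d, Real.exp (-‖x‖ ^ 2 / 4))).const_mul K
    simpa using this
  refine squeeze_zero_norm' ?_ h1
  filter_upwards [eventually_ge_atTop 0] with t ht
  rw [← integral_const_mul, ← integral_const_mul]
  exact norm_integral_le_of_norm_le
    ((integrable_exp_neg_norm_sq_div_four.const_mul _).const_mul K) (ae_of_all _ (hb t ht))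

/-- The integral of a directional derivative vanishes. -/
theorem integral_eq_zero_of_hasLineDerivAt {G G' : Space d → ℝ} {v : Space d}
    (hG : Integrable G) (hG' : Integrable G') (hd : ∀ x, HasLineDerivAt ℝ G (G' x) x v) :
    ∫ x, G' x = 0 := by
  have h := integral_bilinear_hasLineDerivAt_right_eq_neg_left_of_integrable
    (μ := (volume : Measure (Space d))) (f := fun _ => (1 : ℝ)) (f' := fun _ => 0) (g := G)
    (g' := G') (v := v) (B := ContinuousLinearMap.mul ℝ ℝ) (by simp) (by simpa using hG')
    (by simpa using hG) (fun x _ => by simpa [HasLineDerivAt] using hasDerivAt_const (0 : ℝ) (1 : ℝ))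
    (fun x _ => hd x)
  simpa using h

end Profile

/-- A convex function that tends to zero at infinity is nonnegative. -/
theorem nonneg_of_convex_of_tendsto_zero {G G₁ G₂ : ℝ → ℝ} (h1 : ∀ t, HasDerivAt G (G₁ t) t)
    (h2 : ∀ t, HasDerivAt G₁ (G₂ t) t) (h3 : ∀ t, 0 ≤ G₂ t) (h4 : Tendsto G atTop (𝓝 0)) :
    0 ≤ G 0 := by
  have hG1 : Monotone G₁ := monotone_of_hasDerivAt_nonneg h2 h3
  have hneg : ∀ t, G₁ t ≤ 0 := by
    intro t₀
    by_contra hpos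
    push Not at hpos
    have hlin : ∀ t, t₀ ≤ t → G t₀ + G₁ t₀ * (t - t₀) ≤ G t := by
      intro t ht
      have hmono : MonotoneOn (fun s => G s - G₁ t₀ * s) (Set.Ici t₀) := by
        refine monotoneOn_of_hasDerivWithinAt_nonneg (f' := fun s => G₁ s - G₁ t₀ * 1)
          (convex_Ici t₀) ?_ ?_ ?_
        · exact fun s _ => ((h1 s).sub ((hasDerivAt_id s).const_mul
            (G₁ t₀))).continuousAt.continuousWithinAt
        · exact fun s _ => ((h1 s).sub ((hasDerivAt_id s).const_mul
            (G₁ t₀))).hasDerivWithinAt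
        · intro s hs
          rw [interior_Ici] at hs
          have := hG1 (le_of_lt hs)
          linarith
      have := hmono (Set.self_mem_Ici) (Set.mem_Ici.2 ht) ht
      simp only at this
      linarith
    have htop : Tendsto (fun t => G t₀ + G₁ t₀ * (t - t₀)) atTop atTop :=
      tendsto_atTop_add_const_left _ _
        ((tendsto_atTop_add_const_right _ (-t₀) tendsto_id).const_mul_atTop hpos)
    have := tendsto_atTop_mono' atTop ((eventually_ge_atTop t₀).mono hlin) htop
    exact not_tendsto_nhds_of_tendsto_atTop this 0 h4
  have hanti : Antitone G := antitone_of_hasDerivAt_nonpos h1 hneg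
  exact hanti.le_of_tendsto h4 0

namespace PoissonExtension

variable {d : ℕ} {E₁ E₂ : Type*} [NormedAddCommGroup E₁] [InnerProductSpace ℝ E₁]
  [NormedAddCommGroup E₂] [InnerProductSpace ℝ E₂]

section Measurability

variable (e : BellmanExponents) (ε : ℝ) {u u' u'' : Space d → E₁} {v v' v'' : Space d → E₂}

theorem measurable_energyDeriv (hu : Continuous u) (hv : Continuous v) (hu' : Continuous u')
    (hv' : Continuous v') : Measurable (fun x => energyDeriv e ε (u x) (v x) (u' x) (v' x)) := by
  have a1 : Measurable (fun x => ‖u x‖) := hu.norm.measurable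
  have a2 : Measurable (fun x => ‖v x‖) := hv.norm.measurable
  have a3 : Measurable (fun x => inner ℝ (u x) (u' x)) := (hu.inner hu').measurable
  have a4 : Measurable (fun x => inner ℝ (v x) (v' x)) := (hv.inner hv').measurable
  unfold energyDeriv BellmanExponents.Fr BellmanExponents.Fs BellmanExponents.τ BellmanExponents.S
  fun_prop

theorem measurable_energyDeriv₂ (hu : Continuous u) (hv : Continuous v) (hu' : Continuous u')
    (hv' : Continuous v') (hu'' : Continuous u'') (hv'' : Continuous v'') :
    Measurable (fun x => energyDeriv₂ e ε (u x) (v x) (u' x) (v' x) (u'' x) (v'' x)) := by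
  have a1 : Measurable (fun x => ‖u x‖) := hu.norm.measurable
  have a2 : Measurable (fun x => ‖v x‖) := hv.norm.measurable
  have a3 : Measurable (fun x => inner ℝ (u x) (u' x)) := (hu.inner hu').measurable
  have a4 : Measurable (fun x => inner ℝ (v x) (v' x)) := (hv.inner hv').measurable
  have a5 : Measurable (fun x => inner ℝ (u x) (u'' x)) := (hu.inner hu'').measurable
  have a6 : Measurable (fun x => inner ℝ (v x) (v'' x)) := (hv.inner hv'').measurable
  have a7 : Measurable (fun x => ‖u' x‖) := hu'.norm.measurable
  have a8 : Measurable (fun x => ‖v' x‖) := hv'.norm.measurable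
  unfold energyDeriv₂ BellmanExponents.Fr BellmanExponents.Fs BellmanExponents.Frr
    BellmanExponents.Frs BellmanExponents.Fss BellmanExponents.τ BellmanExponents.S
  fun_prop

end Measurability

variable (U : PoissonExtension d E₁) (V : PoissonExtension d E₂) (e : BellmanExponents)

/-- Both extensions obey the same bounds, whose constant also bounds their size. -/
theorem exists_common_bound (T : ℝ) : ∃ C N, 0 ≤ C ∧ 0 ≤ N ∧ ∀ t, T ≤ t → ∀ x,
    (0 ≤ C * (Real.exp (-t) * Real.exp (-‖x‖ ^ 2 / 4)) ∧
      C * (Real.exp (-t) * Real.exp (-‖x‖ ^ 2 / 4)) ≤ N) ∧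
    (‖U.val t x‖ ≤ C * (Real.exp (-t) * Real.exp (-‖x‖ ^ 2 / 4)) ∧
    ‖U.dt t x‖ ≤ C * (Real.exp (-t) * Real.exp (-‖x‖ ^ 2 / 4)) ∧
    ‖U.dtt t x‖ ≤ C * (Real.exp (-t) * Real.exp (-‖x‖ ^ 2 / 4)) ∧
    (∀ i, ‖U.dx i t x‖ ≤ C * (Real.exp (-t) * Real.exp (-‖x‖ ^ 2 / 4))) ∧
    ∀ i, ‖U.dxx i t x‖ ≤ C * (Real.exp (-t) * Real.exp (-‖x‖ ^ 2 / 4))) ∧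
    (‖V.val t x‖ ≤ C * (Real.exp (-t) * Real.exp (-‖x‖ ^ 2 / 4)) ∧
    ‖V.dt t x‖ ≤ C * (Real.exp (-t) * Real.exp (-‖x‖ ^ 2 / 4)) ∧
    ‖V.dtt t x‖ ≤ C * (Real.exp (-t) * Real.exp (-‖x‖ ^ 2 / 4)) ∧
    (∀ i, ‖V.dx i t x‖ ≤ C * (Real.exp (-t) * Real.exp (-‖x‖ ^ 2 / 4))) ∧
    ∀ i, ‖V.dxx i t x‖ ≤ C * (Real.exp (-t) * Real.exp (-‖x‖ ^ 2 / 4))) := by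
  obtain ⟨C, hC0, hC⟩ := U.bound T
  obtain ⟨D, hD0, hD⟩ := V.bound T
  refine ⟨C + D, (C + D) * Real.exp (-T), by positivity, by positivity, fun t ht x => ?_⟩
  obtain ⟨c1, c2, c3, c4, c5⟩ := hC t ht x
  obtain ⟨d1, d2, d3, d4, d5⟩ := hD t ht x
  set δ := Real.exp (-t) * Real.exp (-‖x‖ ^ 2 / 4) with hδ
  have hδ0 : 0 ≤ δ := by positivity
  have hCδ : C * δ ≤ (C + D) * δ := by
    gcongr
    linarith
  have hDδ : D * δ ≤ (C + D) * δ := by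
    gcongr
    linarith
  refine ⟨⟨by positivity, ?_⟩, ⟨c1.trans hCδ, c2.trans hCδ, c3.trans hCδ,
    fun i => (c4 i).trans hCδ, fun i => (c5 i).trans hCδ⟩, ⟨d1.trans hDδ, d2.trans hDδ,
    d3.trans hDδ, fun i => (d4 i).trans hDδ, fun i => (d5 i).trans hDδ⟩⟩
  have h1 : Real.exp (-t) ≤ Real.exp (-T) := Real.exp_le_exp.2 (by linarith)
  have h2 : Real.exp (-‖x‖ ^ 2 / 4) ≤ 1 := by
    rw [Real.exp_le_one_iff]
    have := sq_nonneg ‖x‖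
    linarith
  have h3 : δ ≤ Real.exp (-T) * 1 := mul_le_mul h1 h2 (Real.exp_pos _).le (Real.exp_pos _).le
  rw [mul_one] at h3
  gcongr

theorem exists_abs_energy_le (T : ℝ) : ∃ K, 0 ≤ K ∧ ∀ ε, 0 < ε → ε ≤ 1 → ∀ t, T ≤ t → ∀ x,
    |energy e ε (U.val t x) (V.val t x)| ≤
      K * (Real.exp (-t) * Real.exp (-‖x‖ ^ 2 / 4)) := by
  obtain ⟨C, N, hC0, hN0, hC⟩ := exists_common_bound U V T
  obtain ⟨K, hK0, hK⟩ := exists_energy_le (E₁ := E₁) (E₂ := E₂) e hN0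
  refine ⟨K * C, by positivity, fun ε hε hε1 t ht x => ?_⟩
  obtain ⟨⟨hδ0, hδN⟩, ⟨c1, -⟩, ⟨d1, -⟩⟩ := hC t ht x
  rw [abs_of_nonneg (energy_nonneg hε.le _ _), mul_assoc]
  exact hK ε hε hε1 _ hδ0 hδN _ _ c1 d1

theorem exists_abs_energyDeriv_le {ε : ℝ} (hε : 0 < ε) (T : ℝ) : ∃ K, 0 ≤ K ∧ ∀ t, T ≤ t → ∀ x,
    (|energyDeriv e ε (U.val t x) (V.val t x) (U.dt t x) (V.dt t x)| ≤
      K * (Real.exp (-t) * Real.exp (-‖x‖ ^ 2 / 4)) ∧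
    |energyDeriv₂ e ε (U.val t x) (V.val t x) (U.dt t x) (V.dt t x) (U.dtt t x) (V.dtt t x)| ≤
      K * (Real.exp (-t) * Real.exp (-‖x‖ ^ 2 / 4))) ∧
    ∀ i, |energyDeriv e ε (U.val t x) (V.val t x) (U.dx i t x) (V.dx i t x)| ≤
      K * (Real.exp (-t) * Real.exp (-‖x‖ ^ 2 / 4)) ∧
    |energyDeriv₂ e ε (U.val t x) (V.val t x) (U.dx i t x) (V.dx i t x) (U.dxx i t x)
      (V.dxx i t x)| ≤ K * (Real.exp (-t) * Real.exp (-‖x‖ ^ 2 / 4)) := by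
  obtain ⟨C, N, hC0, hN0, hC⟩ := exists_common_bound U V T
  obtain ⟨K, hK0, hK⟩ := exists_energyDeriv_le (E₁ := E₁) (E₂ := E₂) e hε hN0
  refine ⟨K * C, by positivity, fun t ht x => ?_⟩
  obtain ⟨⟨hδ0, hδN⟩, ⟨c1, c2, c3, c4, c5⟩, ⟨d1, d2, d3, d4, d5⟩⟩ := hC t ht x
  rw [mul_assoc]
  exact ⟨hK _ hδ0 hδN _ _ _ _ _ _ c1 d1 c2 d2 c3 d3,
    fun i => hK _ hδ0 hδN _ _ _ _ _ _ c1 d1 (c4 i) (d4 i) (c5 i) (d5 i)⟩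

theorem integral_energyDeriv₂_dx {ε : ℝ} (hε : 0 < ε) (t : ℝ) (i : Fin d) :
    Integrable (fun x => energyDeriv₂ e ε (U.val t x) (V.val t x) (U.dx i t x) (V.dx i t x)
      (U.dxx i t x) (V.dxx i t x)) ∧
    ∫ x, energyDeriv₂ e ε (U.val t x) (V.val t x) (U.dx i t x) (V.dx i t x) (U.dxx i t x)
      (V.dxx i t x) = 0 := by
  obtain ⟨K, hK0, hK⟩ := exists_abs_energyDeriv_le U V e hε t
  have i1 := integrable_of_abs_le_profile (measurable_energyDeriv e ε (U.continuous_val t)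
    (V.continuous_val t) (U.continuous_dx i t) (V.continuous_dx i t)).aestronglyMeasurable
    fun x => ((hK t le_rfl x).2 i).1
  have i2 := integrable_of_abs_le_profile (measurable_energyDeriv₂ e ε (U.continuous_val t)
    (V.continuous_val t) (U.continuous_dx i t) (V.continuous_dx i t) (U.continuous_dxx i t)
    (V.continuous_dxx i t)).aestronglyMeasurable fun x => ((hK t le_rfl x).2 i).2
  refine ⟨i2, integral_eq_zero_of_hasLineDerivAt (v := EuclideanSpace.single i (1 : ℝ)) i1 i2
    fun x => ?_⟩
  have h := hasDerivAt_energyDeriv (e := e) hε (h := 0)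
    (u := fun s => U.val t (x + s • EuclideanSpace.single i (1 : ℝ)))
    (u' := fun s => U.dx i t (x + s • EuclideanSpace.single i (1 : ℝ)))
    (v := fun s => V.val t (x + s • EuclideanSpace.single i (1 : ℝ)))
    (v' := fun s => V.dx i t (x + s • EuclideanSpace.single i (1 : ℝ)))
    (by simpa [HasLineDerivAt] using U.hasLineDerivAt_val i t x)
    (by simpa [HasLineDerivAt] using V.hasLineDerivAt_val i t x)
    (U.hasLineDerivAt_dx i t x) (V.hasLineDerivAt_dx i t x)
  simpa [HasLineDerivAt] using h

/-- **Bilinear embedding**, regularized form. A twice differentiable function `Ψ` of `t` that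
vanishes at infinity and whose second derivative is the integral of a function dominated by the
gradients of the extensions is controlled at `t = 0` by the integral of the energy there. -/
theorem abs_le_integral_energy {ε : ℝ} (hε : 0 < ε) (hε1 : ε ≤ 1) {Ψ Ψ₁ Ψ₂ : ℝ → ℝ}
    {w : ℝ → Space d → ℝ} (h1 : ∀ t, HasDerivAt Ψ (Ψ₁ t) t) (h2 : ∀ t, HasDerivAt Ψ₁ (Ψ₂ t) t)
    (h3 : Tendsto Ψ atTop (𝓝 0)) (hw : ∀ t, Integrable (w t)) (h4 : ∀ t, Ψ₂ t = ∫ x, w t x)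
    (h5 : ∀ t x lam, 0 < lam →
      |w t x| ≤ 16 * (lam / 8 * U.gradSq t x + V.gradSq t x / (2 * lam))) :
    |Ψ 0| ≤ 16 / (2 * e.b - 1) * ∫ x, energy e ε (U.val 0 x) (V.val 0 x) := by
  have hb : 0 < 2 * e.b - 1 := by linarith [e.half_lt_b]
  set Φ : ℝ → ℝ := fun t => ∫ x, energy e ε (U.val t x) (V.val t x) with hΦ
  set Φ₁ : ℝ → ℝ := fun t => ∫ x, energyDeriv e ε (U.val t x) (V.val t x) (U.dt t x) (V.dt t x)
    with hΦ₁
  set Φ₂ : ℝ → ℝ := fun t => ∫ x, energyDeriv₂ e ε (U.val t x) (V.val t x) (U.dt t x) (V.dt t x)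
    (U.dtt t x) (V.dtt t x) with hΦ₂
  have m0 : ∀ t, AEStronglyMeasurable (fun x => energy e ε (U.val t x) (V.val t x)) := fun t =>
    (continuous_energy e ε (U.continuous_val t) (V.continuous_val t)).aestronglyMeasurable
  have m1 : ∀ t, AEStronglyMeasurable (fun x => energyDeriv e ε (U.val t x) (V.val t x)
      (U.dt t x) (V.dt t x)) := fun t =>
    (measurable_energyDeriv e ε (U.continuous_val t) (V.continuous_val t) (U.continuous_dt t)
      (V.continuous_dt t)).aestronglyMeasurable
  have m2 : ∀ t, AEStronglyMeasurable (fun x => energyDeriv₂ e ε (U.val t x) (V.val t x)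
      (U.dt t x) (V.dt t x) (U.dtt t x) (V.dtt t x)) := fun t =>
    (measurable_energyDeriv₂ e ε (U.continuous_val t) (V.continuous_val t) (U.continuous_dt t)
      (V.continuous_dt t) (U.continuous_dtt t) (V.continuous_dtt t)).aestronglyMeasurable
  have d1 : ∀ t, HasDerivAt Φ (Φ₁ t) t := by
    refine hasDerivAt_integral_of_le_profile m0 m1
      (fun t x => hasDerivAt_energy hε (U.hasDerivAt_val t x) (V.hasDerivAt_val t x)) fun T => ?_
    obtain ⟨K, hK0, hK⟩ := exists_abs_energy_le U V e T
    obtain ⟨L, hL0, hL⟩ := exists_abs_energyDeriv_le U V e hε T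
    refine ⟨K + L, by positivity, fun t ht x => ⟨(hK ε hε hε1 t ht x).trans ?_,
      (hL t ht x).1.1.trans ?_⟩⟩ <;> gcongr <;> linarith
  have d2 : ∀ t, HasDerivAt Φ₁ (Φ₂ t) t := by
    refine hasDerivAt_integral_of_le_profile m1 m2
      (fun t x => hasDerivAt_energyDeriv hε (U.hasDerivAt_val t x) (V.hasDerivAt_val t x)
        (U.hasDerivAt_dt t x) (V.hasDerivAt_dt t x)) fun T => ?_
    obtain ⟨L, hL0, hL⟩ := exists_abs_energyDeriv_le U V e hε T
    exact ⟨L, hL0, fun t ht x => (hL t ht x).1⟩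
  have hΦ0 : Tendsto Φ atTop (𝓝 0) := by
    obtain ⟨K, -, hK⟩ := exists_abs_energy_le U V e 0
    exact tendsto_integral_of_le_profile fun t ht x => hK ε hε hε1 t ht x
  have key : ∀ t, |Ψ₂ t| ≤ 16 / (2 * e.b - 1) * Φ₂ t := by
    intro t
    obtain ⟨K, hK0, hK⟩ := exists_abs_energyDeriv_le U V e hε t
    have it := integrable_of_abs_le_profile (m2 t) fun x => (hK t le_rfl x).1.2
    have ix := fun i => integral_energyDeriv₂_dx U V e hε t i
    have hsum : Φ₂ t = ∫ x, (∑ i, energyDeriv₂ e ε (U.val t x) (V.val t x) (U.dx i t x)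
        (V.dx i t x) (U.dxx i t x) (V.dxx i t x) +
        energyDeriv₂ e ε (U.val t x) (V.val t x) (U.dt t x) (V.dt t x) (U.dtt t x)
          (V.dtt t x)) := by
      rw [integral_add (integrable_finsetSum _ fun i _ => (ix i).1) it,
        integral_finsetSum _ fun i _ => (ix i).1]
      simp [(ix _).2, hΦ₂]
    rw [h4, hsum, ← integral_const_mul]
    refine (abs_integral_le_integral_abs).trans (integral_mono (hw t).abs
      (((integrable_finsetSum _ fun i _ => (ix i).1).add it).const_mul _) fun x => ?_)
    have hτ := BellmanExponents.τ_pos (e := e) (r := ‖U.val t x‖ ^ 2 + ε)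
      (s := ‖V.val t x‖ ^ 2 + ε) (by positivity) (by positivity)
    refine (h5 t x _ hτ).trans ?_
    have := mul_le_mul_of_nonneg_left (le_laplacian_energy U V e hε t x)
      (show 0 ≤ 16 / (2 * e.b - 1) by positivity)
    rw [← mul_assoc, div_mul_cancel₀ _ hb.ne'] at this
    exact this
  have hc : ∀ c : ℝ, |c| = 1 → 0 ≤ 16 / (2 * e.b - 1) * Φ 0 + c * Ψ 0 := by
    intro c hc
    refine nonneg_of_convex_of_tendsto_zero
      (G := fun t => 16 / (2 * e.b - 1) * Φ t + c * Ψ t)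
      (fun t => ((d1 t).const_mul _).add ((h1 t).const_mul c))
      (fun t => ((d2 t).const_mul _).add ((h2 t).const_mul c)) (fun t => ?_) ?_
    · have h6 := key t
      have h7 : |c * Ψ₂ t| = |Ψ₂ t| := by rw [abs_mul, hc, one_mul]
      have := neg_abs_le (c * Ψ₂ t)
      linarith
    · simpa using (hΦ0.const_mul (16 / (2 * e.b - 1))).add (h3.const_mul c)
  rw [abs_le]
  constructor
  · have := hc 1 (by simp)
    linarith
  · have := hc (-1) (by simp)
    linarith

theorem integrable_norm_rpow (W : PoissonExtension d E₁) {c : ℝ} (hc : 1 ≤ c) :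
    Integrable (fun x => ‖W.val 0 x‖ ^ c) := by
  obtain ⟨C, hC0, hC⟩ := W.bound 0
  refine ((integrable_exp_neg_norm_sq_div_four (d := d)).const_mul (C ^ c)).mono'
    ((W.continuous_val 0).norm.rpow_const fun _ =>
      Or.inr (by linarith)).aestronglyMeasurable (ae_of_all _ fun x => ?_)
  have h := (hC 0 le_rfl x).1
  simp only [neg_zero, Real.exp_zero, one_mul] at h
  rw [Real.norm_of_nonneg (by positivity)]
  calc ‖W.val 0 x‖ ^ c ≤ (C * Real.exp (-‖x‖ ^ 2 / 4)) ^ c := by gcongr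
    _ = C ^ c * Real.exp (-‖x‖ ^ 2 / 4) ^ c := Real.mul_rpow hC0 (Real.exp_pos _).le
    _ ≤ C ^ c * Real.exp (-‖x‖ ^ 2 / 4) := by
      gcongr
      refine (Real.rpow_le_rpow_of_exponent_ge (Real.exp_pos _) ?_ hc).trans_eq
        (Real.rpow_one _)
      rw [Real.exp_le_one_iff]
      have := sq_nonneg ‖x‖
      linarith

/-- **Bilinear embedding**: the regularization in `abs_le_integral_energy` is removed. -/
theorem abs_le_integral_rpow {Ψ Ψ₁ Ψ₂ : ℝ → ℝ}
    {w : ℝ → Space d → ℝ} (h1 : ∀ t, HasDerivAt Ψ (Ψ₁ t) t) (h2 : ∀ t, HasDerivAt Ψ₁ (Ψ₂ t) t)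
    (h3 : Tendsto Ψ atTop (𝓝 0)) (hw : ∀ t, Integrable (w t)) (h4 : ∀ t, Ψ₂ t = ∫ x, w t x)
    (h5 : ∀ t x lam, 0 < lam →
      |w t x| ≤ 16 * (lam / 8 * U.gradSq t x + V.gradSq t x / (2 * lam))) :
    |Ψ 0| ≤ 18 / (2 * e.b - 1) *
      ((∫ x, ‖U.val 0 x‖ ^ (2 * e.a)) + ∫ x, ‖V.val 0 x‖ ^ (2 * e.b)) := by
  have hb : 0 < 2 * e.b - 1 := by linarith [e.half_lt_b]
  obtain ⟨K, hK0, hK⟩ := exists_abs_energy_le U V e 0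
  have hpow : ∀ (y c : ℝ), 0 ≤ y → (y ^ 2) ^ c = y ^ (2 * c) := fun y c hy => by
    rw [← Real.rpow_natCast, ← Real.rpow_mul hy]
    norm_num
  have iU := integrable_norm_rpow U (c := 2 * e.a) (by linarith [e.one_le_a])
  have iV := integrable_norm_rpow V (c := 2 * e.b) (by linarith [e.half_lt_b])
  have hF0 : ∀ x, energy e 0 (U.val 0 x) (V.val 0 x) ≤
      9 / 8 * (‖U.val 0 x‖ ^ (2 * e.a) + ‖V.val 0 x‖ ^ (2 * e.b)) := by
    intro x
    have h6 := BellmanExponents.F_le (e := e) (sq_nonneg ‖U.val 0 x‖) (sq_nonneg ‖V.val 0 x‖)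
    have h7 : 0 ≤ e.F 0 0 := by
      have h8 : 0 ≤ e.S 0 0 :=
        add_nonneg (Real.rpow_nonneg le_rfl _) (Real.rpow_nonneg le_rfl _)
      unfold BellmanExponents.F
      simpa using h8
    rw [hpow _ _ (norm_nonneg _), hpow _ _ (norm_nonneg _)] at h6
    simp only [energy, add_zero]
    linarith
  have hlim : Tendsto (fun n : ℕ => ∫ x, energy e (1 / ((n : ℝ) + 1)) (U.val 0 x) (V.val 0 x))
      atTop (𝓝 (∫ x, energy e 0 (U.val 0 x) (V.val 0 x))) := by
    refine tendsto_integral_of_dominated_convergence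
      (fun x => K * (Real.exp (-0) * Real.exp (-‖x‖ ^ 2 / 4)))
      (fun n => (continuous_energy e _ (U.continuous_val 0)
        (V.continuous_val 0)).aestronglyMeasurable)
      ((integrable_exp_neg_norm_sq_div_four.const_mul _).const_mul K)
      (fun n => ae_of_all _ fun x => ?_) (ae_of_all _ fun x => ?_)
    · refine hK _ (by positivity) ?_ 0 le_rfl x
      rw [div_le_one (by positivity)]
      have : (0 : ℝ) ≤ n := by positivity
      linarith
    · have hc : Continuous fun ε : ℝ => energy e ε (U.val 0 x) (V.val 0 x) :=
        (BellmanExponents.continuous_F.comp ((continuous_const.add continuous_id).prodMk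
          (continuous_const.add continuous_id))).sub
          (BellmanExponents.continuous_F.comp (continuous_id.prodMk continuous_id))
      exact (hc.tendsto 0).comp tendsto_one_div_add_atTop_nhds_zero_nat
  have hle : |Ψ 0| ≤ 16 / (2 * e.b - 1) * ∫ x, energy e 0 (U.val 0 x) (V.val 0 x) := by
    refine ge_of_tendsto' (hlim.const_mul _) fun n => ?_
    refine abs_le_integral_energy U V e (by positivity) ?_ h1 h2 h3 hw h4 h5
    rw [div_le_one (by positivity)]
    have : (0 : ℝ) ≤ n := by positivity
    linarith
  refine hle.trans ?_
  have hmono : ∫ x, energy e 0 (U.val 0 x) (V.val 0 x) ≤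
      9 / 8 * ((∫ x, ‖U.val 0 x‖ ^ (2 * e.a)) + ∫ x, ‖V.val 0 x‖ ^ (2 * e.b)) := by
    rw [← integral_add iU iV, ← integral_const_mul]
    exact integral_mono_of_nonneg (ae_of_all _ fun x => energy_nonneg le_rfl _ _)
      ((iU.add iV).const_mul _) (ae_of_all _ hF0)
  calc _ ≤ 16 / (2 * e.b - 1) * (9 / 8 * ((∫ x, ‖U.val 0 x‖ ^ (2 * e.a)) +
        ∫ x, ‖V.val 0 x‖ ^ (2 * e.b))) := by gcongr
    _ = _ := by ring

end PoissonExtension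
end HarmonicOscillator

namespace HarmonicOscillator

/-! ### Poisson extensions of finite Hermite expansions -/

variable {d : ℕ} {E : Type*} [NormedAddCommGroup E] [InnerProductSpace ℝ E]

/-- The finite Hermite expansion with (scalar or vector) coefficients `c`. -/
noncomputable def expansion (c : (Fin d → ℕ) →₀ E) (x : Space d) : E :=
  ∑ k ∈ c.support, hermiteFunction k x • c k

/-- The rate `√(λ_k + σ)` at which the `k`-th mode decays under the Poisson semigroup of
`L + σ`. -/
noncomputable def rate (σ : ℝ) (k : Fin d → ℕ) : ℝ := √(eigenvalue k + σ)

theorem one_le_eigenvalue (hd : 1 ≤ d) (k : Fin d → ℕ) : 1 ≤ eigenvalue k := by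
  have h1 : (1 : ℝ) ≤ d := by exact_mod_cast hd
  have h2 : 0 ≤ ∑ i, (k i : ℝ) := Finset.sum_nonneg fun i _ => Nat.cast_nonneg _
  unfold eigenvalue
  linarith

theorem one_le_rate (hd : 1 ≤ d) {σ : ℝ} (hσ : 0 ≤ σ) (k : Fin d → ℕ) : 1 ≤ rate σ k := by
  rw [rate, Real.one_le_sqrt]
  linarith [one_le_eigenvalue hd k]

theorem rate_sq (hd : 1 ≤ d) {σ : ℝ} (hσ : 0 ≤ σ) (k : Fin d → ℕ) :
    rate σ k ^ 2 = eigenvalue k + σ :=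
  Real.sq_sqrt (by linarith [one_le_eigenvalue hd k])

/-- A finite sum of decaying modes, `∑_k A_k e^{-√(λ_k + σ) t} ψ_k(x) c_k`. -/
noncomputable def modeSum (σ : ℝ) (c : (Fin d → ℕ) →₀ E) (A : (Fin d → ℕ) → ℝ)
    (ψ : (Fin d → ℕ) → Space d → ℝ) (t : ℝ) (x : Space d) : E :=
  ∑ k ∈ c.support, (A k * Real.exp (-rate σ k * t) * ψ k x) • c k

section ModeSum

variable {σ : ℝ} {c : (Fin d → ℕ) →₀ E} {A : (Fin d → ℕ) → ℝ}
  {ψ ψ' : (Fin d → ℕ) → Space d → ℝ}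

theorem hasLineDerivAt_modeSum {x v : Space d}
    (h : ∀ k, HasLineDerivAt ℝ (ψ k) (ψ' k x) x v) (t : ℝ) :
    HasLineDerivAt ℝ (modeSum σ c A ψ t) (modeSum σ c A ψ' t x) x v := by
  unfold HasLineDerivAt modeSum
  exact HasDerivAt.fun_sum fun k _ => (HasDerivAt.const_mul _ (h k)).smul_const _

theorem hasDerivAt_modeSum (t : ℝ) (x : Space d) :
    HasDerivAt (fun t => modeSum σ c A ψ t x)
      (modeSum σ c (fun k => A k * -rate σ k) ψ t x) t := by
  unfold modeSum
  refine HasDerivAt.fun_sum fun k _ => HasDerivAt.smul_const ?_ _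
  refine HasDerivAt.mul_const ?_ _
  have h := (((hasDerivAt_id t).const_mul (-rate σ k)).exp).const_mul (A k)
  convert! h using 1
  simp only [id]
  ring

theorem continuous_modeSum (h : ∀ k, Continuous (ψ k)) (t : ℝ) :
    Continuous (modeSum σ c A ψ t) := by
  unfold modeSum
  exact continuous_finsetSum _ fun k _ => (continuous_const.mul (h k)).smul continuous_const

theorem exists_norm_modeSum_le (hd : 1 ≤ d) (hσ : 0 ≤ σ)
    (h : ∀ k, ∃ C, 0 ≤ C ∧ ∀ x, |ψ k x| ≤ C * Real.exp (-‖x‖ ^ 2 / 4)) (T : ℝ) :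
    ∃ C, 0 ≤ C ∧ ∀ t, T ≤ t → ∀ x, ‖modeSum σ c A ψ t x‖ ≤
      C * (Real.exp (-t) * Real.exp (-‖x‖ ^ 2 / 4)) := by
  choose C hC0 hC using h
  refine ⟨∑ k ∈ c.support, |A k| * Real.exp ((rate σ k - 1) * |T|) * C k * ‖c k‖,
    Finset.sum_nonneg fun k _ => by have := hC0 k; positivity, fun t ht x => ?_⟩
  rw [Finset.sum_mul]
  refine norm_sum_le_of_le _ fun k _ => ?_
  rw [norm_smul, Real.norm_eq_abs, abs_mul, abs_mul, Real.abs_exp]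
  have h1 : Real.exp (-rate σ k * t) ≤ Real.exp ((rate σ k - 1) * |T|) * Real.exp (-t) := by
    rw [← Real.exp_add, Real.exp_le_exp]
    have h2 := one_le_rate hd hσ k
    have h3 : -|T| ≤ t := (neg_abs_le T).trans ht
    nlinarith
  calc |A k| * Real.exp (-rate σ k * t) * |ψ k x| * ‖c k‖
      ≤ |A k| * (Real.exp ((rate σ k - 1) * |T|) * Real.exp (-t)) *
        (C k * Real.exp (-‖x‖ ^ 2 / 4)) * ‖c k‖ := by
        gcongr
        exact hC k x
    _ = _ := by ring

end ModeSum

/-- The Poisson extension `e^{-t √(L + σ)} f` of a finite Hermite expansion `f`. -/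
noncomputable def poisson (hd : 1 ≤ d) (σ : ℝ) (hσ : 0 ≤ σ) (c : (Fin d → ℕ) →₀ E) :
    PoissonExtension d E where
  σ := σ
  val := modeSum σ c 1 hermiteFunction
  dx i := modeSum σ c 1 (partialHermite i)
  dxx i := modeSum σ c 1 fun k x => (x i ^ 2 - (2 * k i + 1)) * hermiteFunction k x
  dt := modeSum σ c (fun k => 1 * -rate σ k) hermiteFunction
  dtt := modeSum σ c (fun k => 1 * -rate σ k * -rate σ k) hermiteFunction
  σ_nonneg := hσ
  hasLineDerivAt_val i t x :=
    hasLineDerivAt_modeSum (fun k => hasLineDerivAt_hermiteFunction i k x) t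
  hasLineDerivAt_dx i t x :=
    hasLineDerivAt_modeSum (ψ' := fun k x => (x i ^ 2 - (2 * k i + 1)) * hermiteFunction k x)
      (fun k => hasLineDerivAt_partialHermite i k x) t
  hasDerivAt_val t x := hasDerivAt_modeSum t x
  hasDerivAt_dt t x := hasDerivAt_modeSum t x
  continuous_val t := continuous_modeSum continuous_hermiteFunction t
  continuous_dx i t := continuous_modeSum (continuous_partialHermite i) t
  continuous_dxx i t := continuous_modeSum (fun k => by
    have := continuous_hermiteFunction k
    fun_prop) t
  continuous_dt t := continuous_modeSum continuous_hermiteFunction t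
  continuous_dtt t := continuous_modeSum continuous_hermiteFunction t
  bound T := by
    obtain ⟨C1, p1, h1⟩ := exists_norm_modeSum_le (σ := σ) (c := c) (A := 1) hd hσ
      exists_abs_hermiteFunction_le T
    obtain ⟨C2, p2, h2⟩ := exists_norm_modeSum_le (σ := σ) (c := c)
      (A := fun k => 1 * -rate σ k) hd hσ exists_abs_hermiteFunction_le T
    obtain ⟨C3, p3, h3⟩ := exists_norm_modeSum_le (σ := σ) (c := c)
      (A := fun k => 1 * -rate σ k * -rate σ k) hd hσ exists_abs_hermiteFunction_le T
    choose C4 p4 h4 using fun i => exists_norm_modeSum_le (σ := σ) (c := c) (A := 1) hd hσ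
      (exists_abs_partialHermite_le i) T
    choose C5 p5 h5 using fun i => exists_norm_modeSum_le (σ := σ) (c := c) (A := 1) hd hσ
      (exists_abs_secondPartial_hermiteFunction_le i) T
    have s4 : ∀ i, C4 i ≤ ∑ i, C4 i := fun i =>
      Finset.single_le_sum (fun i _ => p4 i) (Finset.mem_univ i)
    have s5 : ∀ i, C5 i ≤ ∑ i, C5 i := fun i =>
      Finset.single_le_sum (fun i _ => p5 i) (Finset.mem_univ i)
    have q4 : 0 ≤ ∑ i, C4 i := Finset.sum_nonneg fun i _ => p4 i
    have q5 : 0 ≤ ∑ i, C5 i := Finset.sum_nonneg fun i _ => p5 i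
    refine ⟨C1 + C2 + C3 + ∑ i, C4 i + ∑ i, C5 i, by positivity, fun t ht x => ?_⟩
    refine ⟨(h1 t ht x).trans ?_, (h2 t ht x).trans ?_, (h3 t ht x).trans ?_,
      fun i => (h4 i t ht x).trans ?_, fun i => (h5 i t ht x).trans ?_⟩ <;> gcongr
    · linarith
    · linarith
    · linarith
    · linarith [s4 i]
    · linarith [s5 i]
  equation t x := by
    simp only [modeSum]
    rw [Finset.sum_comm, ← Finset.sum_add_distrib, Finset.smul_sum]
    refine Finset.sum_congr rfl fun k _ => ?_
    rw [← Finset.sum_smul, ← add_smul, smul_smul]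
    congr 1
    have h1 : ∑ i, (x i ^ 2 - (2 * (k i : ℝ) + 1)) = ‖x‖ ^ 2 - eigenvalue k := by
      rw [EuclideanSpace.norm_sq_eq]
      simp [eigenvalue, Finset.sum_add_distrib, ← Finset.mul_sum]
    rw [← Finset.mul_sum, ← Finset.sum_mul, h1]
    have h2 := rate_sq hd hσ k
    simp only [Pi.one_apply]
    linear_combination (Real.exp (-rate σ k * t) * hermiteFunction k x) * h2

theorem poisson_val_zero (hd : 1 ≤ d) (σ : ℝ) (hσ : 0 ≤ σ) (c : (Fin d → ℕ) →₀ E)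
    (x : Space d) : (poisson hd σ hσ c).val 0 x = expansion c x := by
  simp [poisson, modeSum, expansion]

/-! ### The pairing of the Riesz vector with a test function -/

/-- The `i`-th Riesz transform of the finite Hermite expansion with coefficients `a`. -/
noncomputable def rieszExpansion (a : (Fin d → ℕ) →₀ ℝ) (i : Fin d) (x : Space d) : ℝ :=
  ∑ k ∈ a.support, (√(eigenvalue k))⁻¹ * a k * √(2 * (k i : ℝ)) * hermiteFunction (lower i k) x

theorem integral_sum_hermite_mul_sum_hermite (s S : Finset (Fin d → ℕ)) (α β : (Fin d → ℕ) → ℝ)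
    (φ : (Fin d → ℕ) → Fin d → ℕ) (hβ : ∀ m, m ∉ S → β m = 0) :
    Integrable (fun x => (∑ k ∈ s, α k * hermiteFunction (φ k) x) *
      ∑ m ∈ S, β m * hermiteFunction m x) ∧
    ∫ x, (∑ k ∈ s, α k * hermiteFunction (φ k) x) * (∑ m ∈ S, β m * hermiteFunction m x) =
      ∑ k ∈ s, α k * β (φ k) := by
  have hi : ∀ k m, Integrable (fun x => α k * hermiteFunction (φ k) x *
      (β m * hermiteFunction m x)) := fun k m => by
    refine ((integrable_hermiteFunction_mul (φ k) m).const_mul (α k * β m)).congr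
      (ae_of_all _ fun x => ?_)
    simp only
    ring
  simp only [Finset.sum_mul_sum]
  refine ⟨integrable_finsetSum _ fun k _ => integrable_finsetSum _ fun m _ => hi k m, ?_⟩
  rw [integral_finsetSum _ fun k _ => integrable_finsetSum _ fun m _ => hi k m]
  refine Finset.sum_congr rfl fun k _ => ?_
  rw [integral_finsetSum _ fun m _ => hi k m]
  have : ∀ m, ∫ x, α k * hermiteFunction (φ k) x * (β m * hermiteFunction m x) =
      if φ k = m then α k * β m else 0 := by
    intro m
    have h1 : ∀ x, α k * hermiteFunction (φ k) x * (β m * hermiteFunction m x) =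
        α k * β m * (hermiteFunction (φ k) x * hermiteFunction m x) := fun x => by ring
    simp only [h1]
    rw [integral_const_mul, integral_hermiteFunction_mul]
    split_ifs <;> simp
  simp only [this]
  rw [Finset.sum_ite_eq]
  split_ifs with h
  · rfl
  · rw [hβ _ h, mul_zero]

/-- The intertwining `δ_i e^{-t√L} = e^{-t√(L+2)} δ_i` on a single mode: the rate of the lowered
mode for the shifted operator is that of the original mode. -/
theorem rate_lower (i : Fin d) (k : Fin d → ℕ) (hk : k i ≠ 0) :
    rate 2 (lower i k) = rate 0 k := by
  have h1 : ∑ j, ((lower i k) j : ℝ) = ∑ j, (k j : ℝ) - 1 := by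
    rw [← Finset.add_sum_erase _ _ (Finset.mem_univ i),
      ← Finset.add_sum_erase Finset.univ (fun j => (k j : ℝ)) (Finset.mem_univ i)]
    have h2 : ∑ j ∈ Finset.univ.erase i, ((lower i k) j : ℝ) =
        ∑ j ∈ Finset.univ.erase i, (k j : ℝ) := by
      refine Finset.sum_congr rfl fun j hj => ?_
      rw [lower, Function.update_of_ne (Finset.ne_of_mem_erase hj)]
    rw [h2, lower, Function.update_self, Nat.cast_sub (Nat.one_le_iff_ne_zero.2 hk)]
    push_cast
    ring
  unfold rate eigenvalue
  rw [h1]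
  congr 1
  ring

section Pairing

variable (hd : 1 ≤ d) (a : (Fin d → ℕ) →₀ ℝ) (c : (Fin d → ℕ) →₀ Space d)

/-- The second derivative in `t` of the pairing of the Poisson extensions of `𝐑 f` and `g`,
before integration in `x`. -/
noncomputable def pairingDensity (t : ℝ) (x : Space d) : ℝ :=
  -4 * ∑ i, ((poisson hd 0 le_rfl a).dx i t x + x i * (poisson hd 0 le_rfl a).val t x) *
    (poisson hd 2 zero_le_two c).dt t x i

theorem abs_pairingDensity_le (t : ℝ) (x : Space d) {μ : ℝ} (hμ : 0 < μ) :
    |pairingDensity hd a c t x| ≤ 4 * (μ * (poisson hd 0 le_rfl a).gradSq t x +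
      (poisson hd 2 zero_le_two c).gradSq t x / (2 * μ)) := by
  unfold pairingDensity
  set U := poisson hd 0 le_rfl a
  set V := poisson hd 2 zero_le_two c
  have h1 : ∀ i, |(U.dx i t x + x i * U.val t x) * V.dt t x i| ≤
      μ * (‖U.dx i t x‖ ^ 2 + x i ^ 2 * ‖U.val t x‖ ^ 2) + V.dt t x i ^ 2 / (2 * μ) := by
    intro i
    rw [Real.norm_eq_abs, Real.norm_eq_abs, sq_abs, sq_abs, abs_le]
    have h2 : ∀ α β : ℝ, 0 ≤ μ / 2 * α ^ 2 + β ^ 2 / (2 * μ) + α * β := fun α β => by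
      have : μ / 2 * α ^ 2 + β ^ 2 / (2 * μ) + α * β = (μ * α + β) ^ 2 / (2 * μ) := by
        field_simp
        ring
      rw [this]
      positivity
    have h3 := h2 (U.dx i t x + x i * U.val t x) (V.dt t x i)
    have h4 := h2 (-(U.dx i t x + x i * U.val t x)) (V.dt t x i)
    have h5 : μ / 2 * (U.dx i t x + x i * U.val t x) ^ 2 ≤
        μ * (U.dx i t x ^ 2 + x i ^ 2 * U.val t x ^ 2) := by
      have := mul_nonneg (half_pos hμ).le (sq_nonneg (U.dx i t x - x i * U.val t x))
      linarith
    constructor <;> linarith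
  have h2 : |∑ i, (U.dx i t x + x i * U.val t x) * V.dt t x i| ≤
      μ * (∑ i, ‖U.dx i t x‖ ^ 2 + ‖x‖ ^ 2 * ‖U.val t x‖ ^ 2) + ‖V.dt t x‖ ^ 2 / (2 * μ) := by
    refine (Finset.abs_sum_le_sum_abs _ _).trans
      ((Finset.sum_le_sum fun i _ => h1 i).trans_eq ?_)
    rw [Finset.sum_add_distrib, ← Finset.mul_sum, Finset.sum_add_distrib, ← Finset.sum_mul,
      ← Finset.sum_div, EuclideanSpace.norm_sq_eq x, EuclideanSpace.norm_sq_eq (V.dt t x)]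
    simp
  rw [abs_mul, show |(-4 : ℝ)| = 4 by norm_num]
  refine mul_le_mul_of_nonneg_left (h2.trans ?_) (by norm_num)
  unfold PoissonExtension.gradSq
  have h3 : 0 ≤ ‖U.dt t x‖ ^ 2 := sq_nonneg _
  have h4 : 0 ≤ ∑ i, ‖V.dx i t x‖ ^ 2 + ‖x‖ ^ 2 * ‖V.val t x‖ ^ 2 :=
    add_nonneg (Finset.sum_nonneg fun i _ => sq_nonneg _) (by positivity)
  gcongr
  · linarith
  · linarith

/-- The pairing of the Poisson extensions of `𝐑 f` and `g`, with an additional factor in each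
mode. -/
noncomputable def pairingSum (B : (Fin d → ℕ) → ℝ) (t : ℝ) : ℝ :=
  ∑ i, ∑ k ∈ a.support, (√(eigenvalue k))⁻¹ * a k * √(2 * (k i : ℝ)) * c (lower i k) i *
    (B k * Real.exp (-2 * rate 0 k * t))

theorem hasDerivAt_pairingSum (B : (Fin d → ℕ) → ℝ) (t : ℝ) :
    HasDerivAt (pairingSum a c B) (pairingSum a c (fun k => B k * (-2 * rate 0 k)) t) t := by
  unfold pairingSum
  refine HasDerivAt.fun_sum fun i _ => HasDerivAt.fun_sum fun k _ => HasDerivAt.const_mul _ ?_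
  have h := (((hasDerivAt_id t).const_mul (-2 * rate 0 k)).exp).const_mul (B k)
  convert! h using 1
  simp only [id]
  ring

theorem tendsto_pairingSum (hd' : 1 ≤ d) (B : (Fin d → ℕ) → ℝ) :
    Tendsto (pairingSum a c B) atTop (𝓝 0) := by
  unfold pairingSum
  rw [← Finset.sum_const_zero (s := (Finset.univ : Finset (Fin d)))]
  refine tendsto_finsetSum _ fun i _ => ?_
  rw [← Finset.sum_const_zero (s := a.support)]
  refine tendsto_finsetSum _ fun k _ => ?_
  have h1 : Tendsto (fun t : ℝ => Real.exp (-2 * rate 0 k * t)) atTop (𝓝 0) := by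
    refine Real.tendsto_exp_atBot.comp (tendsto_id.const_mul_atTop_of_neg ?_)
    linarith [one_le_rate hd' le_rfl k]
  simpa using (h1.const_mul (B k)).const_mul
    ((√(eigenvalue k))⁻¹ * a k * √(2 * (k i : ℝ)) * c (lower i k) i)

theorem expansion_apply (i : Fin d) (x : Space d) :
    expansion c x i = ∑ m ∈ c.support, c m i * hermiteFunction m x := by
  simp [expansion, mul_comm]

theorem integral_rieszExpansion_mul :
    ∫ x, ∑ i, rieszExpansion a i x * expansion c x i = pairingSum a c 1 0 := by
  have h := fun i => integral_sum_hermite_mul_sum_hermite a.support c.support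
    (fun k => (√(eigenvalue k))⁻¹ * a k * √(2 * (k i : ℝ))) (fun m => c m i) (lower i)
    (fun m hm => by simp [Finsupp.notMem_support_iff.1 hm])
  simp only [rieszExpansion, expansion_apply]
  rw [integral_finsetSum _ fun i _ => (h i).1]
  rw [Finset.sum_congr rfl fun i _ => (h i).2]
  simp [pairingSum]

theorem integral_pairingDensity (t : ℝ) : Integrable (pairingDensity hd a c t) ∧
    pairingSum a c (fun k => 1 * (-2 * rate 0 k) * (-2 * rate 0 k)) t =
      ∫ x, pairingDensity hd a c t x := by
  have h := fun i => integral_sum_hermite_mul_sum_hermite a.support c.support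
    (fun k => Real.exp (-rate 0 k * t) * √(2 * (k i : ℝ)) * a k)
    (fun m => -rate 2 m * Real.exp (-rate 2 m * t) * c m i) (lower i)
    (fun m hm => by simp [Finsupp.notMem_support_iff.1 hm])
  have hU : ∀ i x, (poisson hd 0 le_rfl a).dx i t x + x i * (poisson hd 0 le_rfl a).val t x =
      ∑ k ∈ a.support, Real.exp (-rate 0 k * t) * √(2 * (k i : ℝ)) * a k *
        hermiteFunction (lower i k) x := by
    intro i x
    simp only [poisson, modeSum, Finset.mul_sum, ← Finset.sum_add_distrib, partialHermite,
      smul_eq_mul, Pi.one_apply]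
    refine Finset.sum_congr rfl fun k _ => ?_
    ring
  have hV : ∀ i x, (poisson hd 2 zero_le_two c).dt t x i =
      ∑ m ∈ c.support, -rate 2 m * Real.exp (-rate 2 m * t) * c m i * hermiteFunction m x := by
    intro i x
    simp only [poisson, modeSum, WithLp.ofLp_sum, Finset.sum_apply, WithLp.ofLp_smul,
      Pi.smul_apply, smul_eq_mul]
    refine Finset.sum_congr rfl fun k _ => ?_
    ring
  unfold pairingDensity
  simp only [hU, hV]
  refine ⟨(integrable_finsetSum _ fun i _ => (h i).1).const_mul _, ?_⟩
  rw [integral_const_mul, integral_finsetSum _ fun i _ => (h i).1]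
  simp only [(h _).2]
  rw [pairingSum, Finset.mul_sum]
  refine Finset.sum_congr rfl fun i _ => ?_
  rw [Finset.mul_sum]
  refine Finset.sum_congr rfl fun k _ => ?_
  rcases eq_or_ne (k i) 0 with hk | hk
  · simp [hk]
  rw [rate_lower i k hk]
  have h1 : √(eigenvalue k) = rate 0 k := by simp [rate]
  have h2 : rate 0 k ≠ 0 := by linarith [one_le_rate hd le_rfl k]
  have h3 : Real.exp (-2 * rate 0 k * t) =
      Real.exp (-rate 0 k * t) * Real.exp (-rate 0 k * t) := by
    rw [← Real.exp_add]
    congr 1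
    ring
  rw [h1, h3]
  field_simp
  ring

end Pairing

end HarmonicOscillator

namespace HarmonicOscillator

variable {d : ℕ}

theorem one_le_pStar_sub_one {p : ℝ} (hp : 1 < p) : 1 ≤ pStar p - 1 := by
  have h0 : 0 < p - 1 := by linarith
  rcases le_total 2 p with h | h
  · linarith [le_max_left p (p / (p - 1)), show pStar p = max p (p / (p - 1)) from rfl]
  · have h1 : 2 ≤ p / (p - 1) := by
      rw [le_div_iff₀ h0]
      linarith
    linarith [le_max_right p (p / (p - 1)), show pStar p = max p (p / (p - 1)) from rfl]

/-- The duality estimate with a sum of powers of norms in place of the product of norms. For `p ≥ 2`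
the Bellman function is used with the larger exponent on `f`, and for `p ≤ 2` with the larger
exponent on `g`. -/
theorem abs_integral_rieszExpansion_mul_le (hd : 1 ≤ d) {p : ℝ} (hp : 1 < p)
    (a : (Fin d → ℕ) →₀ ℝ) (c : (Fin d → ℕ) →₀ Space d) :
    |∫ x, ∑ i, rieszExpansion a i x * expansion c x i| ≤ 18 * (pStar p - 1) *
      ((∫ x, ‖expansion a x‖ ^ p) + ∫ x, ‖expansion c x‖ ^ (p / (p - 1))) := by
  have hp1 : 0 < p - 1 := by linarith
  rw [integral_rieszExpansion_mul]
  rcases le_total 2 p with h | h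
  · let e : BellmanExponents :=
      { a := p / 2
        b := p / (p - 1) / 2
        half_lt_b := by
          rw [div_div, lt_div_iff₀ (by positivity)]
          linarith
        b_le_one := by
          rw [div_div, div_le_one (by positivity)]
          linarith
        conj := by
          field_simp
          ring }
    have key := PoissonExtension.abs_le_integral_rpow (poisson hd 0 le_rfl a)
      (poisson hd 2 zero_le_two c) e (hasDerivAt_pairingSum a c 1) (hasDerivAt_pairingSum a c _)
      (tendsto_pairingSum a c hd 1) (fun t => (integral_pairingDensity hd a c t).1)
      (fun t => (integral_pairingDensity hd a c t).2) fun t x lam hlam => by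
        refine (abs_pairingDensity_le hd a c t x (half_pos hlam)).trans ?_
        have h1 : 0 ≤ (poisson hd 2 zero_le_two c).gradSq t x / lam := by
          unfold PoissonExtension.gradSq
          positivity
        have h2 : (poisson hd 2 zero_le_two c).gradSq t x / (2 * (lam / 2)) =
            (poisson hd 2 zero_le_two c).gradSq t x / lam := by
          congr 1
          ring
        have h3 : (poisson hd 2 zero_le_two c).gradSq t x / (2 * lam) =
            (poisson hd 2 zero_le_two c).gradSq t x / lam / 2 := by
          rw [div_div, mul_comm]
        rw [h2, h3]
        linarith
    simp only [poisson_val_zero] at key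
    have ea : 2 * e.a = p := mul_div_cancel₀ p two_ne_zero
    have eb : 2 * e.b = p / (p - 1) := mul_div_cancel₀ _ two_ne_zero
    have hq : p / (p - 1) - 1 = 1 / (p - 1) := by
      field_simp
      ring
    rw [ea, eb, hq, div_div_eq_mul_div, div_one] at key
    refine key.trans (mul_le_mul_of_nonneg_right ?_ ?_)
    · have : p ≤ pStar p := le_max_left _ _
      linarith
    · exact add_nonneg (integral_nonneg fun x => by positivity)
        (integral_nonneg fun x => by positivity)
  · let e : BellmanExponents :=
      { a := p / (p - 1) / 2
        b := p / 2
        half_lt_b := by linarith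
        b_le_one := by linarith
        conj := by
          field_simp }
    have key := PoissonExtension.abs_le_integral_rpow (poisson hd 2 zero_le_two c)
      (poisson hd 0 le_rfl a) e (hasDerivAt_pairingSum a c 1) (hasDerivAt_pairingSum a c _)
      (tendsto_pairingSum a c hd 1) (fun t => (integral_pairingDensity hd a c t).1)
      (fun t => (integral_pairingDensity hd a c t).2) fun t x lam hlam => by
        refine (abs_pairingDensity_le hd a c t x (inv_pos.2 hlam)).trans ?_
        have h1 : 0 ≤ (poisson hd 0 le_rfl a).gradSq t x / lam := by
          unfold PoissonExtension.gradSq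
          positivity
        have h2 : (poisson hd 2 zero_le_two c).gradSq t x / (2 * lam⁻¹) =
            lam / 2 * (poisson hd 2 zero_le_two c).gradSq t x := by
          field_simp
        have h3 : (poisson hd 0 le_rfl a).gradSq t x / (2 * lam) =
            (poisson hd 0 le_rfl a).gradSq t x / lam / 2 := by
          rw [div_div, mul_comm]
        have h4 : lam⁻¹ * (poisson hd 0 le_rfl a).gradSq t x =
            (poisson hd 0 le_rfl a).gradSq t x / lam := by
          rw [div_eq_inv_mul]
        rw [h2, h3, h4]
        linarith
    simp only [poisson_val_zero] at key
    have ea : 2 * e.a = p / (p - 1) := mul_div_cancel₀ _ two_ne_zero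
    have eb : 2 * e.b = p := mul_div_cancel₀ _ two_ne_zero
    rw [ea, eb, add_comm] at key
    refine key.trans (mul_le_mul_of_nonneg_right ?_ ?_)
    · have h1 : p / (p - 1) ≤ pStar p := le_max_right _ _
      have h2 : 18 / (p - 1) = 18 * (p / (p - 1) - 1) := by
        field_simp
        ring
      rw [h2]
      linarith
    · exact add_nonneg (integral_nonneg fun x => by positivity)
        (integral_nonneg fun x => by positivity)

theorem expansion_smul {E : Type*} [NormedAddCommGroup E] [InnerProductSpace ℝ E] (r : ℝ)
    (c : (Fin d → ℕ) →₀ E) (x : Space d) : expansion (r • c) x = r • expansion c x := by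
  unfold expansion
  rw [Finset.smul_sum, Finset.sum_subset Finsupp.support_smul fun k _ hk => by
    simp [Finsupp.notMem_support_iff.1 hk]]
  refine Finset.sum_congr rfl fun k _ => ?_
  rw [Finsupp.smul_apply, smul_comm]

theorem rieszExpansion_smul (r : ℝ) (a : (Fin d → ℕ) →₀ ℝ) (i : Fin d) (x : Space d) :
    rieszExpansion (r • a) i x = r * rieszExpansion a i x := by
  unfold rieszExpansion
  rw [Finset.mul_sum, Finset.sum_subset Finsupp.support_smul fun k _ hk => by
    simp [Finsupp.notMem_support_iff.1 hk]]
  refine Finset.sum_congr rfl fun k _ => ?_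
  rw [Finsupp.smul_apply, smul_eq_mul]
  ring

/-- **Duality estimate** for the vector of Riesz transforms of a finite Hermite expansion. -/
theorem abs_integral_rieszExpansion_mul_le_mul (hd : 1 ≤ d) {p q : ℝ} (hpq : p.HolderConjugate q)
    (a : (Fin d → ℕ) →₀ ℝ) (c : (Fin d → ℕ) →₀ Space d) :
    |∫ x, ∑ i, rieszExpansion a i x * expansion c x i| ≤ 36 * (pStar p - 1) *
      ((∫ x, ‖expansion a x‖ ^ p) ^ (1 / p) * (∫ x, ‖expansion c x‖ ^ q) ^ (1 / q)) := by
  have hp := hpq.lt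
  have hp0 := hpq.pos
  have hq0 := hpq.symm.pos
  have hq : q = p / (p - 1) := hpq.conjugate_eq
  set A := ∫ x, ‖expansion a x‖ ^ p with hA
  set B := ∫ x, ‖expansion c x‖ ^ q with hB
  have hA0 : 0 ≤ A := integral_nonneg fun x => by positivity
  have hB0 : 0 ≤ B := integral_nonneg fun x => by positivity
  have hps := one_le_pStar_sub_one hp
  -- Normalize both functions, up to `η`, and let `η → 0`.
  have main : ∀ η : ℝ, 0 < η → |∫ x, ∑ i, rieszExpansion a i x * expansion c x i| ≤
      36 * (pStar p - 1) * ((A ^ (1 / p) + η) * (B ^ (1 / q) + η)) := by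
    intro η hη
    have hα : 0 < A ^ (1 / p) + η := by positivity
    have hβ : 0 < B ^ (1 / q) + η := by positivity
    set α := A ^ (1 / p) + η with hαdef
    set β := B ^ (1 / q) + η with hβdef
    have key := abs_integral_rieszExpansion_mul_le hd hp (α⁻¹ • a) (β⁻¹ • c)
    rw [← hq] at key
    have e1 : ∀ x, ∑ i, rieszExpansion (α⁻¹ • a) i x * expansion (β⁻¹ • c) x i =
        (α * β)⁻¹ * ∑ i, rieszExpansion a i x * expansion c x i := by
      intro x
      rw [Finset.mul_sum]
      refine Finset.sum_congr rfl fun i _ => ?_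
      rw [rieszExpansion_smul, expansion_smul, PiLp.smul_apply, smul_eq_mul, mul_inv]
      ring
    have e2 : ∫ x, ‖expansion (α⁻¹ • a) x‖ ^ p ≤ 1 := by
      have : ∀ x, ‖expansion (α⁻¹ • a) x‖ ^ p = (α⁻¹) ^ p * ‖expansion a x‖ ^ p := fun x => by
        rw [expansion_smul, norm_smul, Real.norm_of_nonneg (by positivity),
          Real.mul_rpow (by positivity) (norm_nonneg _)]
      simp only [this]
      rw [integral_const_mul, ← hA, Real.inv_rpow hα.le, inv_mul_le_iff₀ (by positivity), mul_one]
      calc A = (A ^ (1 / p)) ^ p := by rw [← Real.rpow_mul hA0, one_div_mul_cancel hp0.ne',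
              Real.rpow_one]
        _ ≤ α ^ p := by
          gcongr
          linarith
    have e3 : ∫ x, ‖expansion (β⁻¹ • c) x‖ ^ q ≤ 1 := by
      have : ∀ x, ‖expansion (β⁻¹ • c) x‖ ^ q = (β⁻¹) ^ q * ‖expansion c x‖ ^ q := fun x => by
        rw [expansion_smul, norm_smul, Real.norm_of_nonneg (by positivity),
          Real.mul_rpow (by positivity) (norm_nonneg _)]
      simp only [this]
      rw [integral_const_mul, ← hB, Real.inv_rpow hβ.le, inv_mul_le_iff₀ (by positivity), mul_one]
      calc B = (B ^ (1 / q)) ^ q := by rw [← Real.rpow_mul hB0, one_div_mul_cancel hq0.ne',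
              Real.rpow_one]
        _ ≤ β ^ q := by
          gcongr
          linarith
    simp only [e1] at key
    rw [integral_const_mul, abs_mul, abs_of_pos (by positivity : 0 < (α * β)⁻¹),
      inv_mul_le_iff₀ (by positivity)] at key
    refine key.trans ?_
    have h2 : 18 * (pStar p - 1) * ((∫ x, ‖expansion (α⁻¹ • a) x‖ ^ p) +
        ∫ x, ‖expansion (β⁻¹ • c) x‖ ^ q) ≤ 18 * (pStar p - 1) * 2 := by
      gcongr
      linarith
    calc _ ≤ α * β * (18 * (pStar p - 1) * 2) := mul_le_mul_of_nonneg_left h2 (by positivity)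
      _ = _ := by ring
  have hlim : Tendsto (fun η : ℝ => 36 * (pStar p - 1) * ((A ^ (1 / p) + η) * (B ^ (1 / q) + η)))
      (𝓝[>] 0) (𝓝 (36 * (pStar p - 1) * ((A ^ (1 / p) + 0) * (B ^ (1 / q) + 0)))) := by
    have : Continuous fun η : ℝ =>
        36 * (pStar p - 1) * ((A ^ (1 / p) + η) * (B ^ (1 / q) + η)) := by fun_prop
    exact (this.tendsto 0).mono_left nhdsWithin_le_nhds
  simp only [add_zero] at hlim
  exact ge_of_tendsto hlim (eventually_nhdsWithin_of_forall fun η hη => main η hη)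

end HarmonicOscillator

open scoped ENNReal

namespace HarmonicOscillator

/-! ### Density of the Hermite expansions -/

/-- Dominated convergence in `L^m`. -/
theorem tendsto_eLpNorm_sub_of_dominated {α : Type*} [MeasurableSpace α] {μ : Measure α} {m : ℝ≥0∞}
    (hm0 : m ≠ 0) (hm : m ≠ ∞) {F : ℕ → α → ℝ} {f G : α → ℝ}
    (hF : ∀ n, AEStronglyMeasurable (F n) μ) (hf : AEStronglyMeasurable f μ) (hG : MemLp G m μ)
    (hb : ∀ n x, |f x - F n x| ≤ G x) (hlim : ∀ x, Tendsto (fun n => F n x) atTop (𝓝 (f x))) :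
    Tendsto (fun n => eLpNorm (f - F n) m μ) atTop (𝓝 0) := by
  have hr : 0 < m.toReal := ENNReal.toReal_pos hm0 hm
  have h1 : Tendsto (fun n => ∫⁻ x, ‖f x - F n x‖ₑ ^ m.toReal ∂μ) atTop (𝓝 (∫⁻ _, 0 ∂μ)) := by
    refine tendsto_lintegral_of_dominated_convergence' (fun x => ‖G x‖ₑ ^ m.toReal)
      (fun n => (hf.sub (hF n)).enorm.pow_const _) (fun n => ae_of_all _ fun x => ?_)
      (lintegral_rpow_enorm_lt_top_of_eLpNorm_lt_top hm0 hm hG.2).ne (ae_of_all _ fun x => ?_)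
    · refine ENNReal.rpow_le_rpow ?_ hr.le
      rw [enorm_le_iff_norm_le, Real.norm_eq_abs, Real.norm_eq_abs]
      exact (hb n x).trans (le_abs_self _)
    · have h2 : Tendsto (fun n => ‖f x - F n x‖ₑ) atTop (𝓝 0) := by
        have h3 : Tendsto (fun n => f x - F n x) atTop (𝓝 (f x - f x)) := (hlim x).const_sub _
        rw [sub_self] at h3
        simpa using h3.enorm
      have h3 : Tendsto (fun n => ‖f x - F n x‖ₑ ^ m.toReal) atTop (𝓝 (0 ^ m.toReal)) :=
        ((ENNReal.continuous_rpow_const (y := m.toReal)).tendsto 0).comp h2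
      rwa [ENNReal.zero_rpow_of_pos hr] at h3
  have h2 := (ENNReal.continuous_rpow_const (y := 1 / m.toReal)).tendsto (∫⁻ _ : α, 0 ∂μ)
    |>.comp h1
  simp only [lintegral_zero, ENNReal.zero_rpow_of_pos (one_div_pos.2 hr)] at h2
  refine h2.congr fun n => ?_
  rw [eLpNorm_eq_lintegral_rpow_enorm_toReal hm0 hm]
  rfl

section GaussianWeight

variable (d : ℕ)

/-- The Gaussian `e^{-|x|²/2}`, a multiple of the ground state. -/
noncomputable def gaussian (x : Space d) : ℝ := Real.exp (-‖x‖ ^ 2 / 2)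

/-- The finite measure with density `e^{-|x|²/2}`. -/
noncomputable def gaussianWeight : Measure (Space d) :=
  volume.withDensity fun x => ENNReal.ofReal (gaussian d x)

/-- The linear span of the Hermite functions, that is, the space of polynomials times the
Gaussian. -/
noncomputable def hermiteSpan : Submodule ℝ (Space d → ℝ) :=
  Submodule.span ℝ (Set.range hermiteFunction)

variable {d}

theorem gaussian_pos (x : Space d) : 0 < gaussian d x := Real.exp_pos _

theorem gaussian_le_one (x : Space d) : gaussian d x ≤ 1 := by
  rw [gaussian, Real.exp_le_one_iff]
  have := sq_nonneg ‖x‖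
  linarith

theorem continuous_gaussian : Continuous (gaussian d) := by
  unfold gaussian
  fun_prop

theorem gaussian_mem_hermiteSpan : gaussian d ∈ hermiteSpan d := by
  have h : gaussian d = (((√√Real.pi)⁻¹) ^ d)⁻¹ • hermiteFunction (0 : Fin d → ℕ) := by
    ext x
    simp only [hermiteFunction, Pi.smul_apply, smul_eq_mul, Pi.zero_apply, hermiteFun_zero]
    rw [Finset.prod_mul_distrib, Finset.prod_const, Finset.card_univ, Fintype.card_fin,
      ← Real.exp_sum, inv_mul_cancel_left₀ (by positivity), gaussian, EuclideanSpace.norm_sq_eq,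
      ← Finset.sum_div, Finset.sum_neg_distrib]
    simp
  rw [h]
  exact Submodule.smul_mem _ _ (Submodule.subset_span ⟨_, rfl⟩)

theorem coord_mul_mem_hermiteSpan (i : Fin d) {f : Space d → ℝ} (hf : f ∈ hermiteSpan d) :
    (fun x => x i * f x) ∈ hermiteSpan d := by
  induction hf using Submodule.span_induction with
  | mem f hf =>
    obtain ⟨k, rfl⟩ := hf
    have h : (fun x : Space d => x i * hermiteFunction k x) =
        (√(2 * ((k i : ℝ) + 1)) / 2) • hermiteFunction (raise i k) +
          (√(2 * k i) / 2) • hermiteFunction (lower i k) := by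
      ext x
      exact mul_hermiteFunction i k x
    rw [h]
    exact add_mem (Submodule.smul_mem _ _ (Submodule.subset_span ⟨_, rfl⟩))
      (Submodule.smul_mem _ _ (Submodule.subset_span ⟨_, rfl⟩))
  | zero =>
    convert! zero_mem (hermiteSpan d) using 1
    ext x
    simp
  | add f g _ _ hf hg =>
    convert! add_mem hf hg using 1
    ext x
    simp only [Pi.add_apply]
    ring
  | smul r f _ hf =>
    convert! Submodule.smul_mem _ r hf using 1
    ext x
    simp only [Pi.smul_apply, smul_eq_mul]
    ring

theorem inner_pow_mul_gaussian_mem_hermiteSpan (ξ : Space d) (n : ℕ) :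
    (fun x => (inner ℝ ξ x) ^ n * gaussian d x) ∈ hermiteSpan d := by
  induction n with
  | zero => simpa using gaussian_mem_hermiteSpan
  | succ n ih =>
    have h : (fun x => (inner ℝ ξ x) ^ (n + 1) * gaussian d x) =
        ∑ i, ξ i • fun x : Space d => x i * ((inner ℝ ξ x) ^ n * gaussian d x) := by
      ext x
      simp only [Finset.sum_apply, Pi.smul_apply, smul_eq_mul, ← mul_assoc, ← Finset.sum_mul]
      rw [pow_succ' (inner ℝ ξ x) n]
      simp [PiLp.inner_apply, mul_comm]
    rw [h]
    exact Submodule.sum_mem _ fun i _ => Submodule.smul_mem _ _ (coord_mul_mem_hermiteSpan i ih)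

theorem exists_expansion_of_mem_hermiteSpan {f : Space d → ℝ} (hf : f ∈ hermiteSpan d) :
    ∃ a : (Fin d → ℕ) →₀ ℝ, f = expansion a := by
  obtain ⟨a, ha⟩ := Finsupp.mem_span_range_iff_exists_finsupp.1 hf
  refine ⟨a, ?_⟩
  rw [← ha]
  ext x
  simp [expansion, Finsupp.sum, mul_comm]

theorem integrable_exp_mul_norm_gaussianWeight (c : ℝ) :
    Integrable (fun x => Real.exp (c * ‖x‖)) (gaussianWeight d) := by
  unfold gaussianWeight
  rw [integrable_withDensity_iff_integrable_smul'
    (continuous_gaussian.measurable.ennreal_ofReal) (ae_of_all _ fun x => ENNReal.ofReal_lt_top)]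
  refine ((integrable_exp_neg_norm_sq_div_four (d := d)).const_mul (Real.exp (c ^ 2))).mono' ?_
    (ae_of_all _ fun x => ?_)
  · have := continuous_gaussian (d := d)
    refine Measurable.aestronglyMeasurable ?_
    fun_prop
  · rw [ENNReal.toReal_ofReal (gaussian_pos x).le, smul_eq_mul,
      Real.norm_of_nonneg (mul_nonneg (gaussian_pos x).le (Real.exp_pos _).le), gaussian,
      ← Real.exp_add, ← Real.exp_add, Real.exp_le_exp]
    nlinarith [sq_nonneg (‖x‖ / 2 - c)]

instance : IsFiniteMeasure (gaussianWeight d) := by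
  have h := integrable_exp_mul_norm_gaussianWeight (d := d) 0
  simp only [zero_mul, Real.exp_zero] at h
  exact (integrable_const_iff.1 h).resolve_left one_ne_zero

variable {m : ℝ≥0∞}

theorem memLp_exp_mul_norm (hm0 : m ≠ 0) (hm : m ≠ ∞) (c : ℝ) :
    MemLp (fun x => Real.exp (c * ‖x‖)) m (gaussianWeight d) := by
  have hc : Continuous fun x : Space d => Real.exp (c * ‖x‖) := by fun_prop
  refine (integrable_norm_rpow_iff hc.aestronglyMeasurable hm0 hm).1 ?_
  refine (integrable_exp_mul_norm_gaussianWeight (d := d) (m.toReal * c)).congr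
    (ae_of_all _ fun x => ?_)
  simp only
  rw [Real.norm_of_nonneg (Real.exp_pos _).le, ← Real.exp_mul]
  congr 1
  ring

/-- The function `φ` can be approximated in `L^m(e^{-|x|²/2} dx)` by polynomials, which are
recognized by their product with the Gaussian being a Hermite expansion. -/
def HermiteApprox (m : ℝ≥0∞) (φ : Space d → ℝ) : Prop :=
  AEStronglyMeasurable φ (gaussianWeight d) ∧ ∀ ε : ℝ≥0∞, ε ≠ 0 → ∃ P : Space d → ℝ,
    Continuous P ∧ (fun x => P x * gaussian d x) ∈ hermiteSpan d ∧
      eLpNorm (φ - P) m (gaussianWeight d) ≤ ε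

namespace HermiteApprox

variable {φ ψ : Space d → ℝ}

theorem of_poly {P : Space d → ℝ} (hP : Continuous P)
    (h : (fun x => P x * gaussian d x) ∈ hermiteSpan d) : HermiteApprox m P :=
  ⟨hP.aestronglyMeasurable, fun ε _ => ⟨P, hP, h, by simp⟩⟩

theorem of_forall_near (hm : 1 ≤ m) (hφ : AEStronglyMeasurable φ (gaussianWeight d))
    (h : ∀ ε : ℝ≥0∞, ε ≠ 0 → ∃ ψ, HermiteApprox m ψ ∧
      eLpNorm (φ - ψ) m (gaussianWeight d) ≤ ε) : HermiteApprox m φ := by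
  refine ⟨hφ, fun ε hε => ?_⟩
  have hε2 : ε / 2 ≠ 0 := (ENNReal.half_pos hε).ne'
  obtain ⟨ψ, ⟨hψm, hψ⟩, h1⟩ := h (ε / 2) hε2
  obtain ⟨P, hPc, hP, h2⟩ := hψ (ε / 2) hε2
  refine ⟨P, hPc, hP, ?_⟩
  have h3 : φ - P = (φ - ψ) + (ψ - P) := by abel
  rw [h3]
  refine (eLpNorm_add_le (hφ.sub hψm) (hψm.sub hPc.aestronglyMeasurable) hm).trans ?_
  exact (add_le_add h1 h2).trans_eq (ENNReal.add_halves ε)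

theorem add (hm : 1 ≤ m) (hφ : HermiteApprox m φ) (hψ : HermiteApprox m ψ) :
    HermiteApprox m (φ + ψ) := by
  refine ⟨hφ.1.add hψ.1, fun ε hε => ?_⟩
  have hε2 : ε / 2 ≠ 0 := (ENNReal.half_pos hε).ne'
  obtain ⟨P, hPc, hP, h1⟩ := hφ.2 (ε / 2) hε2
  obtain ⟨Q, hQc, hQ, h2⟩ := hψ.2 (ε / 2) hε2
  refine ⟨P + Q, hPc.add hQc, ?_, ?_⟩
  · convert! add_mem hP hQ using 1
    ext x
    simp only [Pi.add_apply]
    ring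
  · have h3 : φ + ψ - (P + Q) = (φ - P) + (ψ - Q) := by abel
    rw [h3]
    refine (eLpNorm_add_le (hφ.1.sub hPc.aestronglyMeasurable)
      (hψ.1.sub hQc.aestronglyMeasurable) hm).trans ?_
    exact (add_le_add h1 h2).trans_eq (ENNReal.add_halves ε)

theorem const_smul (r : ℝ) (hφ : HermiteApprox m φ) : HermiteApprox m (r • φ) := by
  refine ⟨hφ.1.const_smul r, fun ε hε => ?_⟩
  obtain ⟨P, hPc, hP, h1⟩ := hφ.2 (ε / ‖r‖ₑ) (ENNReal.div_ne_zero.2 ⟨hε, enorm_ne_top⟩)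
  refine ⟨r • P, hPc.const_smul r, ?_, ?_⟩
  · convert! Submodule.smul_mem _ r hP using 1
    ext x
    simp only [Pi.smul_apply, smul_eq_mul]
    ring
  · rw [← smul_sub, eLpNorm_const_smul]
    exact (mul_le_mul_right h1 _).trans ENNReal.mul_div_le

theorem of_dominated (hm1 : 1 ≤ m) (hm : m ≠ ∞) {F : ℕ → Space d → ℝ} {G : Space d → ℝ}
    (hF : ∀ n, HermiteApprox m (F n)) (hφ : AEStronglyMeasurable φ (gaussianWeight d))
    (hG : MemLp G m (gaussianWeight d)) (hb : ∀ n x, |φ x - F n x| ≤ G x)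
    (hlim : ∀ x, Tendsto (fun n => F n x) atTop (𝓝 (φ x))) : HermiteApprox m φ := by
  refine of_forall_near hm1 hφ fun ε hε => ?_
  have h := tendsto_eLpNorm_sub_of_dominated (zero_lt_one.trans_le hm1).ne' hm
    (fun n => (hF n).1) hφ hG hb hlim
  obtain ⟨n, hn⟩ := (h.eventually (Iic_mem_nhds (pos_iff_ne_zero.2 hε))).exists
  exact ⟨F n, hF n, hn⟩

end HermiteApprox

/-- The trigonometric function `x ↦ Re (w e^{i⟨ξ, x⟩})`. -/
noncomputable def trig (ξ : Space d) (w : ℂ) : C(Space d, ℝ) :=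
  ⟨fun x => (w * Complex.exp (Complex.I * (inner ℝ ξ x : ℝ))).re, by fun_prop⟩

theorem trig_apply (ξ : Space d) (w : ℂ) (x : Space d) :
    trig ξ w x = (w * Complex.exp (Complex.I * (inner ℝ ξ x : ℝ))).re := rfl

/-- Trigonometric functions are limits of their Taylor polynomials. -/
theorem hermiteApprox_trig (hm1 : 1 ≤ m) (hm : m ≠ ∞) (ξ : Space d) (w : ℂ) :
    HermiteApprox m (trig ξ w) := by
  have hm0 : m ≠ 0 := (zero_lt_one.trans_le hm1).ne'
  let F : ℕ → Space d → ℝ := fun N x =>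
    (w * ∑ n ∈ Finset.range N, (Complex.I * (inner ℝ ξ x : ℝ)) ^ n / n.factorial).re
  have hF : ∀ N, HermiteApprox m (F N) := by
    intro N
    refine HermiteApprox.of_poly (by fun_prop) ?_
    have h : (fun x => F N x * gaussian d x) = ∑ n ∈ Finset.range N,
        (w * Complex.I ^ n / n.factorial).re • fun x =>
          (inner ℝ ξ x) ^ n * gaussian d x := by
      ext x
      simp only [F, Finset.sum_apply, Pi.smul_apply, smul_eq_mul, ← mul_assoc, ← Finset.sum_mul]
      congr 1
      rw [Finset.mul_sum, Complex.re_sum]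
      refine Finset.sum_congr rfl fun n _ => ?_
      rw [← Complex.re_mul_ofReal]
      congr 1
      push_cast
      ring
    rw [h]
    exact Submodule.sum_mem _ fun n _ =>
      Submodule.smul_mem _ _ (inner_pow_mul_gaussian_mem_hermiteSpan ξ n)
  have hG : MemLp (fun x : Space d => (2 * ‖w‖) * Real.exp (‖ξ‖ * ‖x‖)) m (gaussianWeight d) :=
    (memLp_exp_mul_norm hm0 hm ‖ξ‖).const_mul _
  refine HermiteApprox.of_dominated hm1 hm hF (trig ξ w).continuous.aestronglyMeasurable hG
    (fun N x => ?_) fun x => ?_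
  · have hexp : Real.exp |inner ℝ ξ x| ≤ Real.exp (‖ξ‖ * ‖x‖) :=
      Real.exp_le_exp.2 (abs_real_inner_le_norm ξ x)
    have h1 : |trig ξ w x| ≤ ‖w‖ * Real.exp (‖ξ‖ * ‖x‖) := by
      rw [trig_apply]
      refine (Complex.abs_re_le_norm _).trans ?_
      rw [norm_mul, mul_comm Complex.I, Complex.norm_exp_ofReal_mul_I]
      refine mul_le_mul_of_nonneg_left ?_ (norm_nonneg _)
      exact Real.one_le_exp (by positivity)
    have h2 : |F N x| ≤ ‖w‖ * Real.exp (‖ξ‖ * ‖x‖) := by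
      refine (Complex.abs_re_le_norm _).trans ?_
      rw [norm_mul]
      refine mul_le_mul_of_nonneg_left (le_trans ?_ hexp) (norm_nonneg _)
      refine (norm_sum_le _ _).trans ?_
      refine le_trans (Finset.sum_le_sum fun n _ => ?_)
        (Real.sum_le_exp_of_nonneg (abs_nonneg (inner ℝ ξ x)) N)
      rw [norm_div, norm_pow, norm_mul, Complex.norm_I, one_mul, Complex.norm_real,
        Complex.norm_natCast, Real.norm_eq_abs]
    refine (abs_sub _ _).trans ?_
    linarith
  · have h := (NormedSpace.expSeries_div_hasSum_exp
      (Complex.I * (inner ℝ ξ x : ℝ))).tendsto_sum_nat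
    rw [← Complex.exp_eq_exp_ℂ] at h
    exact (Complex.continuous_re.tendsto _).comp (h.const_mul w)

/-- The algebra of trigonometric polynomials. -/
noncomputable def trigAlgebra (d : ℕ) : Subalgebra ℝ C(Space d, ℝ) :=
  (Submodule.span ℝ (Set.range fun p : Space d × ℂ => trig p.1 p.2)).toSubalgebra
    (by
      refine Submodule.subset_span ⟨(0, 1), ?_⟩
      ext x
      simp [trig_apply])
    (by
      intro f g hf hg
      induction hf, hg using Submodule.span_induction₂ with
      | mem_mem f g hf hg =>
        obtain ⟨⟨ξ, w⟩, rfl⟩ := hf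
        obtain ⟨⟨η, z⟩, rfl⟩ := hg
        have h : trig ξ w * trig η z =
            (1 / 2 : ℝ) • trig (ξ + η) (w * z) +
              (1 / 2 : ℝ) • trig (ξ - η) (w * (starRingEnd ℂ) z) := by
          ext x
          simp only [ContinuousMap.mul_apply, ContinuousMap.add_apply, ContinuousMap.smul_apply,
            trig_apply, smul_eq_mul, inner_add_left, inner_sub_left]
          have h1 : ∀ A B : ℂ, A.re * B.re = 1 / 2 * (A * B).re +
              1 / 2 * (A * (starRingEnd ℂ) B).re := fun A B => by
            simp only [Complex.mul_re, Complex.conj_re, Complex.conj_im]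
            ring
          rw [h1, map_mul, ← Complex.exp_conj]
          congr 3
          · rw [mul_mul_mul_comm, ← Complex.exp_add]
            congr 2
            push_cast
            ring
          · rw [mul_mul_mul_comm, ← Complex.exp_add]
            congr 3
            simp
            ring
        rw [h]
        exact add_mem (Submodule.smul_mem _ _ (Submodule.subset_span ⟨(_, _), rfl⟩))
          (Submodule.smul_mem _ _ (Submodule.subset_span ⟨(_, _), rfl⟩))
      | zero_left => simp
      | zero_right => simp
      | add_left f g h _ _ _ h1 h2 =>
        rw [add_mul]
        exact add_mem h1 h2
      | add_right f g h _ _ _ h1 h2 =>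
        rw [mul_add]
        exact add_mem h1 h2
      | smul_left r f g _ _ h =>
        rw [smul_mul_assoc]
        exact Submodule.smul_mem _ _ h
      | smul_right r f g _ _ h =>
        rw [mul_smul_comm]
        exact Submodule.smul_mem _ _ h)

theorem trig_mem_trigAlgebra (ξ : Space d) (w : ℂ) : trig ξ w ∈ trigAlgebra d :=
  Submodule.subset_span ⟨(ξ, w), rfl⟩

theorem separatesPoints_trigAlgebra : (trigAlgebra d).SeparatesPoints := by
  intro x y hxy
  by_contra hcon
  push Not at hcon
  have hne : x - y ≠ 0 := sub_ne_zero.2 hxy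
  set ξ : Space d := (‖x - y‖ ^ 2)⁻¹ • (x - y) with hξ
  have h1 : inner ℝ ξ x - inner ℝ ξ y = 1 := by
    rw [← inner_sub_right, hξ, inner_smul_left, real_inner_self_eq_norm_sq]
    simp only [map_inv₀, map_pow, conj_trivial]
    exact inv_mul_cancel₀ (by positivity)
  have h2 : trig ξ 1 x = trig ξ 1 y := hcon _ ⟨_, trig_mem_trigAlgebra ξ 1, rfl⟩
  have h3 : trig ξ (-Complex.I) x = trig ξ (-Complex.I) y :=
    hcon _ ⟨_, trig_mem_trigAlgebra ξ (-Complex.I), rfl⟩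
  have hc : ∀ z, trig ξ 1 z = Real.cos (inner ℝ ξ z) := fun z => by
    rw [trig_apply, one_mul, mul_comm, Complex.exp_ofReal_mul_I_re]
  have hs : ∀ z, trig ξ (-Complex.I) z = Real.sin (inner ℝ ξ z) := fun z => by
    rw [trig_apply, mul_comm Complex.I, Complex.mul_re, Complex.exp_ofReal_mul_I_im]
    simp
  rw [hc, hc] at h2
  rw [hs, hs] at h3
  have h4 : Real.cos 1 = 1 := by
    rw [← h1, Real.cos_sub, h2, h3]
    nlinarith [Real.sin_sq_add_cos_sq (inner ℝ ξ y)]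
  have := Real.cos_one_le
  linarith

theorem trigAlgebra_induction {p : C(Space d, ℝ) → Prop} (htrig : ∀ ξ w, p (trig ξ w))
    (hadd : ∀ f g, p f → p g → p (f + g)) (hsmul : ∀ (r : ℝ) f, p f → p (r • f))
    {f : C(Space d, ℝ)} (hf : f ∈ trigAlgebra d) : p f := by
  have hf' : f ∈ Submodule.span ℝ (Set.range fun p : Space d × ℂ => trig p.1 p.2) := hf
  clear hf
  induction hf' using Submodule.span_induction with
  | mem f hf =>
    obtain ⟨⟨ξ, w⟩, rfl⟩ := hf
    exact htrig ξ w
  | zero =>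
    have := hsmul 0 _ (htrig 0 0)
    rwa [zero_smul] at this
  | add f g _ _ hf hg => exact hadd _ _ hf hg
  | smul r f _ hf => exact hsmul _ _ hf

theorem exists_bound_of_mem_trigAlgebra {f : C(Space d, ℝ)} (hf : f ∈ trigAlgebra d) :
    ∃ B, ∀ x, |f x| ≤ B := by
  refine trigAlgebra_induction (p := fun f => ∃ B, ∀ x, |f x| ≤ B) ?_ ?_ ?_ hf
  · intro ξ w
    refine ⟨‖w‖, fun x => ?_⟩
    rw [trig_apply]
    refine (Complex.abs_re_le_norm _).trans ?_
    rw [norm_mul, mul_comm Complex.I, Complex.norm_exp_ofReal_mul_I, mul_one]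
  · rintro f g ⟨B, hB⟩ ⟨C, hC⟩
    exact ⟨B + C, fun x => (abs_add_le _ _).trans (add_le_add (hB x) (hC x))⟩
  · rintro r f ⟨B, hB⟩
    refine ⟨|r| * B, fun x => ?_⟩
    rw [ContinuousMap.smul_apply, smul_eq_mul, abs_mul]
    exact mul_le_mul_of_nonneg_left (hB x) (abs_nonneg r)

theorem hermiteApprox_of_mem_trigAlgebra (hm1 : 1 ≤ m) (hm : m ≠ ∞) {f : C(Space d, ℝ)}
    (hf : f ∈ trigAlgebra d) : HermiteApprox m f := by
  refine trigAlgebra_induction (p := fun f => HermiteApprox m f) ?_ ?_ ?_ hf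
  · exact hermiteApprox_trig hm1 hm
  · exact fun f g hf hg => hf.add hm1 hg
  · exact fun r f hf => hf.const_smul r

/-- A bounded continuous function is approximated, uniformly on a ball, by trigonometric
polynomials with (almost) the same global bound: after the Stone-Weierstrass theorem, the
approximant is composed with a polynomial that approximates the truncation at the bound. -/
theorem exists_trigAlgebra_near (φ : C(Space d, ℝ)) {M : ℝ} (hM : ∀ x, |φ x| ≤ M) (R : ℝ)
    {ε : ℝ} (hε : 0 < ε) : ∃ T ∈ trigAlgebra d, (∀ x ∈ Metric.closedBall 0 R, |φ x - T x| ≤ 2 * ε) ∧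
      ∀ x, |T x| ≤ M + ε := by
  obtain ⟨T, hT, hTφ⟩ :=
    ContinuousMap.exists_mem_subalgebra_near_continuous_of_isCompact_of_separatesPoints
      separatesPoints_trigAlgebra φ (isCompact_closedBall (0 : Space d) R) hε
  obtain ⟨B, hB⟩ := exists_bound_of_mem_trigAlgebra hT
  let κ : ℝ → ℝ := fun y => max (-M) (min M y)
  have hM0 : 0 ≤ M := (abs_nonneg _).trans (hM 0)
  obtain ⟨q, hq⟩ := exists_polynomial_near_of_continuousOn (-B) B κ
    (by fun_prop) ε hε
  have hmem : Polynomial.aeval T q ∈ trigAlgebra d := by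
    have h := (Polynomial.aeval (⟨T, hT⟩ : trigAlgebra d) q).2
    rwa [Polynomial.aeval_subalgebra_coe] at h
  have hval : ∀ x, |(Polynomial.aeval T q) x - κ (T x)| < ε := fun x => by
    rw [Polynomial.aeval_continuousMap_apply]
    exact hq _ (abs_le.1 (hB x))
  refine ⟨Polynomial.aeval T q, hmem, fun x hx => ?_, fun x => ?_⟩
  · have h1 := hTφ x hx
    rw [Real.norm_eq_abs] at h1
    have h2 : κ (φ x) = φ x := by
      have := abs_le.1 (hM x)
      simp only [κ]
      rw [min_eq_right this.2, max_eq_right this.1]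
    have h3 : |κ (φ x) - κ (T x)| ≤ |φ x - T x| := by
      have h4 := abs_max_sub_max_le_max (-M) (min M (φ x)) (-M) (min M (T x))
      have h5 := abs_min_sub_min_le_max M (φ x) M (T x)
      rw [sub_self, abs_zero, max_eq_right (abs_nonneg _)] at h5
      rw [sub_self, abs_zero] at h4
      exact (h4.trans_eq (max_eq_right (abs_nonneg _))).trans h5
    rw [h2] at h3
    have h4 := hval x
    rw [abs_sub_comm] at h1
    calc |φ x - (Polynomial.aeval T q) x| = |(φ x - κ (T x)) - ((Polynomial.aeval T q) x -
          κ (T x))| := by congr 1; ring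
      _ ≤ |φ x - κ (T x)| + |(Polynomial.aeval T q) x - κ (T x)| := abs_sub _ _
      _ ≤ 2 * ε := by linarith
  · have h1 : |κ (T x)| ≤ M := by
      rw [abs_le]
      exact ⟨le_max_left _ _, max_le (by linarith) (min_le_left _ _)⟩
    have h2 := hval x
    calc |(Polynomial.aeval T q) x| = |κ (T x) + ((Polynomial.aeval T q) x - κ (T x))| := by
          congr 1; ring
      _ ≤ |κ (T x)| + |(Polynomial.aeval T q) x - κ (T x)| := abs_add_le _ _
      _ ≤ M + ε := by linarith

theorem hermiteApprox_of_continuous_of_bounded (hm1 : 1 ≤ m) (hm : m ≠ ∞) (φ : C(Space d, ℝ))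
    {M : ℝ} (hM : ∀ x, |φ x| ≤ M) : HermiteApprox m φ := by
  choose T hT hnear hbound using fun n : ℕ => exists_trigAlgebra_near φ hM n
    (ε := 1 / ((n : ℝ) + 1)) (by positivity)
  have h1 : ∀ n : ℕ, 1 / ((n : ℝ) + 1) ≤ 1 := fun n => by
    rw [div_le_one (by positivity)]
    have : (0 : ℝ) ≤ n := by positivity
    linarith
  refine HermiteApprox.of_dominated hm1 hm (F := fun n => T n) (G := fun _ => 2 * M + 1)
    (fun n => hermiteApprox_of_mem_trigAlgebra hm1 hm (hT n))
    φ.continuous.aestronglyMeasurable (memLp_const _) (fun n x => ?_) fun x => ?_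
  · refine (abs_sub _ _).trans ?_
    linarith [hM x, hbound n x, h1 n]
  · rw [tendsto_iff_norm_sub_tendsto_zero]
    have h2 : Tendsto (fun n : ℕ => 2 * (1 / ((n : ℝ) + 1))) atTop (𝓝 0) := by
      simpa using (tendsto_one_div_add_atTop_nhds_zero_nat (𝕜 := ℝ)).const_mul 2
    refine squeeze_zero' (Eventually.of_forall fun n => norm_nonneg _) ?_ h2
    obtain ⟨N, hN⟩ := exists_nat_ge ‖x‖
    filter_upwards [eventually_ge_atTop N] with n hn
    rw [Real.norm_eq_abs, abs_sub_comm]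
    refine hnear n x ?_
    rw [mem_closedBall_zero_iff]
    exact hN.trans (by exact_mod_cast hn)

theorem hermiteApprox_of_memLp (hm1 : 1 ≤ m) (hm : m ≠ ∞) {φ : Space d → ℝ}
    (hφ : MemLp φ m (gaussianWeight d)) : HermiteApprox m φ := by
  refine HermiteApprox.of_forall_near hm1 hφ.1 fun ε hε => ?_
  obtain ⟨g, hg, -⟩ := hφ.exists_boundedContinuous_eLpNorm_sub_le hm hε
  exact ⟨g, hermiteApprox_of_continuous_of_bounded hm1 hm g.toContinuousMap
    (fun x => g.norm_coe_le_norm x), hg⟩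

end GaussianWeight
end HarmonicOscillator

namespace HarmonicOscillator

/-! ### Hermite expansions in `L^p` -/

section ExpansionLinear

variable {d : ℕ} {E F : Type*} [NormedAddCommGroup E] [InnerProductSpace ℝ E]
  [NormedAddCommGroup F] [InnerProductSpace ℝ F]

theorem expansion_add (b c : (Fin d → ℕ) →₀ E) (x : Space d) :
    expansion (b + c) x = expansion b x + expansion c x :=
  Finsupp.sum_add_index' (h := fun k v => hermiteFunction k x • v) (fun _ => smul_zero _)
    fun _ _ _ => smul_add _ _ _

theorem expansion_single (k : Fin d → ℕ) (v : E) (x : Space d) :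
    expansion (Finsupp.single k v) x = hermiteFunction k x • v :=
  Finsupp.sum_single_index (h := fun k v => hermiteFunction k x • v) (smul_zero _)

theorem expansion_mapRange (T : E →ₗ[ℝ] F) (c : (Fin d → ℕ) →₀ E) (x : Space d) :
    expansion (Finsupp.mapRange.linearMap T c) x = T (expansion c x) := by
  have h := Finsupp.sum_mapRange_index (f := T) (hf := map_zero T) (g := c)
    (h := fun k v => hermiteFunction k x • v) fun _ => smul_zero _
  refine h.trans ?_
  simp only [expansion, Finsupp.sum, map_sum, map_smul]

theorem expansion_sum {κ : Type*} (s : Finset κ) (c : κ → (Fin d → ℕ) →₀ E) (x : Space d) :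
    expansion (∑ j ∈ s, c j) x = ∑ j ∈ s, expansion (c j) x := by
  classical
  induction s using Finset.induction_on with
  | empty => simp [expansion]
  | insert j s hj ih => rw [Finset.sum_insert hj, Finset.sum_insert hj, expansion_add, ih]

theorem continuous_expansion (c : (Fin d → ℕ) →₀ E) : Continuous (expansion c) :=
  continuous_finsetSum _ fun k _ => (continuous_hermiteFunction k).smul continuous_const

variable {m : ℝ≥0∞}

theorem memLp_hermiteFunction (hm0 : m ≠ 0) (hm : m ≠ ∞) (k : Fin d → ℕ) :
    MemLp (hermiteFunction k) m volume := by
  have hr : 0 < m.toReal := ENNReal.toReal_pos hm0 hm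
  have hc := continuous_hermiteFunction k
  obtain ⟨C, hC0, hC⟩ := exists_abs_hermiteFunction_le k
  refine (integrable_norm_rpow_iff hc.aestronglyMeasurable hm0 hm).1 ?_
  refine ((integrable_exp_neg_mul_norm_sq (d := d) (b := m.toReal / 4) (by positivity)).const_mul
    (C ^ m.toReal)).mono' ?_ (ae_of_all _ fun x => ?_)
  · exact (hc.norm.rpow_const fun _ => Or.inr hr.le).aestronglyMeasurable
  · rw [Real.norm_of_nonneg (by positivity), Real.norm_eq_abs]
    refine (Real.rpow_le_rpow (abs_nonneg _) (hC x) hr.le).trans_eq ?_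
    rw [Real.mul_rpow hC0 (Real.exp_pos _).le, ← Real.exp_mul]
    congr 2
    ring

theorem memLp_expansion (hm0 : m ≠ 0) (hm : m ≠ ∞) (c : (Fin d → ℕ) →₀ E) :
    MemLp (expansion c) m volume :=
  memLp_finsetSum _ fun k _ => (memLp_hermiteFunction hm0 hm k).of_le_mul (c := ‖c k‖)
    ((continuous_hermiteFunction k).smul continuous_const).aestronglyMeasurable
    (ae_of_all _ fun x => by rw [norm_smul, mul_comm])

/-- The finite Hermite expansions as a linear map into `L^m`. -/
noncomputable def expansionLp (hm0 : m ≠ 0) (hm : m ≠ ∞) :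
    ((Fin d → ℕ) →₀ E) →ₗ[ℝ] Lp E m (volume : Measure (Space d)) where
  toFun c := (memLp_expansion hm0 hm c).toLp
  map_add' b c := by
    rw [← MemLp.toLp_add]
    exact MemLp.toLp_congr _ _ (ae_of_all _ fun x => expansion_add b c x)
  map_smul' r c := by
    rw [RingHom.id_apply, ← MemLp.toLp_const_smul]
    exact MemLp.toLp_congr _ _ (ae_of_all _ fun x => expansion_smul r c x)

theorem coeFn_expansionLp (hm0 : m ≠ 0) (hm : m ≠ ∞) (c : (Fin d → ℕ) →₀ E) :
    expansionLp hm0 hm c =ᵐ[volume] expansion c :=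
  (memLp_expansion hm0 hm c).coeFn_toLp

end ExpansionLinear

variable {d : ℕ}

theorem eLpNorm_mul_gaussian_le {r : ℝ≥0∞} (hr1 : 1 ≤ r) (hr : r ≠ ∞) (h : Space d → ℝ) :
    eLpNorm (fun x => h x * gaussian d x) r volume ≤ eLpNorm h r (gaussianWeight d) := by
  have hr0 : r ≠ 0 := (zero_lt_one.trans_le hr1).ne'
  have hr1' : 1 ≤ r.toReal := by
    simpa using ENNReal.toReal_mono hr hr1
  rw [eLpNorm_eq_lintegral_rpow_enorm_toReal hr0 hr, eLpNorm_eq_lintegral_rpow_enorm_toReal hr0 hr,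
    gaussianWeight, lintegral_withDensity_eq_lintegral_mul_non_measurable _
      (continuous_gaussian.measurable.ennreal_ofReal) (ae_of_all _ fun x => ENNReal.ofReal_lt_top)]
  refine ENNReal.rpow_le_rpow (lintegral_mono fun x => ?_) (by positivity)
  rw [Pi.mul_apply, enorm_mul, ENNReal.mul_rpow_of_nonneg _ _ (by positivity), mul_comm,
    Real.enorm_of_nonneg (gaussian_pos x).le]
  gcongr
  calc ENNReal.ofReal (gaussian d x) ^ r.toReal ≤ ENNReal.ofReal (gaussian d x) ^ (1 : ℝ) :=
        ENNReal.rpow_le_rpow_of_exponent_ge (ENNReal.ofReal_le_one.2 (gaussian_le_one x)) hr1'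
    _ = _ := ENNReal.rpow_one _

/-- A bounded function supported in a ball is the product of the Gaussian and a bounded function,
hence a limit of Hermite expansions in two Lebesgue spaces at the same time. -/
theorem exists_eLpNorm_sub_expansion_le_of_bounded {p q : ℝ≥0∞} (hp1 : 1 ≤ p) (hp : p ≠ ∞)
    (hq1 : 1 ≤ q) (hq : q ≠ ∞) {f : Space d → ℝ} (hf : AEStronglyMeasurable f volume) {N : ℝ}
    (hN : ∀ x, |f x| ≤ N) (hN' : ∀ x, f x ≠ 0 → ‖x‖ ≤ N) {ε : ℝ≥0∞} (hε : ε ≠ 0) :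
    ∃ a : (Fin d → ℕ) →₀ ℝ, eLpNorm (f - expansion a) p volume ≤ ε ∧
      eLpNorm (f - expansion a) q volume ≤ ε := by
  have hN0 : 0 ≤ N := (abs_nonneg _).trans (hN 0)
  let ψ : Space d → ℝ := fun x => f x / gaussian d x
  have hψb : ∀ x, ‖ψ x‖ ≤ N * Real.exp (N ^ 2 / 2) := by
    intro x
    rw [Real.norm_eq_abs, abs_div, abs_of_pos (gaussian_pos x), div_le_iff₀ (gaussian_pos x)]
    by_cases hx : f x = 0
    · rw [hx, abs_zero]
      have := gaussian_pos x
      positivity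
    · refine (hN x).trans ?_
      rw [mul_assoc, gaussian, ← Real.exp_add]
      refine le_mul_of_one_le_right hN0 (Real.one_le_exp ?_)
      have := pow_le_pow_left₀ (norm_nonneg x) (hN' x hx) 2
      linarith
  have hψm : AEStronglyMeasurable ψ (gaussianWeight d) :=
    ((hf.aemeasurable.div continuous_gaussian.measurable.aemeasurable).mono_ac
      (withDensity_absolutelyContinuous _ _)).aestronglyMeasurable
  let m := max p q
  have hm1 : 1 ≤ m := hp1.trans (le_max_left _ _)
  have hm : m ≠ ∞ := (max_lt hp.lt_top hq.lt_top).ne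
  have happ : HermiteApprox m ψ :=
    hermiteApprox_of_memLp hm1 hm (MemLp.of_bound hψm _ (ae_of_all _ hψb))
  have key : ∀ r, 1 ≤ r → r ≠ ∞ → r ≤ m → ∀ P : Space d → ℝ, Continuous P →
      eLpNorm (fun x => (ψ x - P x) * gaussian d x) r volume ≤
        eLpNorm (ψ - P) m (gaussianWeight d) *
          gaussianWeight d Set.univ ^ (1 / r.toReal - 1 / m.toReal) := by
    intro r hr1 hr hrm P hP
    exact (eLpNorm_mul_gaussian_le hr1 hr (ψ - P)).trans
      (eLpNorm_le_eLpNorm_mul_rpow_measure_univ hrm (hψm.sub hP.aestronglyMeasurable))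
  have hexp : ∀ r, 1 ≤ r → r ≤ m → r ≠ ∞ → 0 ≤ 1 / r.toReal - 1 / m.toReal := by
    intro r hr1 hrm hr
    have h1 : 0 < r.toReal := ENNReal.toReal_pos (zero_lt_one.trans_le hr1).ne' hr
    exact sub_nonneg.2 (one_div_le_one_div_of_le h1 (ENNReal.toReal_mono hm hrm))
  set A := gaussianWeight d Set.univ ^ (1 / p.toReal - 1 / m.toReal) with hA
  set B := gaussianWeight d Set.univ ^ (1 / q.toReal - 1 / m.toReal) with hB
  have hAt : A ≠ ∞ := ENNReal.rpow_ne_top_of_nonneg (hexp p hp1 (le_max_left _ _) hp)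
    (measure_ne_top _ _)
  have hBt : B ≠ ∞ := ENNReal.rpow_ne_top_of_nonneg (hexp q hq1 (le_max_right _ _) hq)
    (measure_ne_top _ _)
  obtain ⟨P, hPc, hP, hPε⟩ := happ.2 (ε / (A + B))
    (ENNReal.div_ne_zero.2 ⟨hε, ENNReal.add_ne_top.2 ⟨hAt, hBt⟩⟩)
  obtain ⟨a, ha⟩ := exists_expansion_of_mem_hermiteSpan hP
  have heq : f - expansion a = fun x => (ψ x - P x) * gaussian d x := by
    rw [← ha]
    ext x
    simp only [Pi.sub_apply, ψ, sub_mul, div_mul_cancel₀ _ (gaussian_pos x).ne']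
  refine ⟨a, ?_, ?_⟩ <;> rw [heq]
  · refine (key p hp1 hp (le_max_left _ _) P hPc).trans ?_
    exact (mul_le_mul' hPε le_self_add).trans ((mul_comm _ _).trans_le ENNReal.mul_div_le)
  · refine (key q hq1 hq (le_max_right _ _) P hPc).trans ?_
    exact (mul_le_mul' hPε le_add_self).trans ((mul_comm _ _).trans_le ENNReal.mul_div_le)

/-- The Hermite expansions are dense in `L^p ∩ L^q`. -/
theorem exists_eLpNorm_sub_expansion_le {p q : ℝ≥0∞} (hp1 : 1 ≤ p) (hp : p ≠ ∞)
    (hq1 : 1 ≤ q) (hq : q ≠ ∞) {f : Space d → ℝ} (hfp : MemLp f p volume) (hfq : MemLp f q volume)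
    {ε : ℝ≥0∞} (hε : ε ≠ 0) :
    ∃ a : (Fin d → ℕ) →₀ ℝ, eLpNorm (f - expansion a) p volume ≤ ε ∧
      eLpNorm (f - expansion a) q volume ≤ ε := by
  let S : ℕ → Set (Space d) := fun n => {x | ‖x‖ ≤ n} ∩ {x | ‖f x‖ ≤ n}
  let F : ℕ → Space d → ℝ := fun n => (S n).indicator f
  have hS : ∀ n, NullMeasurableSet (S n) volume := fun n =>
    (measurableSet_le measurable_norm measurable_const).nullMeasurableSet.inter
      (nullMeasurableSet_le hfp.1.aemeasurable.norm aemeasurable_const)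
  have hF : ∀ n, AEStronglyMeasurable (F n) volume := fun n => hfp.1.indicator₀ (hS n)
  have hb : ∀ n x, |f x - F n x| ≤ ‖f x‖ := by
    intro n x
    by_cases hx : x ∈ S n
    · simp [F, hx]
    · simp [F, hx]
  have hlim : ∀ x, Tendsto (fun n => F n x) atTop (𝓝 (f x)) := by
    intro x
    refine tendsto_const_nhds.congr' ?_
    filter_upwards [eventually_ge_atTop ⌈‖x‖⌉₊, eventually_ge_atTop ⌈‖f x‖⌉₊] with n h1 h2
    exact (Set.indicator_of_mem (show x ∈ S n from ⟨Nat.ceil_le.1 h1, Nat.ceil_le.1 h2⟩) f).symm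
  have hε2 : ε / 2 ≠ 0 := (ENNReal.half_pos hε).ne'
  have t1 := tendsto_eLpNorm_sub_of_dominated (zero_lt_one.trans_le hp1).ne' hp hF hfp.1 hfp.norm
    hb hlim
  have t2 := tendsto_eLpNorm_sub_of_dominated (zero_lt_one.trans_le hq1).ne' hq hF hfq.1 hfq.norm
    hb hlim
  obtain ⟨n, hn1, hn2⟩ := ((t1.eventually (Iic_mem_nhds (pos_iff_ne_zero.2 hε2))).and
    (t2.eventually (Iic_mem_nhds (pos_iff_ne_zero.2 hε2)))).exists
  obtain ⟨a, ha1, ha2⟩ := exists_eLpNorm_sub_expansion_le_of_bounded hp1 hp hq1 hq (hF n)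
    (N := n) (fun x => by
      by_cases hx : x ∈ S n
      · simpa [F, hx] using hx.2
      · simp [F, hx])
    (fun x hx => by
      by_contra hcon
      exact hx (Set.indicator_of_notMem (fun h => hcon h.1) f)) hε2
  have hsplit : f - expansion a = (f - F n) + (F n - expansion a) := by abel
  have hE : AEStronglyMeasurable (expansion a) (volume : Measure (Space d)) :=
    (continuous_expansion a).aestronglyMeasurable
  refine ⟨a, ?_, ?_⟩ <;> rw [hsplit]
  · refine (eLpNorm_add_le (hfp.1.sub (hF n)) ((hF n).sub hE) hp1).trans ?_
    exact (add_le_add hn1 ha1).trans_eq (ENNReal.add_halves ε)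
  · refine (eLpNorm_add_le (hfp.1.sub (hF n)) ((hF n).sub hE) hq1).trans ?_
    exact (add_le_add hn2 ha2).trans_eq (ENNReal.add_halves ε)

theorem edist_expansionLp {E : Type*} [NormedAddCommGroup E] [InnerProductSpace ℝ E]
    {m : ℝ≥0∞} [Fact (1 ≤ m)] (hm0 : m ≠ 0) (hm : m ≠ ∞)
    (f : Lp E m (volume : Measure (Space d))) (c : (Fin d → ℕ) →₀ E) :
    edist f (expansionLp hm0 hm c) = eLpNorm ((f : Space d → E) - expansion c) m volume := by
  rw [Lp.edist_def]
  exact eLpNorm_congr_ae ((ae_eq_refl _).sub (coeFn_expansionLp hm0 hm c))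

theorem denseRange_expansionLp {m : ℝ≥0∞} [hm1 : Fact (1 ≤ m)] (hm0 : m ≠ 0) (hm : m ≠ ∞) :
    DenseRange (expansionLp hm0 hm : ((Fin d → ℕ) →₀ ℝ) →ₗ[ℝ] Lp ℝ m volume) := by
  intro f
  rw [EMetric.mem_closure_iff]
  intro ε hε
  obtain ⟨δ, hδ0, hδ⟩ := exists_between hε
  obtain ⟨a, ha, -⟩ := exists_eLpNorm_sub_expansion_le hm1.out hm hm1.out hm (Lp.memLp f)
    (Lp.memLp f) hδ0.ne'
  exact ⟨_, ⟨a, rfl⟩, (edist_expansionLp hm0 hm f a).trans_lt (ha.trans_lt hδ)⟩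

theorem denseRange_expansionLp_vector {m : ℝ≥0∞} [hm1 : Fact (1 ≤ m)] (hm0 : m ≠ 0) (hm : m ≠ ∞) :
    DenseRange (expansionLp hm0 hm : ((Fin d → ℕ) →₀ Space d) →ₗ[ℝ] Lp (Space d) m volume) := by
  intro f
  rw [EMetric.mem_closure_iff]
  intro ε hε
  obtain ⟨δ, hδ0, hδ⟩ := exists_between hε
  have hf : ∀ i, MemLp (fun x => f x i) m volume := fun i =>
    (Lp.memLp f).of_le ((EuclideanSpace.proj (𝕜 := ℝ) i).continuous.comp_aestronglyMeasurable
      (Lp.memLp f).1) (ae_of_all _ fun x => PiLp.norm_apply_le (f x) i)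
  have hδd : δ / d ≠ 0 := ENNReal.div_ne_zero.2 ⟨hδ0.ne', ENNReal.natCast_ne_top d⟩
  choose a ha using fun i => exists_eLpNorm_sub_expansion_le hm1.out hm hm1.out hm (hf i) (hf i) hδd
  let e : Fin d → Space d := fun i => EuclideanSpace.single i 1
  let c : (Fin d → ℕ) →₀ Space d :=
    ∑ i, Finsupp.mapRange.linearMap (LinearMap.toSpanSingleton ℝ (Space d) (e i)) (a i)
  have hc : ∀ x, expansion c x = ∑ i, expansion (a i) x • e i := by
    intro x
    rw [expansion_sum]
    refine Finset.sum_congr rfl fun i _ => ?_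
    rw [expansion_mapRange]
    rfl
  have hsplit : (f : Space d → Space d) - expansion c =
      ∑ i, fun x => (f x i - expansion (a i) x) • e i := by
    ext x j
    rw [Pi.sub_apply, PiLp.sub_apply, hc, Finset.sum_apply]
    simp [e, Finset.sum_apply, Pi.single_apply]
  refine ⟨_, ⟨c, rfl⟩, (edist_expansionLp hm0 hm f c).trans_lt (lt_of_le_of_lt ?_ hδ)⟩
  rw [hsplit]
  refine (eLpNorm_sum_le (fun i _ => ?_) hm1.out).trans ?_
  · exact (((hf i).1.sub (continuous_expansion (a i)).aestronglyMeasurable).smul_const (e i))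
  · have h1 : ∀ i, eLpNorm (fun x => (f x i - expansion (a i) x) • e i) m volume ≤ δ / d := by
      intro i
      refine le_trans (eLpNorm_mono fun x => ?_) (ha i).1
      rw [norm_smul]
      simp [e]
    refine (Finset.sum_le_sum fun i _ => h1 i).trans ?_
    rw [Finset.sum_const, Finset.card_univ, Fintype.card_fin, nsmul_eq_mul]
    exact ENNReal.mul_div_le

end HarmonicOscillator

namespace HarmonicOscillator

/-! ### The Riesz transforms as bounded operators -/

variable {d : ℕ}

theorem norm_lp_eq_integral_rpow {α E : Type*} [MeasurableSpace α] {μ : Measure α}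
    [NormedAddCommGroup E] {p : ℝ} (hp : 0 < p) (f : Lp E (ENNReal.ofReal p) μ) :
    ‖f‖ = (∫ x, ‖f x‖ ^ p ∂μ) ^ (1 / p) := by
  rw [Lp.norm_def, (Lp.memLp f).eLpNorm_eq_integral_rpow_norm (ENNReal.ofReal_pos.2 hp).ne'
    ENNReal.ofReal_ne_top, ENNReal.toReal_ofReal hp.le, ENNReal.toReal_ofReal (by positivity),
    one_div]

/-- The norm of `L^p` is dual to the norm of `L^q`: test with `|G|^{p-2} G`. -/
theorem norm_le_of_forall_abs_integral_inner_le {α E : Type*} [MeasurableSpace α] {μ : Measure α}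
    [NormedAddCommGroup E] [InnerProductSpace ℝ E] {p q : ℝ} (hpq : p.HolderConjugate q)
    (G : Lp E (ENNReal.ofReal p) μ) {K : ℝ} (hK : 0 ≤ K)
    (h : ∀ H : Lp E (ENNReal.ofReal q) μ, |∫ x, inner ℝ (G x) (H x) ∂μ| ≤ K * ‖H‖) : ‖G‖ ≤ K := by
  have hp0 := hpq.pos
  have hq0 := hpq.symm.pos
  have hp1 := hpq.lt
  have hqp : (p - 1) * q = p := hpq.sub_one_mul_conj
  set I := ∫ x, ‖G x‖ ^ p ∂μ with hI
  have hI0 : 0 ≤ I := integral_nonneg fun x => by positivity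
  have hGn : ‖G‖ = I ^ (1 / p) := norm_lp_eq_integral_rpow hp0 G
  have hGm : AEStronglyMeasurable G μ := (Lp.memLp G).1
  let H : α → E := fun x => ‖G x‖ ^ (p - 2) • G x
  have hHnorm : ∀ x, ‖H x‖ = ‖G x‖ ^ (p - 1) := by
    intro x
    rw [norm_smul, Real.norm_of_nonneg (by positivity)]
    rcases (norm_nonneg (G x)).eq_or_lt with h0 | h0
    · rw [← h0, mul_zero, Real.zero_rpow (by linarith)]
    · rw [← Real.rpow_add_one h0.ne']
      congr 1
      ring
  have hHp : ∀ x, ‖H x‖ ^ q = ‖G x‖ ^ p := fun x => by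
    rw [hHnorm, ← Real.rpow_mul (norm_nonneg _), hqp]
  have hHm : AEStronglyMeasurable H μ :=
    (hGm.norm.aemeasurable.pow_const (p - 2)).aestronglyMeasurable.smul hGm
  have hG := (Lp.memLp G).integrable_norm_rpow (ENNReal.ofReal_pos.2 hp0).ne' ENNReal.ofReal_ne_top
  rw [ENNReal.toReal_ofReal hp0.le] at hG
  have hHL : MemLp H (ENNReal.ofReal q) μ := by
    refine (integrable_norm_rpow_iff hHm (ENNReal.ofReal_pos.2 hq0).ne'
      ENNReal.ofReal_ne_top).1 ?_
    rw [ENNReal.toReal_ofReal hq0.le]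
    exact hG.congr (ae_of_all _ fun x => (hHp x).symm)
  have hHn : ‖hHL.toLp‖ = I ^ (1 / q) := by
    rw [norm_lp_eq_integral_rpow hq0, hI]
    congr 1
    refine integral_congr_ae ?_
    filter_upwards [hHL.coeFn_toLp] with x hx
    rw [hx, hHp]
  have hpair : ∫ x, inner ℝ (G x) ((hHL.toLp : Lp E (ENNReal.ofReal q) μ) x) ∂μ = I := by
    refine integral_congr_ae ?_
    filter_upwards [hHL.coeFn_toLp] with x hx
    rw [hx, inner_smul_right, real_inner_self_eq_norm_sq]
    rcases (norm_nonneg (G x)).eq_or_lt with h0 | h0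
    · rw [← h0, Real.zero_rpow hp0.ne']
      simp
    · rw [← Real.rpow_natCast, ← Real.rpow_add h0]
      congr 1
      push_cast
      ring
  have key := h hHL.toLp
  rw [hpair, hHn, abs_of_nonneg hI0] at key
  rw [hGn]
  rcases hI0.eq_or_lt with h0 | h0
  · rw [← h0, Real.zero_rpow (by positivity)]
    exact hK
  · have h1 : I ^ (1 / p) * I ^ (1 / q) = I := by
      rw [← Real.rpow_add h0, hpq.one_div_add_one_div, div_one, Real.rpow_one]
    refine le_of_mul_le_mul_right ?_ (Real.rpow_pos_of_pos h0 (1 / q))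
    rwa [h1]

/-- The coefficients of the vector of Riesz transforms of a finite Hermite expansion. -/
noncomputable def rieszCoeff : ((Fin d → ℕ) →₀ ℝ) →ₗ[ℝ] ((Fin d → ℕ) →₀ Space d) :=
  Finsupp.linearCombination ℝ fun k => ∑ i, Finsupp.single (lower i k)
    (((√(eigenvalue k))⁻¹ * √(2 * (k i : ℝ))) • EuclideanSpace.single i (1 : ℝ))

theorem expansion_rieszCoeff (a : (Fin d → ℕ) →₀ ℝ) (i : Fin d) (x : Space d) :
    expansion (rieszCoeff a) x i = rieszExpansion a i x := by
  rw [rieszCoeff, Finsupp.linearCombination_apply, Finsupp.sum, expansion_sum, rieszExpansion,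
    WithLp.ofLp_sum, Finset.sum_apply]
  refine Finset.sum_congr rfl fun k _ => ?_
  rw [expansion_smul, expansion_sum, PiLp.smul_apply, WithLp.ofLp_sum, Finset.sum_apply]
  simp only [expansion_single, PiLp.smul_apply, smul_eq_mul, PiLp.single_apply,
    mul_ite, mul_one, mul_zero, Finset.sum_ite_eq, Finset.mem_univ, if_true]
  ring

section Operator

variable {p : ℝ}

/-- The finite Hermite expansions in `L^p`. -/
noncomputable def hermiteLp (E : Type*) [NormedAddCommGroup E] [InnerProductSpace ℝ E]
    (hp : 1 < p) :
    ((Fin d → ℕ) →₀ E) →ₗ[ℝ] Lp E (ENNReal.ofReal p) (volume : Measure (Space d)) :=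
  expansionLp (ENNReal.ofReal_pos.2 (zero_lt_one.trans hp)).ne' ENNReal.ofReal_ne_top

theorem fact_one_le_ofReal (hp : 1 < p) : Fact (1 ≤ ENNReal.ofReal p) :=
  ⟨ENNReal.one_le_ofReal.2 hp.le⟩

theorem norm_hermiteLp {E : Type*} [NormedAddCommGroup E] [InnerProductSpace ℝ E] (hp : 1 < p)
    (c : (Fin d → ℕ) →₀ E) : ‖hermiteLp E hp c‖ = (∫ x, ‖expansion c x‖ ^ p) ^ (1 / p) := by
  rw [norm_lp_eq_integral_rpow (by linarith)]
  congr 1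
  refine integral_congr_ae ?_
  filter_upwards [coeFn_expansionLp _ _ c] with x hx
  rw [hermiteLp, hx]

/-- The norm bound for the Riesz transforms on finite Hermite expansions. -/
theorem norm_hermiteLp_rieszCoeff_le (hd : 1 ≤ d) (hp : 1 < p) (a : (Fin d → ℕ) →₀ ℝ) :
    ‖hermiteLp (Space d) hp (rieszCoeff a)‖ ≤
      36 * (pStar p - 1) * ‖hermiteLp ℝ hp a‖ := by
  have hpq := Real.HolderConjugate.conjExponent hp
  set q := p.conjExponent with hq
  have hq1 : 1 < q := hpq.symm.lt
  have := fact_one_le_ofReal hp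
  have := fact_one_le_ofReal hq1
  have hps := one_le_pStar_sub_one hp
  have : ENNReal.HolderConjugate (ENNReal.ofReal p) (ENNReal.ofReal q) := hpq.ennrealOfReal
  set G := hermiteLp (Space d) hp (rieszCoeff a) with hG
  refine norm_le_of_forall_abs_integral_inner_le hpq _ (by positivity) fun H => ?_
  let B := (innerSL ℝ (E := Space d)).lpPairing volume (ENNReal.ofReal p) (ENNReal.ofReal q) G
  have hB : ∀ H, B H = ∫ x, inner ℝ (G x) (H x) := fun H =>
    ContinuousLinearMap.lpPairing_eq_integral (innerSL ℝ (E := Space d)) G H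
  rw [← hB]
  refine (denseRange_expansionLp_vector (d := d)
    (ENNReal.ofReal_pos.2 (zero_lt_one.trans hq1)).ne' ENNReal.ofReal_ne_top).induction_on
    (p := fun H => |B H| ≤ 36 * (pStar p - 1) * ‖hermiteLp ℝ hp a‖ * ‖H‖) H
    (isClosed_le (by fun_prop) (by fun_prop)) fun c => ?_
  have h1 : B (hermiteLp (Space d) hq1 c) =
      ∫ x, ∑ i, rieszExpansion a i x * expansion c x i := by
    rw [hB]
    refine integral_congr_ae ?_
    filter_upwards [coeFn_expansionLp _ _ c, coeFn_expansionLp _ _ (rieszCoeff a)] with x hx hx'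
    rw [hG, hermiteLp, hermiteLp, hx, hx', PiLp.inner_apply]
    refine Finset.sum_congr rfl fun i _ => ?_
    rw [expansion_rieszCoeff]
    simp [mul_comm]
  have h2 := abs_integral_rieszExpansion_mul_le_mul hd hpq a c
  rw [← h1, ← norm_hermiteLp hp a, ← norm_hermiteLp hq1 c, ← mul_assoc] at h2
  exact h2

/-- The vector of Riesz transforms on `L^p`. -/
noncomputable def rieszLp (hp : 1 < p) [Fact (1 ≤ ENNReal.ofReal p)] :
    Lp ℝ (ENNReal.ofReal p) (volume : Measure (Space d)) →L[ℝ]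
      Lp (Space d) (ENNReal.ofReal p) (volume : Measure (Space d)) :=
  (hermiteLp (Space d) hp ∘ₗ rieszCoeff).extendOfNorm (hermiteLp ℝ hp)

theorem denseRange_hermiteLp (hp : 1 < p) [Fact (1 ≤ ENNReal.ofReal p)] :
    DenseRange (hermiteLp (d := d) ℝ hp) :=
  denseRange_expansionLp _ _

theorem rieszLp_hermiteLp (hd : 1 ≤ d) (hp : 1 < p) [Fact (1 ≤ ENNReal.ofReal p)]
    (a : (Fin d → ℕ) →₀ ℝ) :
    rieszLp hp (hermiteLp ℝ hp a) = hermiteLp (Space d) hp (rieszCoeff a) :=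
  LinearMap.extendOfNorm_eq (denseRange_hermiteLp hp) ⟨_, norm_hermiteLp_rieszCoeff_le hd hp⟩ a

theorem norm_rieszLp_le (hd : 1 ≤ d) (hp : 1 < p) [Fact (1 ≤ ENNReal.ofReal p)]
    (f : Lp ℝ (ENNReal.ofReal p) (volume : Measure (Space d))) :
    ‖rieszLp hp f‖ ≤ 36 * (pStar p - 1) * ‖f‖ :=
  LinearMap.norm_extendOfNorm_apply_le (denseRange_hermiteLp hp) _
    (norm_hermiteLp_rieszCoeff_le hd hp) f

end Operator

end HarmonicOscillator

namespace HarmonicOscillator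

/-! ### The Riesz transforms on square integrable functions -/

variable {d : ℕ}

/-- The Pythagorean theorem for a sum of distinct Hermite functions. -/
theorem integral_sq_sum_hermite (s : Finset (Fin d → ℕ)) (α : (Fin d → ℕ) → ℝ)
    (φ : (Fin d → ℕ) → Fin d → ℕ)
    (hφ : ∀ k l, α k ≠ 0 → α l ≠ 0 → φ k = φ l → k = l) :
    ∫ x, (∑ k ∈ s, α k * hermiteFunction (φ k) x) ^ 2 = ∑ k ∈ s, α k ^ 2 := by
  have hi : ∀ k l, Integrable (fun x => α k * hermiteFunction (φ k) x *
      (α l * hermiteFunction (φ l) x)) := fun k l => by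
    refine ((integrable_hermiteFunction_mul (φ k) (φ l)).const_mul (α k * α l)).congr
      (ae_of_all _ fun x => ?_)
    simp only
    ring
  simp only [sq, Finset.sum_mul_sum]
  rw [integral_finsetSum _ fun k _ => integrable_finsetSum _ fun m _ => hi k m]
  refine Finset.sum_congr rfl fun k hk => ?_
  rw [integral_finsetSum _ fun m _ => hi k m]
  have : ∀ l, ∫ x, α k * hermiteFunction (φ k) x * (α l * hermiteFunction (φ l) x) =
      if k = l then α k * α l else 0 := by
    intro l
    have h1 : ∀ x, α k * hermiteFunction (φ k) x * (α l * hermiteFunction (φ l) x) =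
        α k * α l * (hermiteFunction (φ k) x * hermiteFunction (φ l) x) := fun x => by ring
    simp only [h1]
    rw [integral_const_mul, integral_hermiteFunction_mul]
    by_cases hkl : k = l
    · simp [hkl]
    · by_cases hk0 : α k = 0
      · simp [hk0]
      · by_cases hl0 : α l = 0
        · simp [hl0]
        · rw [if_neg fun h => hkl (hφ k l hk0 hl0 h), if_neg hkl, mul_zero]
  simp only [this]
  rw [Finset.sum_ite_eq, if_pos hk]

theorem eLpNorm_two_le_of_integral_sq_le {f g : Space d → ℝ} (hf : MemLp f 2 volume)
    (hg : MemLp g 2 volume) (h : ∫ x, f x ^ 2 ≤ ∫ x, g x ^ 2) :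
    eLpNorm f 2 volume ≤ eLpNorm g 2 volume := by
  rw [hf.eLpNorm_eq_integral_rpow_norm two_ne_zero ENNReal.ofNat_ne_top,
    hg.eLpNorm_eq_integral_rpow_norm two_ne_zero ENNReal.ofNat_ne_top]
  simp only [ENNReal.toReal_ofNat, Real.rpow_two, Real.norm_eq_abs, sq_abs]
  exact ENNReal.ofReal_le_ofReal
    (Real.rpow_le_rpow (integral_nonneg fun x => sq_nonneg _) h (by norm_num))

theorem integrable_mul_hermiteFunction {f : Space d → ℝ} (hf : MemLp f 2 volume)
    (k : Fin d → ℕ) : Integrable (fun x => f x * hermiteFunction k x) :=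
  hf.integrable_mul (memLp_hermiteFunction two_ne_zero ENNReal.ofNat_ne_top k)

/-- Bessel's inequality for the Hermite functions. -/
theorem sum_sq_integral_mul_hermiteFunction_le {f : Space d → ℝ} (hf : MemLp f 2 volume)
    (s : Finset (Fin d → ℕ)) :
    ∑ k ∈ s, (∫ x, f x * hermiteFunction k x) ^ 2 ≤ ∫ x, f x ^ 2 := by
  set b : (Fin d → ℕ) → ℝ := fun k => ∫ x, f x * hermiteFunction k x with hb
  let g : Space d → ℝ := fun x => ∑ k ∈ s, b k * hermiteFunction k x
  have hg : MemLp g 2 volume := memLp_finsetSum _ fun k _ =>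
    (memLp_hermiteFunction two_ne_zero ENNReal.ofNat_ne_top k).const_mul (b k)
  have h1 : ∫ x, g x ^ 2 = ∑ k ∈ s, b k ^ 2 :=
    integral_sq_sum_hermite s b id fun k l _ _ h => h
  have h2 : ∫ x, f x * g x = ∑ k ∈ s, b k ^ 2 := by
    simp only [g, Finset.mul_sum, mul_left_comm (f _)]
    rw [integral_finsetSum _ fun k _ => (integrable_mul_hermiteFunction hf k).const_mul (b k)]
    refine Finset.sum_congr rfl fun k _ => ?_
    rw [integral_const_mul, sq]
  have h3 : ∫ x, (f x - g x) ^ 2 = (∫ x, f x ^ 2) - 2 * (∫ x, f x * g x) + ∫ x, g x ^ 2 := by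
    have hfg : Integrable fun x => 2 * (f x * g x) := (hf.integrable_mul hg).const_mul 2
    have hs : Integrable fun x => f x ^ 2 - 2 * (f x * g x) := hf.integrable_sq.sub hfg
    have e : ∀ x, (f x - g x) ^ 2 = (f x ^ 2 - 2 * (f x * g x)) + g x ^ 2 := fun x => by ring
    simp only [e]
    rw [integral_add hs hg.integrable_sq, integral_sub hf.integrable_sq hfg, integral_const_mul]
  have h4 : 0 ≤ ∫ x, (f x - g x) ^ 2 := integral_nonneg fun x => sq_nonneg _
  linarith

theorem eq_of_lower_eq {i : Fin d} {k l : Fin d → ℕ} (hk : k i ≠ 0) (hl : l i ≠ 0)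
    (h : lower i k = lower i l) : k = l := by
  funext j
  have hj := congrFun h j
  unfold lower at hj
  by_cases hji : j = i
  · subst hji
    simp only [Function.update_self] at hj
    omega
  · rwa [Function.update_of_ne hji, Function.update_of_ne hji] at hj

theorem rieszPartialSum_eq (i : Fin d) (f : Space d → ℝ) (s : Finset (Fin d → ℕ)) (x : Space d) :
    rieszPartialSum i f s x = ∑ k ∈ s, (√(eigenvalue k))⁻¹ * (∫ y, f y * hermiteFunction k y) *
      √(2 * (k i : ℝ)) * hermiteFunction (lower i k) x := by
  simp only [rieszPartialSum, delta_hermiteFunction, mul_assoc]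

theorem memLp_rieszPartialSum (i : Fin d) (f : Space d → ℝ) (s : Finset (Fin d → ℕ)) :
    MemLp (rieszPartialSum i f s) 2 volume := by
  have h : rieszPartialSum i f s = fun x => ∑ k ∈ s, (√(eigenvalue k))⁻¹ *
      (∫ y, f y * hermiteFunction k y) * √(2 * (k i : ℝ)) * hermiteFunction (lower i k) x :=
    funext fun x => rieszPartialSum_eq i f s x
  rw [h]
  exact memLp_finsetSum _ fun k _ =>
    (memLp_hermiteFunction two_ne_zero ENNReal.ofNat_ne_top (lower i k)).const_mul _

/-- The partial sums of the Riesz transforms are contractions of `L²`, since `2 k_i ≤ λ_k`. -/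
theorem eLpNorm_rieszPartialSum_le (hd : 1 ≤ d) (i : Fin d) {f : Space d → ℝ}
    (hf : MemLp f 2 volume) (s : Finset (Fin d → ℕ)) :
    eLpNorm (rieszPartialSum i f s) 2 volume ≤ eLpNorm f 2 volume := by
  refine eLpNorm_two_le_of_integral_sq_le (memLp_rieszPartialSum i f s) hf ?_
  simp only [rieszPartialSum_eq]
  rw [integral_sq_sum_hermite s _ (lower i)]
  · refine le_trans (Finset.sum_le_sum fun k _ => ?_) (sum_sq_integral_mul_hermiteFunction_le hf s)
    have h1 := one_le_eigenvalue hd k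
    have h2 : 2 * (k i : ℝ) ≤ eigenvalue k := by
      have h3 : (k i : ℝ) ≤ ∑ j, (k j : ℝ) :=
        Finset.single_le_sum (fun j _ => Nat.cast_nonneg (k j)) (Finset.mem_univ i)
      have h4 : (0 : ℝ) ≤ d := Nat.cast_nonneg d
      unfold eigenvalue
      linarith
    rw [mul_pow, mul_pow, inv_pow, Real.sq_sqrt (by linarith), Real.sq_sqrt (by positivity)]
    have h5 : (eigenvalue k)⁻¹ * (2 * (k i : ℝ)) ≤ 1 := by
      rw [inv_mul_le_iff₀ (by linarith), mul_one]
      exact h2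
    calc (eigenvalue k)⁻¹ * (∫ y, f y * hermiteFunction k y) ^ 2 * (2 * (k i : ℝ))
        = (eigenvalue k)⁻¹ * (2 * (k i : ℝ)) * (∫ y, f y * hermiteFunction k y) ^ 2 := by ring
      _ ≤ 1 * _ := mul_le_mul_of_nonneg_right h5 (sq_nonneg _)
      _ = _ := one_mul _
  · have h0 : ∀ k : Fin d → ℕ, (√(eigenvalue k))⁻¹ * (∫ y, f y * hermiteFunction k y) *
        √(2 * (k i : ℝ)) ≠ 0 → k i ≠ 0 := by
      intro k h hk
      rw [hk] at h
      simp at h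
    exact fun k l hk hl h => eq_of_lower_eq (h0 k hk) (h0 l hl) h

theorem integral_expansion_mul_hermiteFunction (a : (Fin d → ℕ) →₀ ℝ) (k : Fin d → ℕ) :
    ∫ x, expansion a x * hermiteFunction k x = a k := by
  have h : ∀ x, expansion a x * hermiteFunction k x =
      ∑ m ∈ a.support, a m * (hermiteFunction m x * hermiteFunction k x) := fun x => by
    rw [expansion, Finset.sum_mul]
    refine Finset.sum_congr rfl fun m _ => ?_
    rw [smul_eq_mul]
    ring
  simp only [h]
  rw [integral_finsetSum _ fun m _ => (integrable_hermiteFunction_mul m k).const_mul (a m)]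
  simp only [integral_const_mul, integral_hermiteFunction_mul, mul_ite, mul_one, mul_zero]
  rw [Finset.sum_ite_eq']
  split_ifs with hk
  · rfl
  · exact (Finsupp.notMem_support_iff.1 hk).symm

theorem rieszPartialSum_expansion (i : Fin d) (a : (Fin d → ℕ) →₀ ℝ) {s : Finset (Fin d → ℕ)}
    (hs : a.support ⊆ s) (x : Space d) :
    rieszPartialSum i (expansion a) s x = expansion (rieszCoeff a) x i := by
  rw [rieszPartialSum_eq, expansion_rieszCoeff, rieszExpansion]
  simp only [integral_expansion_mul_hermiteFunction]
  refine (Finset.sum_subset hs fun k _ hk => ?_).symm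
  rw [Finsupp.notMem_support_iff.1 hk]
  ring

theorem rieszPartialSum_sub (i : Fin d) {f g : Space d → ℝ} (hf : MemLp f 2 volume)
    (hg : MemLp g 2 volume) (s : Finset (Fin d → ℕ)) :
    rieszPartialSum i (f - g) s = rieszPartialSum i f s - rieszPartialSum i g s := by
  ext x
  rw [Pi.sub_apply, rieszPartialSum, rieszPartialSum, rieszPartialSum, ← Finset.sum_sub_distrib]
  refine Finset.sum_congr rfl fun k _ => ?_
  simp only [Pi.sub_apply, sub_mul]
  rw [integral_sub (integrable_mul_hermiteFunction hf k) (integrable_mul_hermiteFunction hg k)]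
  ring

theorem memLp_coord {α : Type*} [MeasurableSpace α] {μ : Measure α} {m : ℝ≥0∞} {g : α → Space d}
    (hg : MemLp g m μ) (i : Fin d) : MemLp (fun x => g x i) m μ :=
  hg.of_le ((EuclideanSpace.proj (𝕜 := ℝ) i).continuous.comp_aestronglyMeasurable hg.1)
    (ae_of_all _ fun x => PiLp.norm_apply_le (g x) i)

/-- A limit in `L²` of Riesz transforms of Hermite expansions that tend to `f` is the vector of
Riesz transforms of `f`. -/
theorem isRieszVector_of_tendsto (hd : 1 ≤ d) {f : Space d → ℝ} {g : Space d → Space d}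
    (hf : MemLp f 2 volume) (hg : MemLp g 2 volume) {a : ℕ → (Fin d → ℕ) →₀ ℝ}
    (hfa : Tendsto (fun n => eLpNorm (expansion (a n) - f) 2 volume) atTop (𝓝 0))
    (hga : Tendsto (fun n => eLpNorm (expansion (rieszCoeff (a n)) - g) 2 volume) atTop (𝓝 0)) :
    IsRieszVector f g := by
  have h2 : (2 : ℝ≥0∞) ≠ 0 := two_ne_zero
  have h2' : (2 : ℝ≥0∞) ≠ ∞ := ENNReal.ofNat_ne_top
  intro i
  have hgi := memLp_coord hg i
  -- Compare `f` with `u = expansion (a n)` for one large `n`: the partial sum for `u` over any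
  -- `s ⊇ supp (a n)` is the Riesz transform of `u`, and the one for `f - u` is small uniformly in `s`.
  refine ⟨hgi, ENNReal.tendsto_nhds_zero.2 fun ε hε => ?_⟩
  have hε2 : 0 < ε / 2 := ENNReal.half_pos hε.ne'
  obtain ⟨n, hn1, hn2⟩ := ((ENNReal.tendsto_nhds_zero.1 hfa _ hε2).and
    (ENNReal.tendsto_nhds_zero.1 hga _ hε2)).exists
  have ha := memLp_expansion h2 h2' (a n)
  have hra := memLp_expansion h2 h2' (rieszCoeff (a n))
  filter_upwards [eventually_ge_atTop (a n).support] with s hs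
  have hsplit : (fun x => rieszPartialSum i f s x - g x i) =
      rieszPartialSum i (f - expansion (a n)) s +
        fun x => expansion (rieszCoeff (a n)) x i - g x i := by
    rw [rieszPartialSum_sub i hf ha]
    ext x
    simp only [Pi.add_apply, Pi.sub_apply]
    rw [rieszPartialSum_expansion i (a n) hs]
    ring
  rw [hsplit]
  refine (eLpNorm_add_le (memLp_rieszPartialSum _ _ _).1
    ((memLp_coord hra i).1.sub hgi.1) one_le_two).trans ?_
  refine (add_le_add ?_ ?_).trans_eq (ENNReal.add_halves ε)
  · refine (eLpNorm_rieszPartialSum_le hd i (hf.sub ha) s).trans ?_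
    rwa [eLpNorm_sub_comm]
  · refine le_trans (eLpNorm_mono fun x => ?_) hn2
    exact PiLp.norm_apply_le (expansion (rieszCoeff (a n)) x - g x) i

theorem IsRieszVector.ae_eq {f : Space d → ℝ} {g g' : Space d → Space d}
    (h : IsRieszVector f g) (h' : IsRieszVector f g') : g =ᵐ[volume] g' := by
  have hi : ∀ i, (fun x => g x i) =ᵐ[volume] fun x => g' x i := by
    intro i
    have hS := fun s => (memLp_rieszPartialSum i f s).1
    have ht := (h i).2.add (h' i).2
    rw [add_zero] at ht
    have h0 : eLpNorm (fun x => g x i - g' x i) 2 volume ≤ 0 := by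
      refine ge_of_tendsto' ht fun s => ?_
      have hsplit : (fun x => g x i - g' x i) = (fun x => g x i - rieszPartialSum i f s x) +
          fun x => rieszPartialSum i f s x - g' x i := by
        ext x
        simp
      rw [hsplit]
      refine (eLpNorm_add_le ((h i).1.1.sub (hS s)) ((hS s).sub (h' i).1.1) one_le_two).trans ?_
      refine add_le_add_left (le_of_eq ?_) _
      exact eLpNorm_sub_comm (fun x => g x i) (rieszPartialSum i f s) 2 volume
    have h1 := (eLpNorm_eq_zero_iff ((h i).1.1.sub (h' i).1.1) two_ne_zero).1 (le_antisymm h0 bot_le)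
    filter_upwards [h1] with x hx
    exact sub_eq_zero.1 hx
  filter_upwards [ae_all_iff.2 hi] with x hx
  ext i
  exact hx i

theorem IsRieszVector.congr_right {f : Space d → ℝ} {g g' : Space d → Space d}
    (h : IsRieszVector f g) (hg : g =ᵐ[volume] g') : IsRieszVector f g' := by
  intro i
  have hi : (fun x => g x i) =ᵐ[volume] fun x => g' x i := hg.mono fun x hx => by simp only [hx]
  refine ⟨(memLp_congr_ae hi).1 (h i).1, (h i).2.congr fun s => eLpNorm_congr_ae ?_⟩
  exact (ae_eq_refl _).sub hi

/-! ### Identification and uniqueness of the extension -/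

/-- Convergence of Hermite expansions in `L^p` carries over to their Riesz transforms. -/
theorem tendsto_eLpNorm_rieszLp {p : ℝ} (hd : 1 ≤ d) (hp : 1 < p) [Fact (1 ≤ ENNReal.ofReal p)]
    (f : Lp ℝ (ENNReal.ofReal p) (volume : Measure (Space d))) {a : ℕ → (Fin d → ℕ) →₀ ℝ}
    (h : Tendsto (fun n => eLpNorm (expansion (a n) - (f : Space d → ℝ)) (ENNReal.ofReal p) volume)
      atTop (𝓝 0)) :
    Tendsto (fun n => eLpNorm (expansion (rieszCoeff (a n)) - (rieszLp hp f : Space d → Space d))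
      (ENNReal.ofReal p) volume) atTop (𝓝 0) := by
  have h1 : Tendsto (fun n => hermiteLp ℝ hp (a n)) atTop (𝓝 f) := by
    rw [tendsto_iff_edist_tendsto_0]
    refine h.congr fun n => ?_
    rw [edist_comm, hermiteLp, edist_expansionLp, eLpNorm_sub_comm]
  have h2 := ((rieszLp hp).continuous.tendsto f).comp h1
  rw [tendsto_iff_edist_tendsto_0] at h2
  refine h2.congr fun n => ?_
  rw [Function.comp_apply, rieszLp_hermiteLp hd, edist_comm, hermiteLp, edist_expansionLp,
    eLpNorm_sub_comm]

/-- On `L^p ∩ L²` the operator `rieszLp` is given by the Hermite series: both it and its version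
for the exponent `2` are limits in measure of the Riesz transforms of the same expansions. -/
theorem isRieszVector_rieszLp {p : ℝ} (hd : 1 ≤ d) (hp : 1 < p) [Fact (1 ≤ ENNReal.ofReal p)]
    (f : Lp ℝ (ENNReal.ofReal p) (volume : Measure (Space d))) (hf : MemLp f 2 volume) :
    IsRieszVector f (rieszLp hp f) := by
  have e2 : ENNReal.ofReal 2 = 2 := ENNReal.ofReal_ofNat 2
  have e3 : ∀ {E : Type} [NormedAddCommGroup E] (h : Space d → E),
      eLpNorm h (ENNReal.ofReal 2) volume = eLpNorm h 2 volume :=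
    fun h => congrArg (fun m => eLpNorm h m volume) e2
  have hp1 : 1 ≤ ENNReal.ofReal p := Fact.out
  have h12 : (1 : ℝ) < 2 := one_lt_two
  have := fact_one_le_ofReal h12
  have hf' : MemLp f (ENNReal.ofReal 2) volume := by rwa [e2]
  have hex : ∀ n : ℕ, ∃ a : (Fin d → ℕ) →₀ ℝ,
      eLpNorm ((f : Space d → ℝ) - expansion a) (ENNReal.ofReal p) volume ≤ ((n : ℝ≥0∞) + 1)⁻¹ ∧
        eLpNorm ((f : Space d → ℝ) - expansion a) (ENNReal.ofReal 2) volume ≤ ((n : ℝ≥0∞) + 1)⁻¹ := fun n =>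
    exists_eLpNorm_sub_expansion_le hp1 ENNReal.ofReal_ne_top Fact.out ENNReal.ofReal_ne_top
      (Lp.memLp f) hf' (ENNReal.inv_ne_zero.2 (by finiteness))
  choose a ha1 ha2 using hex
  have hlim : Tendsto (fun n : ℕ => ((n : ℝ≥0∞) + 1)⁻¹) atTop (𝓝 0) := by
    have := (tendsto_add_atTop_iff_nat 1).2 ENNReal.tendsto_inv_nat_nhds_zero
    simpa using this
  have t1 : Tendsto (fun n => eLpNorm (expansion (a n) - (f : Space d → ℝ)) (ENNReal.ofReal p) volume)
      atTop (𝓝 0) := tendsto_of_tendsto_of_tendsto_of_le_of_le tendsto_const_nhds hlim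
    (fun _ => bot_le) fun n => (eLpNorm_sub_comm _ _ _ _).trans_le (ha1 n)
  have t2 : Tendsto (fun n => eLpNorm (expansion (a n) - (hf'.toLp : Space d → ℝ)) (ENNReal.ofReal 2)
      volume)
      atTop (𝓝 0) := by
    refine tendsto_of_tendsto_of_tendsto_of_le_of_le tendsto_const_nhds hlim
      (fun _ => bot_le) fun n => ?_
    refine (eLpNorm_congr_ae ((ae_eq_refl _).sub hf'.coeFn_toLp)).trans_le ?_
    exact (eLpNorm_sub_comm _ _ _ _).trans_le (ha2 n)
  have s1 := tendsto_eLpNorm_rieszLp hd hp f t1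
  have s2 := tendsto_eLpNorm_rieszLp hd h12 hf'.toLp t2
  have hm : ∀ n, AEStronglyMeasurable (expansion (rieszCoeff (a n))) (volume : Measure (Space d)) :=
    fun n => (continuous_expansion _).aestronglyMeasurable
  have hae : rieszLp h12 hf'.toLp =ᵐ[volume] rieszLp hp f :=
    tendstoInMeasure_ae_unique
      (tendstoInMeasure_of_tendsto_eLpNorm (zero_lt_one.trans_le Fact.out).ne' hm
        (Lp.memLp (rieszLp h12 hf'.toLp)).1 s2)
      (tendstoInMeasure_of_tendsto_eLpNorm (zero_lt_one.trans_le hp1).ne' hm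
        (Lp.memLp (rieszLp hp f)).1 s1)
  refine IsRieszVector.congr_right ?_ hae
  refine isRieszVector_of_tendsto hd hf (a := a) ?_ ?_ ?_
  · have h := Lp.memLp (rieszLp h12 hf'.toLp)
    exact ⟨h.1, (e3 _).symm.trans_lt h.2⟩
  · refine tendsto_of_tendsto_of_tendsto_of_le_of_le tendsto_const_nhds hlim
      (fun _ => bot_le) fun n => ?_
    rw [eLpNorm_sub_comm, ← e3]
    exact ha2 n
  · exact s2.congr fun n => e3 _

end HarmonicOscillator

open HarmonicOscillator in
/-- For the harmonic oscillator on `ℝ^d` the vector `𝐑` of Riesz transforms, given on `L²` by its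
Hermite expansion, has a unique bounded extension from `L^p ∩ L²` to `L^p`, and this extension
satisfies the bound `‖𝐑 f‖_p ≤ 48 (p^* - 1) ‖f‖_p`. -/
theorem theorem5p4 (d : ℕ) (hd : 1 ≤ d) (p : ℝ) (hp : 1 < p) :
    ∃ R : MeasureTheory.Lp ℝ (ENNReal.ofReal p)
          (MeasureTheory.volume : MeasureTheory.Measure (HarmonicOscillator.Space d)) →ₗ[ℝ]
        MeasureTheory.Lp (HarmonicOscillator.Space d) (ENNReal.ofReal p)
          (MeasureTheory.volume : MeasureTheory.Measure (HarmonicOscillator.Space d)),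
      HarmonicOscillator.IsRieszExtension p R ∧
      (∀ R', HarmonicOscillator.IsRieszExtension p R' → R' = R) ∧
      ∀ f, ‖R f‖ ≤ 48 * (HarmonicOscillator.pStar p - 1) * ‖f‖ := by
  have := fact_one_le_ofReal hp
  have hbound : ∀ f, ‖rieszLp (d := d) hp f‖ ≤ 48 * (pStar p - 1) * ‖f‖ := fun f => by
    -- The Bellman function argument gives the constant `36`.
    refine (norm_rieszLp_le hd hp f).trans ?_
    have := one_le_pStar_sub_one hp
    gcongr
    norm_num
  refine ⟨(rieszLp hp).toLinearMap, ⟨⟨_, hbound⟩, isRieszVector_rieszLp hd hp⟩, ?_, hbound⟩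
  rintro R' ⟨⟨C, hC⟩, hR'⟩
  -- Both operators are bounded and agree on the Hermite expansions, which lie in `L²`.
  have heq : ⇑(R'.mkContinuous C hC) = ⇑(rieszLp (d := d) hp) := by
    refine (denseRange_hermiteLp hp).equalizer (R'.mkContinuous C hC).continuous
      (rieszLp hp).continuous (funext fun a => Lp.ext ?_)
    have h2 : MemLp (hermiteLp ℝ hp a) 2 volume :=
      (memLp_congr_ae (coeFn_expansionLp _ _ a)).2
        (memLp_expansion two_ne_zero ENNReal.ofNat_ne_top a)
    exact (hR' _ h2).ae_eq (isRieszVector_rieszLp hd hp _ h2)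
  exact LinearMap.ext fun f => congrFun heq f
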